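/- **Theorem 3.2.** Let $\Bbbk$ be a field. For a finite quiver $Q$ paths are composed from left to right, and an ideal $I$ of $\Bbbk Q$ is admissible if $J^n\subseteq I\subseteq J^2$ for some $n\ge 2$, where $J$ is the ideal generated by the arrows. For a finite dimensional algebra $A$ let $\mathrm{mod}\,A$ be the category of finitely generated right $A$-modules, $\Omega_A(M)$ the kernel of a projective cover of $M$, and $A_0$ the direct sum of representatives of the isomorphism classes of simple $A$-modules. Let $K_0(A)$ be the abelian group generated by the symbols $[M]$, $M\in\mathrm{mod}\,A$, modulo the relations $[M]=[M']+[M'']$ if $M\cong M'\oplus M''$, and $[P]=0$ if $P$ is projective, and let $\bar\Omega_A$ be the endomorphism $[M]\mapsto[\Omega_A(M)]$ of $K_0(A)$. Put $\varphi_A(M)=\min\{n\ge 0:\bar\Omega_A\text{ is injective on }\bar\Omega_A^{\,l}\langle\mathrm{add}\,M\rangle\text{ for all }l\ge n\}$, where $\langle\mathrm{add}\,M\rangle\subseteq K_0(A)$ is the subgroup generated by the classes of the indecomposable direct summands of $M$, and $\varphi\dim(A)=\sup\{\varphi_A(M):M\in\mathrm{mod}\,A\}$. A subgroup $G\subseteq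 K_0(A)$ is syzygy finite if $\bar\Omega_A^{\,n}(G)$ is finitely generated for some $n\ge 0$. Let $A_i=\Bbbk Q_i/I_i$ $(i=1,\dots,m)$ and $C=\Bbbk\Gamma/I_C$ be finite dimensional algebras given by finite quivers and admissible ideals, such that: 1. the vertex set of $\Gamma$ is the disjoint union of the vertex sets of $Q_1,\dots,Q_m$; 2. the arrows of $\Gamma$ are the arrows of $Q_1,\dots,Q_m$ together with connecting arrows $\delta^{i,j}_k$ $(i\ne j,\ k\in K_{i,j})$, each from a vertex of $Q_i$ to a vertex of $Q_j$; 3. $I_C\cap\Bbbk Q_i=I_i$ for every $i$, and $I_C$ contains all products $\alpha\,\delta^{i,j}_k$ of an arrow $\alpha$ of $Q_i$ followed by a connecting arrow, and all products $\delta^{i,j}_k\,\delta^{j,l}_{k'}$ of two connecting arrows. Let $\Pi_{A_i}:\mathrm{mod}\,C\to\mathrm{mod}\,A_i$ be the restriction of representations to the vertices and arrows of $Q_i$, and regard $A_i$-modules as $C$-modules that vanish at the vertices outside $Q_i$. Let $\mathcal O\subseteq K_0(C)$ be the subgroup generated by the classes of all direct summands of the modules $$\Omega_{A_i}^{\,n}\Bigl(\Pi_{A_i}\bigl(\Omega_C\bigl(\textstyle\bigoplus_{j\ne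 i}(A_j)_0\bigr)\bigr)\Bigr),\qquad 1\le i\le m,\ n\ge 0.$$ If $\mathcal O$ is syzygy finite and $\varphi\dim(A_i)<\infty$ for all $i$, then $\varphi\dim(C)<\infty$. -/

import Mathlib

universe u

namespace BoundQuiver

/-! ### Path algebras -/

section PathAlgebra

/-- The set of all paths of a quiver (the paths of length zero are the vertices). -/
abbrev AllPaths (V : Type u) [Quiver.{u} V] : Type u := Σ a b : V, Quiver.Path a b

/-- The underlying vector space of the path algebra: it has the set of all paths as a basis. -/
def PathAlgebra (k : Type u) [Field k] (V : Type u) [Quiver.{u} V] : Type u :=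
  AllPaths V →₀ k

variable (k : Type u) [Field k] (V : Type u) [Quiver.{u} V]

noncomputable instance : AddCommGroup (PathAlgebra k V) :=
  inferInstanceAs (AddCommGroup (AllPaths V →₀ k))

noncomputable instance : Module k (PathAlgebra k V) :=
  inferInstanceAs (Module k (AllPaths V →₀ k))

variable {V}

/-- A path as an element of the path algebra. -/
noncomputable def ofPath {a b : V} (p : Quiver.Path a b) : PathAlgebra k V :=
  Finsupp.single (⟨a, b, p⟩ : AllPaths V) (1 : k)

/-- An arrow as an element of the path algebra. -/
noncomputable def ofArrow {a b : V} (α : a ⟶ b) : PathAlgebra k V := ofPath k α.toPath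

open Classical in
/-- The product of two paths, composed from left to right: `p q` is "first `p`, then `q`" if
`p` ends where `q` starts, and `0` otherwise. -/
noncomputable def pathMul (p q : AllPaths V) : PathAlgebra k V :=
  if h : p.2.1 = q.1 then ofPath k (p.2.2.comp (q.2.2.cast h.symm rfl)) else 0

/-- The bilinear extension of the product of paths. -/
noncomputable def mulHom : PathAlgebra k V →ₗ[k] PathAlgebra k V →ₗ[k] PathAlgebra k V :=
  Finsupp.linearCombination k (fun p : AllPaths V =>
    (Finsupp.linearCombination k (fun q : AllPaths V => pathMul k p q) :
      (AllPaths V →₀ k) →ₗ[k] PathAlgebra k V))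

noncomputable instance : Mul (PathAlgebra k V) := ⟨fun x y => mulHom k x y⟩

variable {k}

theorem mul_eq (x y : PathAlgebra k V) : x * y = mulHom k x y := rfl

theorem mulHom_ofPath {a b c d : V} (p : Quiver.Path a b) (q : Quiver.Path c d) :
    mulHom k (ofPath k p) (ofPath k q) = pathMul k ⟨a, b, p⟩ ⟨c, d, q⟩ := by
  unfold mulHom ofPath
  erw [Finsupp.linearCombination_single, one_smul, Finsupp.linearCombination_single, one_smul]

theorem ofPath_mul_ofPath {a b c : V} (p : Quiver.Path a b) (q : Quiver.Path b c) :
    ofPath k p * ofPath k q = ofPath k (p.comp q) := by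
  rw [mul_eq, mulHom_ofPath]
  simp [pathMul]

theorem ofPath_mul_ofPath_of_ne {a b c d : V} (p : Quiver.Path a b) (q : Quiver.Path c d)
    (h : b ≠ c) : ofPath k p * ofPath k q = 0 := by
  rw [mul_eq, mulHom_ofPath]
  simp [pathMul, h]

theorem induction_ofPath {P : PathAlgebra k V → Prop} (x : PathAlgebra k V) (h0 : P 0)
    (hadd : ∀ x y, P x → P y → P (x + y))
    (hp : ∀ (c : k) (a b : V) (p : Quiver.Path a b), P (c • ofPath k p)) : P x := by
  induction x using Finsupp.induction_linear with
  | zero => exact h0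
  | add f g hf hg => exact hadd f g hf hg
  | single p c =>
    have := hp c p.1 p.2.1 p.2.2
    unfold ofPath at this
    erw [Finsupp.smul_single, smul_eq_mul, mul_one] at this
    exact this

theorem add_mul_aux (x y z : PathAlgebra k V) : (x + y) * z = x * z + y * z := by
  simp [mul_eq]

theorem mul_add_aux (x y z : PathAlgebra k V) : x * (y + z) = x * y + x * z := by
  simp [mul_eq]

theorem zero_mul_aux (x : PathAlgebra k V) : 0 * x = 0 := by simp [mul_eq]

theorem mul_zero_aux (x : PathAlgebra k V) : x * 0 = 0 := by simp [mul_eq]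

theorem smul_mul_aux (c : k) (x y : PathAlgebra k V) : (c • x) * y = c • (x * y) := by
  simp [mul_eq]

theorem mul_smul_aux (c : k) (x y : PathAlgebra k V) : x * (c • y) = c • (x * y) := by
  simp [mul_eq]

theorem mul_assoc_aux (x y z : PathAlgebra k V) : x * y * z = x * (y * z) := by
  induction x using induction_ofPath with
  | h0 => simp only [zero_mul_aux]
  | hadd x x' hx hx' => simp only [add_mul_aux, hx, hx']
  | hp r a b p =>
  simp only [smul_mul_aux]
  congr 1
  induction y using induction_ofPath with
  | h0 => simp only [zero_mul_aux, mul_zero_aux]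
  | hadd x x' hx hx' => simp only [add_mul_aux, mul_add_aux, hx, hx']
  | hp r a' b' q =>
  simp only [smul_mul_aux, mul_smul_aux]
  congr 1
  induction z using induction_ofPath with
  | h0 => simp only [mul_zero_aux]
  | hadd x x' hx hx' => simp only [mul_add_aux, hx, hx']
  | hp r a'' b'' s =>
  simp only [mul_smul_aux]
  congr 1
  by_cases h1 : b = a'
  · subst h1
    by_cases h2 : b' = a''
    · subst h2
      simp only [ofPath_mul_ofPath, Quiver.Path.comp_assoc]
    · rw [ofPath_mul_ofPath, ofPath_mul_ofPath_of_ne _ _ h2, ofPath_mul_ofPath_of_ne _ _ h2,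
        mul_zero_aux]
  · by_cases h2 : b' = a''
    · subst h2
      rw [ofPath_mul_ofPath, ofPath_mul_ofPath_of_ne _ _ h1, ofPath_mul_ofPath_of_ne _ _ h1,
        zero_mul_aux]
    · rw [ofPath_mul_ofPath_of_ne _ _ h1, ofPath_mul_ofPath_of_ne _ _ h2, mul_zero_aux,
        zero_mul_aux]

variable [Fintype V]

/-- The unit of the path algebra is the sum of all vertices. -/
noncomputable instance : One (PathAlgebra k V) :=
  ⟨∑ v : V, ofPath k (Quiver.Path.nil : Quiver.Path v v)⟩

theorem one_eq : (1 : PathAlgebra k V) =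
    ∑ v : V, ofPath k (Quiver.Path.nil : Quiver.Path v v) := rfl

theorem one_mul_aux (x : PathAlgebra k V) : 1 * x = x := by
  induction x using induction_ofPath with
  | h0 => exact mul_zero_aux 1
  | hadd x y hx hy => rw [mul_add_aux, hx, hy]
  | hp r a b p =>
    rw [mul_smul_aux]
    congr 1
    rw [one_eq, mul_eq, map_sum, LinearMap.sum_apply, Finset.sum_eq_single a]
    · rw [← mul_eq, ofPath_mul_ofPath, Quiver.Path.nil_comp]
    · intro v _ hv
      rw [← mul_eq, ofPath_mul_ofPath_of_ne _ _ hv]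
    · simp

theorem mul_one_aux (x : PathAlgebra k V) : x * 1 = x := by
  induction x using induction_ofPath with
  | h0 => exact zero_mul_aux 1
  | hadd x y hx hy => rw [add_mul_aux, hx, hy]
  | hp r a b p =>
    rw [smul_mul_aux]
    congr 1
    rw [one_eq, mul_eq, map_sum, Finset.sum_eq_single b]
    · rw [← mul_eq, ofPath_mul_ofPath, Quiver.Path.comp_nil]
    · intro v _ hv
      rw [← mul_eq, ofPath_mul_ofPath_of_ne _ _ hv.symm]
    · simp

noncomputable instance : Ring (PathAlgebra k V) where
  __ := (inferInstance : AddCommGroup (PathAlgebra k V))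
  mul_assoc := mul_assoc_aux
  one_mul := one_mul_aux
  mul_one := mul_one_aux
  left_distrib := mul_add_aux
  right_distrib := add_mul_aux
  zero_mul := zero_mul_aux
  mul_zero := mul_zero_aux

noncomputable instance : Algebra k (PathAlgebra k V) :=
  Algebra.ofModule smul_mul_aux mul_smul_aux

/-- An admissible ideal `I` of the path algebra: `J ^ n ⊆ I ⊆ J ^ 2` for some `n ≥ 2`, where `J`
is the ideal generated by the arrows. Here `J ^ n` is the span of the paths of length at
least `n`, that is, the set of all elements in which only such paths occur. -/
def IsAdmissible (I : Ideal (PathAlgebra k V)) : Prop :=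
  (∀ x ∈ I, ∀ p ∈ Finsupp.support (α := AllPaths V) (M := k) x, 2 ≤ p.2.2.length) ∧
    ∃ n : ℕ, 2 ≤ n ∧ ∀ (a b : V) (p : Quiver.Path a b), n ≤ p.length → ofPath k p ∈ I

/-- The bound quiver algebra `kQ / I`. -/
abbrev BoundAlgebra (I : Ideal (PathAlgebra k V)) [I.IsTwoSided] : Type u := PathAlgebra k V ⧸ I

theorem isNoetherianRing_mop (k A : Type u) [Field k] [Ring A] [Algebra k A] [Module.Finite k A] :
    IsNoetherianRing Aᵐᵒᵖ :=
  haveI : Module.Finite k Aᵐᵒᵖ := Module.Finite.equiv (MulOpposite.opLinearEquiv k (M := A))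
  isNoetherian_of_tower k (inferInstance : IsNoetherian k Aᵐᵒᵖ)

instance (I : Ideal (PathAlgebra k V)) [I.IsTwoSided] [Module.Finite k (BoundAlgebra I)] :
    IsNoetherianRing (BoundAlgebra I)ᵐᵒᵖ :=
  isNoetherianRing_mop k (BoundAlgebra I)

end PathAlgebra

/-! ### Finitely generated right modules, syzygies, the group `K₀` and the function `φ` -/

section Modules

/-- `mod A`: the finitely generated right `A`-modules. -/
abbrev FGMod (A : Type u) [Ring A] : Type (u + 1) := FGModuleCat.{u} Aᵐᵒᵖ

variable (A : Type u) [Ring A]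

/-- The defining relations of `K₀(A)`: `[M] - [M'] - [M'']` if `M ≅ M' ⊕ M''`, and `[P]` for every
projective `P`. -/
def K0Rel : Set (FreeAbelianGroup (FGMod A)) :=
  {x | ∃ M M' M'' : FGMod A, Nonempty (M ≃ₗ[Aᵐᵒᵖ] (M' × M'')) ∧
      x = FreeAbelianGroup.of M - FreeAbelianGroup.of M' - FreeAbelianGroup.of M''} ∪
    {x | ∃ P : FGMod A, Module.Projective Aᵐᵒᵖ P ∧ x = FreeAbelianGroup.of P}

/-- The group `K₀(A)` of Igusa and Todorov. -/
abbrev K0 : Type (u + 1) := FreeAbelianGroup (FGMod A) ⧸ AddSubgroup.closure (K0Rel A)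

variable {A}

/-- The class `[M]` of a module in `K₀(A)`. -/
def K0.mk (M : FGMod A) : K0 A := QuotientAddGroup.mk (FreeAbelianGroup.of M)

theorem K0.mk_prod {M M' M'' : FGMod A} (e : M ≃ₗ[Aᵐᵒᵖ] (M' × M'')) :
    K0.mk M = K0.mk M' + K0.mk M'' := by
  have h : (QuotientAddGroup.mk (FreeAbelianGroup.of M - FreeAbelianGroup.of M' -
      FreeAbelianGroup.of M'') : K0 A) = 0 :=
    (QuotientAddGroup.eq_zero_iff _).2
      (AddSubgroup.subset_closure (Or.inl ⟨M, M', M'', ⟨e⟩, rfl⟩))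
  rw [QuotientAddGroup.mk_sub, QuotientAddGroup.mk_sub, sub_sub, sub_eq_zero] at h
  exact h

theorem K0.mk_projective (P : FGMod A) (hP : Module.Projective Aᵐᵒᵖ P) : K0.mk P = 0 :=
  (QuotientAddGroup.eq_zero_iff _).2 (AddSubgroup.subset_closure (Or.inr ⟨P, hP, rfl⟩))

theorem K0.mk_eq_of_equiv {M M' : FGMod A} (e : M ≃ₗ[Aᵐᵒᵖ] M') : K0.mk M = K0.mk M' := by
  let Z : FGMod A := FGModuleCat.of Aᵐᵒᵖ PUnit.{u + 1}
  have hZ : K0.mk Z = 0 :=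
    K0.mk_projective Z (inferInstanceAs (Module.Projective Aᵐᵒᵖ PUnit.{u + 1}))
  have e' : M' ≃ₗ[Aᵐᵒᵖ] (M' × Z) := (LinearEquiv.prodUnique (M₂ := PUnit.{u + 1})).symm
  rw [K0.mk_prod (e.trans e'), hZ, add_zero]

/-- `K` is a syzygy `Ω(M)`: the kernel of a projective cover `f : P → M`, that is, of a surjection
from a projective module whose kernel is superfluous. -/
def IsSyzygy (M K : FGMod A) : Prop :=
  ∃ (P : FGMod A) (f : P →ₗ[Aᵐᵒᵖ] M), Module.Projective Aᵐᵒᵖ P ∧ Function.Surjective f ∧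
    (∀ N : Submodule Aᵐᵒᵖ P, LinearMap.ker f ⊔ N = ⊤ → N = ⊤) ∧
    Nonempty (K ≃ₗ[Aᵐᵒᵖ] LinearMap.ker f)

/-- `K` is the `n`-th syzygy `Ωⁿ(M)`, up to isomorphism. -/
inductive IsIterSyzygy : ℕ → FGMod A → FGMod A → Prop
  | zero {M K : FGMod A} (e : M ≃ₗ[Aᵐᵒᵖ] K) : IsIterSyzygy 0 M K
  | succ {n : ℕ} {M L K : FGMod A} (h : IsIterSyzygy n M L) (h' : IsSyzygy L K) :
      IsIterSyzygy (n + 1) M K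

/-- `X` is (isomorphic to) a direct summand of `M`. -/
def IsSummand (X M : FGMod A) : Prop :=
  ∃ Y : FGMod A, Nonempty (M ≃ₗ[Aᵐᵒᵖ] (X × Y))

/-- `M` is indecomposable. -/
def IsIndecomposable (M : FGMod A) : Prop :=
  Nontrivial M ∧ ∀ X Y : FGMod A, Nonempty (M ≃ₗ[Aᵐᵒᵖ] (X × Y)) → Subsingleton X ∨ Subsingleton Y

/-- `M` is isomorphic to `A₀`, the direct sum of representatives of the isomorphism classes of
simple `A`-modules. -/
def IsSumOfSimples (M : FGMod A) : Prop :=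
  ∃ (n : ℕ) (S : Fin n → FGMod A),
    (∀ i, IsSimpleModule Aᵐᵒᵖ (S i)) ∧
    (∀ i j, i ≠ j → IsEmpty (S i ≃ₗ[Aᵐᵒᵖ] S j)) ∧
    (∀ T : FGMod A, IsSimpleModule Aᵐᵒᵖ T → ∃ i, Nonempty (T ≃ₗ[Aᵐᵒᵖ] S i)) ∧
    Nonempty (M ≃ₗ[Aᵐᵒᵖ] (∀ i, S i))

/-- Schanuel's lemma. -/
noncomputable def schanuel {R : Type*} [Ring R] {P Q M : Type*} [AddCommGroup P] [AddCommGroup Q]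
    [AddCommGroup M] [Module R P] [Module R Q] [Module R M] (f : P →ₗ[R] M) (g : Q →ₗ[R] M)
    (s : P →ₗ[R] Q) (t : Q →ₗ[R] P) (hs : g ∘ₗ s = f) (ht : f ∘ₗ t = g) :
    (LinearMap.ker f × Q) ≃ₗ[R] (LinearMap.ker g × P) where
  toFun x := (⟨x.2 - s (x.1 + t x.2), by
      have h1 := LinearMap.congr_fun hs (x.1 + t x.2)
      have h2 := LinearMap.congr_fun ht x.2
      have h3 : f x.1 = 0 := x.1.2
      simp only [LinearMap.comp_apply] at h1 h2
      rw [LinearMap.mem_ker, map_sub, h1, map_add, h2, h3, zero_add, sub_self]⟩, x.1 + t x.2)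
  invFun y := (⟨y.2 - t (y.1 + s y.2), by
      have h1 := LinearMap.congr_fun ht (y.1 + s y.2)
      have h2 := LinearMap.congr_fun hs y.2
      have h3 : g y.1 = 0 := y.1.2
      simp only [LinearMap.comp_apply] at h1 h2
      rw [LinearMap.mem_ker, map_sub, h1, map_add, h2, h3, zero_add, sub_self]⟩, y.1 + s y.2)
  map_add' x y := by
    ext <;> simp <;> abel
  map_smul' c x := by
    ext <;> simp [smul_sub, smul_add]
  left_inv x := by ext <;> simp
  right_inv x := by ext <;> simp

theorem exists_cover (M : FGMod A) : ∃ (P : FGMod A) (f : P →ₗ[Aᵐᵒᵖ] M),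
    Module.Projective Aᵐᵒᵖ P ∧ Function.Surjective f := by
  obtain ⟨n, f, hf⟩ := Module.Finite.exists_fin' Aᵐᵒᵖ M
  exact ⟨FGModuleCat.of Aᵐᵒᵖ (Fin n → Aᵐᵒᵖ), f,
    inferInstanceAs (Module.Projective Aᵐᵒᵖ (Fin n → Aᵐᵒᵖ)), hf⟩

variable [IsNoetherianRing Aᵐᵒᵖ]

/-- The kernel of a map between finitely generated modules. -/
noncomputable abbrev kerMod {P : FGMod A} {M : FGMod A} (f : P →ₗ[Aᵐᵒᵖ] M) : FGMod A :=
  FGModuleCat.of Aᵐᵒᵖ (LinearMap.ker f)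

theorem mk_ker_eq {M M' P Q : FGMod A} (e : M ≃ₗ[Aᵐᵒᵖ] M') (f : P →ₗ[Aᵐᵒᵖ] M)
    (g : Q →ₗ[Aᵐᵒᵖ] M') (hP : Module.Projective Aᵐᵒᵖ P) (hQ : Module.Projective Aᵐᵒᵖ Q)
    (hf : Function.Surjective f) (hg : Function.Surjective g) :
    K0.mk (kerMod f) = K0.mk (kerMod g) := by
  obtain ⟨s, hs⟩ := Module.projective_lifting_property g (e.toLinearMap ∘ₗ f) hg
  obtain ⟨t, ht⟩ := Module.projective_lifting_property (e.toLinearMap ∘ₗ f) g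
    (e.surjective.comp hf)
  have E := schanuel (e.toLinearMap ∘ₗ f) g s t hs ht
  have hk : LinearMap.ker (e.toLinearMap ∘ₗ f) = LinearMap.ker f :=
    LinearEquiv.ker_comp e f
  rw [hk] at E
  have h1 : K0.mk (FGModuleCat.of Aᵐᵒᵖ (LinearMap.ker f × Q)) =
      K0.mk (kerMod f) + K0.mk Q := K0.mk_prod (LinearEquiv.refl _ _)
  have h2 : K0.mk (FGModuleCat.of Aᵐᵒᵖ (LinearMap.ker f × Q)) =
      K0.mk (kerMod g) + K0.mk P := K0.mk_prod E
  rw [K0.mk_projective Q hQ, add_zero] at h1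
  rw [K0.mk_projective P hP, add_zero] at h2
  exact h1.symm.trans h2

/-- The class in `K₀(A)` of the kernel of a surjection from a projective module onto `M`. By
Schanuel's lemma it does not depend on the surjection, see `omegaClass_eq`. -/
noncomputable def omegaClass (M : FGMod A) : K0 A :=
  K0.mk (kerMod (exists_cover M).choose_spec.choose)

theorem omegaClass_eq {M P : FGMod A} (f : P →ₗ[Aᵐᵒᵖ] M) (hP : Module.Projective Aᵐᵒᵖ P)
    (hf : Function.Surjective f) : omegaClass M = K0.mk (kerMod f) :=
  mk_ker_eq (LinearEquiv.refl _ _) _ f (exists_cover M).choose_spec.choose_spec.1 hP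
    (exists_cover M).choose_spec.choose_spec.2 hf

theorem omegaClass_prod {M M' M'' : FGMod A} (e : M ≃ₗ[Aᵐᵒᵖ] (M' × M'')) :
    omegaClass M = omegaClass M' + omegaClass M'' := by
  obtain ⟨P', f', hP', hf'⟩ := exists_cover M'
  obtain ⟨P'', f'', hP'', hf''⟩ := exists_cover M''
  let P : FGMod A := FGModuleCat.of Aᵐᵒᵖ (P' × P'')
  let f : P →ₗ[Aᵐᵒᵖ] M := e.symm.toLinearMap ∘ₗ (LinearMap.prodMap f' f'')
  have hP : Module.Projective Aᵐᵒᵖ P := inferInstanceAs (Module.Projective Aᵐᵒᵖ (P' × P''))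
  have hf : Function.Surjective f := e.symm.surjective.comp (hf'.prodMap hf'')
  rw [omegaClass_eq f hP hf, omegaClass_eq f' hP' hf', omegaClass_eq f'' hP'' hf'']
  refine K0.mk_prod ?_
  have hk : LinearMap.ker f = (LinearMap.ker f').prod (LinearMap.ker f'') := by
    rw [show LinearMap.ker f = LinearMap.ker (LinearMap.prodMap f' f'') from
      LinearEquiv.ker_comp e.symm _, LinearMap.ker_prodMap]
  exact (LinearEquiv.ofEq _ _ hk).trans
    { toFun := fun x => (⟨x.1.1, x.2.1⟩, ⟨x.1.2, x.2.2⟩)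
      invFun := fun y => ⟨(y.1.1, y.2.1), ⟨y.1.2, y.2.2⟩⟩
      map_add' := fun _ _ => rfl
      map_smul' := fun _ _ => rfl
      left_inv := fun _ => rfl
      right_inv := fun _ => rfl }

theorem omegaClass_projective (P : FGMod A) (hP : Module.Projective Aᵐᵒᵖ P) :
    omegaClass P = 0 := by
  rw [omegaClass_eq LinearMap.id hP Function.surjective_id]
  refine K0.mk_projective _ ?_
  have : Subsingleton (LinearMap.ker (LinearMap.id : P →ₗ[Aᵐᵒᵖ] P)) := by
    rw [LinearMap.ker_id]; infer_instance
  exact Module.Projective.of_free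

variable (A) in
/-- The endomorphism `Ω̄` of `K₀(A)` induced by the syzygy, `Ω̄[M] = [Ω(M)]`,
see `omegaBar_mk_of_isSyzygy`. -/
noncomputable def omegaBar : AddMonoid.End (K0 A) :=
  QuotientAddGroup.lift _ (FreeAbelianGroup.lift omegaClass) (by
    rw [AddSubgroup.closure_le]
    rintro x (⟨M, M', M'', ⟨e⟩, rfl⟩ | ⟨P, hP, rfl⟩)
    · simp [AddMonoidHom.mem_ker, omegaClass_prod e]
    · simp [AddMonoidHom.mem_ker, omegaClass_projective P hP])

theorem omegaBar_mk (M : FGMod A) : omegaBar A (K0.mk M) = omegaClass M := by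
  exact FreeAbelianGroup.lift_apply_of omegaClass M

theorem omegaBar_mk_of_isSyzygy {M K : FGMod A} (h : IsSyzygy M K) :
    omegaBar A (K0.mk M) = K0.mk K := by
  obtain ⟨P, f, hP, hf, -, ⟨e⟩⟩ := h
  rw [omegaBar_mk, omegaClass_eq f hP hf]
  exact (K0.mk_eq_of_equiv (M' := kerMod f) e).symm

/-- `η_T(G)`: the least `n` such that `T` is injective on `T ^ m (G)` for all `m ≥ n`
(and `∞` if there is no such `n`). -/
noncomputable def eta {H : Type*} [AddCommGroup H] (T : AddMonoid.End H) (G : AddSubgroup H) : ℕ∞ :=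
  ⨅ n ∈ {n : ℕ | ∀ m : ℕ, n ≤ m → Set.InjOn T (G.map (T ^ m) : AddSubgroup H)}, (n : ℕ∞)

/-- `⟨add M⟩`: the subgroup of `K₀(A)` generated by the classes of the indecomposable direct
summands of `M`. -/
def addSpan (M : FGMod A) : AddSubgroup (K0 A) :=
  AddSubgroup.closure {x | ∃ X : FGMod A, IsIndecomposable X ∧ IsSummand X M ∧ x = K0.mk X}

/-- The Igusa-Todorov function `φ(M) = η_Ω̄(⟨add M⟩)`. -/
noncomputable def phi (M : FGMod A) : ℕ∞ := eta (omegaBar A) (addSpan M)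

variable (A) in
/-- The `φ`-dimension of `A`: the supremum of `φ(M)` over all `M` in `mod A`. -/
noncomputable def phiDim : ℕ∞ := ⨆ M : FGMod A, phi M

/-- A subgroup `G` of `K₀(A)` is syzygy finite if `Ω̄ⁿ(G)` is finitely generated for some `n`. -/
def IsSyzygyFinite (G : AddSubgroup (K0 A)) : Prop :=
  ∃ n : ℕ, (G.map (omegaBar A ^ n)).FG

end Modules

/-! ### Gluing quivers along connecting arrows -/

section Glue

variable {m : ℕ} (Q : Fin m → Type u) (D : ∀ i j : Fin m, Q i → Q j → Type u)

/-- The vertex set of the glued quiver `Γ`: the disjoint union of the vertex sets of the `Q i`. -/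
def Glued (_ : ∀ i j : Fin m, Q i → Q j → Type u) : Type u := Σ i, Q i

instance [∀ i, Fintype (Q i)] : Fintype (Glued Q D) := inferInstanceAs (Fintype (Σ i, Q i))

variable [∀ i, Quiver.{u} (Q i)]

/-- The arrows of the glued quiver `Γ`: those of the quivers `Q i`, and the connecting arrows
`δ : v ⟶ w` for `v` in `Q i`, `w` in `Q j` and `i ≠ j`, which are indexed by `D i j v w`. -/
inductive GluedHom : Glued Q D → Glued Q D → Type u
  | inner {i : Fin m} {v w : Q i} (α : v ⟶ w) : GluedHom ⟨i, v⟩ ⟨i, w⟩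
  | conn {i j : Fin m} (h : i ≠ j) {v : Q i} {w : Q j} (δ : D i j v w) : GluedHom ⟨i, v⟩ ⟨j, w⟩

instance : Quiver.{u} (Glued Q D) := ⟨GluedHom Q D⟩

/-- The inclusion of the quiver `Q i` into `Γ`. -/
def inclQ (i : Fin m) : Q i ⥤q Glued Q D where
  obj v := ⟨i, v⟩
  map α := GluedHom.inner α

/-- The arrow of `Γ` given by an arrow of `Q i`. -/
def innerArrow {i : Fin m} {v w : Q i} (α : v ⟶ w) :
    ((inclQ Q D i).obj v) ⟶ ((inclQ Q D i).obj w) := GluedHom.inner α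

/-- The connecting arrow of `Γ` given by an element of `D i j v w`. -/
def connArrow {i j : Fin m} (h : i ≠ j) {v : Q i} {w : Q j} (δ : D i j v w) :
    ((inclQ Q D i).obj v) ⟶ ((inclQ Q D j).obj w) := GluedHom.conn h δ

variable (k : Type u) [Field k]

/-- The inclusion `kQ i → kΓ`, which sends a path of `Q i` to the same path in `Γ`. -/
noncomputable def incl (i : Fin m) : PathAlgebra k (Q i) →ₗ[k] PathAlgebra k (Glued Q D) :=
  Finsupp.linearCombination k (fun p : AllPaths (Q i) => ofPath k ((inclQ Q D i).mapPath p.2.2))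

variable {Q D k} [∀ i, Fintype (Q i)]
  (I : ∀ i, Ideal (PathAlgebra k (Q i))) [∀ i, (I i).IsTwoSided]
  (IC : Ideal (PathAlgebra k (Glued Q D))) [IC.IsTwoSided]

/-- `φ` identifies the `A i`-module `N` with the restriction `Π_{A i}(M)` of the `C`-module `M` to
the vertices and arrows of `Q i`: it is an isomorphism from `N` onto `M e`, where `e` is the sum of
the vertices of `Q i`, and the elements of `kQ i` act on `N` as they do on `M`. -/
def IsRestrictionMap (i : Fin m) (N : FGMod (BoundAlgebra (I i))) (M : FGMod (BoundAlgebra IC))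
    (φ : N →+ M) : Prop :=
  Function.Injective φ ∧
  (∀ y : M, y ∈ Set.range φ ↔
    MulOpposite.op (Ideal.Quotient.mk IC (incl Q D k i 1)) • y = y) ∧
  ∀ (x : PathAlgebra k (Q i)) (n : N),
    φ (MulOpposite.op (Ideal.Quotient.mk (I i) x) • n) =
      MulOpposite.op (Ideal.Quotient.mk IC (incl Q D k i x)) • φ n

/-- `N ≅ Π_{A i}(M)`, the restriction of `M` to `Q i`. -/
def IsRestriction (i : Fin m) (M : FGMod (BoundAlgebra IC)) (N : FGMod (BoundAlgebra (I i))) :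
    Prop := ∃ φ : N →+ M, IsRestrictionMap I IC i N M φ

/-- `M` is the `A i`-module `N`, regarded as a `C`-module: `N` is the restriction of `M` to `Q i`,
and `M` vanishes at all the other vertices, that is, `M e = M`. -/
def IsInflation (i : Fin m) (N : FGMod (BoundAlgebra (I i))) (M : FGMod (BoundAlgebra IC)) :
    Prop := ∃ φ : N →+ M, IsRestrictionMap I IC i N M φ ∧ Function.Surjective φ

/-- `N ≅ Π_{A i}(Ω_C(⨁_{j ≠ i} (A j)₀))`. -/
def IsOrbitStart (i : Fin m) (N : FGMod (BoundAlgebra (I i))) : Prop :=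
  ∃ (Z : ∀ j : Fin m, FGMod (BoundAlgebra (I j))) (Y : Fin m → FGMod (BoundAlgebra IC))
    (K : FGMod (BoundAlgebra IC)),
    (∀ j, IsSumOfSimples (Z j)) ∧ (∀ j, IsInflation I IC j (Z j) (Y j)) ∧
    IsSyzygy (FGModuleCat.of (BoundAlgebra IC)ᵐᵒᵖ (∀ j : {j : Fin m // j ≠ i}, Y j)) K ∧
    IsRestriction I IC i K N

/-- The subgroup `𝒪 = [∏ᵢ add Orb_{Ω_{A i}}(Π_{A i}(Ω_C(⨁_{j ≠ i} (A j)₀)))]` of `K₀(C)`: it is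
generated by the classes of the direct summands of the `A i`-modules
`Ωⁿ_{A i}(Π_{A i}(Ω_C(⨁_{j ≠ i} (A j)₀)))`, for all `i` and all `n ≥ 0`. -/
def orbitSubgroup : AddSubgroup (K0 (BoundAlgebra IC)) :=
  AddSubgroup.closure {x | ∃ (i : Fin m) (n : ℕ) (N L X : FGMod (BoundAlgebra (I i)))
    (W : FGMod (BoundAlgebra IC)),
    IsOrbitStart I IC i N ∧ IsIterSyzygy n N L ∧ IsSummand X L ∧ IsInflation I IC i X W ∧
    x = K0.mk W}

end Glue

end BoundQuiver

open BoundQuiver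

/-! Finiteness of the `φ`-dimension means that the kernels of the powers of `Ω̄` stabilize: every
class in `K₀` lies in some `⟨add M⟩`, so a bound on all `φ(M)` is a bound on the step after which
iterating `Ω̄` creates no new kernel (`exists_ker_of_phiDim_lt_top`, `phiDim_lt_top_of_ker`). The
theorem thus amounts to transferring this stabilization from the algebras `A i` to `C`.

The relations say that a radical element of `C` followed by a connecting arrow is zero. The radical
of a projective `C`-module is therefore a module over the product of the `A i`, and every syzygy
over `C` is a direct sum of `A i`-modules up to projectives (`IsGluing.omegaBar_mem_inflSpan`). For
an `A i`-module `N`, the part in `A i` of its syzygy over `C` is the syzygy of `N` over `A i`; the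
other parts are sums of finitely many "radical pieces", the parts of the radicals of the
indecomposable projectives (`IsGluing.exists_isSyzygy`).

The comparison map is `ρ : K₀(C) → ∏ K₀(A i)`, induced by the largest quotient that is an `A
i`-module; this functor preserves projectives. Let `B` be generated by the classes of `A i`-modules,
`P` by those of projective `A i`-modules, and `D` by the radical pieces. Then `P` and `D` are
finitely generated, `Ω̄_C` has values in `B`, the kernel of `ρ` on `B` lies in `P`, and on `B` the
map `ρ` commutes with syzygies up to `ρ(D)`. The radical pieces are summands of the modules that
start the orbits, so `D ≤ 𝒪`, and consequently `𝒪` is stable under `Ω̄_C`.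

What remains is linear algebra over `ℤ` (`exists_ker_pow_stable`). Write `T` for `Ω̄_C` and `S` for
the product of the `Ω̄_{A i}`. If `x ∈ B` and `T ^ l x = 0`, then `S ^ l (ρ x) ∈ ρ(𝒪)`; the elements
of `B` with this property form a `T`-stable subgroup `E`. For a fixed large `M` the rank of `T ^ M
(E)` is bounded by a number `R` independent of `l`: the kernel of `ρ` contributes at most the rank
of `P`, and `S ^ l` embeds `S ^ M ρ(E)` into the finitely generated group `S ^ M ρ(𝒪)`. Nonzero
members of a nilpotent orbit in a torsion free group are independent
(`linearIndependent_pow_of_nilpotent`), so `T ^ (M + R) x = 0`. Torsion freeness of `K₀(C)` comes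
from multiplicities of indecomposable summands (`K0.isAddTorsionFree`). -/

namespace BoundQuiver

/-! ### Linear algebra over `ℤ`: stable kernels under a finitely generated perturbation -/

section KernelStability


variable {K L : Type v} [AddCommGroup K] [AddCommGroup L]

/-- A nilpotent orbit in a torsion free group is linearly independent. -/
theorem linearIndependent_pow_of_nilpotent [IsAddTorsionFree K] (T : Module.End ℤ K) (v : K) (n : ℕ)
    (h0 : ∃ l, (T ^ l) v = 0) (hn : (T ^ n) v ≠ 0) :
    LinearIndependent ℤ (fun i : Fin (n + 1) => (T ^ (i : ℕ)) v) := by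
  classical
  obtain ⟨l, hl, hmin⟩ : ∃ l, (T ^ (l + 1)) v = 0 ∧ (T ^ l) v ≠ 0 := by
    have hs := Nat.find_spec h0
    have hm := fun m => Nat.find_min h0 (m := m)
    cases hf : Nat.find h0 with
    | zero => rw [hf] at hs; exact absurd (by simpa using congrArg (T ^ n) hs) hn
    | succ l => rw [hf] at hs hm; exact ⟨l, hs, hm l (Nat.lt_succ_self l)⟩
  have hvan : ∀ j, l < j → (T ^ j) v = 0 := by
    intro j hj
    obtain ⟨d, rfl⟩ := Nat.exists_eq_add_of_lt hj
    rw [show l + d + 1 = d + (l + 1) by ring, pow_add, Module.End.mul_apply, hl, map_zero]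
  have hnl : n ≤ l := by
    by_contra h
    exact hn (hvan n (by omega))
  rw [Fintype.linearIndependent_iff]
  intro c hc
  by_contra! hne
  have hex : ∃ j : ℕ, ∃ h : j < n + 1, c ⟨j, h⟩ ≠ 0 := by
    obtain ⟨i, hi⟩ := hne
    exact ⟨i, i.2, hi⟩
  obtain ⟨hj, hcj⟩ := Nat.find_spec hex
  set j := Nat.find hex with hjdef
  have hmin' : ∀ i : Fin (n + 1), (i : ℕ) < j → c i = 0 := by
    intro i hi
    have := Nat.find_min hex hi
    push Not at this
    exact this i.2
  -- `T ^ l v` is the last nonzero term of the orbit and `j` the least index with nonzero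
  -- coefficient, so `T ^ (l - j)` leaves only the term `c j • T ^ l v` of the relation.
  have h1 := congrArg (T ^ (l - j)) hc
  rw [map_sum, map_zero, Finset.sum_eq_single ⟨j, hj⟩] at h1
  · rw [map_smul, ← Module.End.mul_apply, ← pow_add, Nat.sub_add_cancel (by omega)] at h1
    rcases smul_eq_zero.1 h1 with h | h
    · exact hcj h
    · exact hmin h
  · intro i _ hi
    rcases lt_or_gt_of_ne (fun h => hi (Fin.ext h) : (i : ℕ) ≠ j) with h | h
    · rw [hmin' i h, zero_smul, map_zero]
    · rw [map_smul, ← Module.End.mul_apply, ← pow_add, hvan _ (by omega), smul_zero]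
  · simp

theorem pow_apply_eq_zero_of_le (S : Module.End ℤ L) {n : ℕ}
    (hS : ∀ y, (S ^ (n + 1)) y = 0 → (S ^ n) y = 0) (l : ℕ) :
    ∀ y, (S ^ (l + n)) y = 0 → (S ^ n) y = 0 := by
  induction l with
  | zero => intro y hy; simpa using hy
  | succ l ih =>
    intro y hy
    refine hS y ?_
    rw [pow_succ, Module.End.mul_apply] 
    refine ih (S y) ?_
    rw [← Module.End.mul_apply, ← pow_succ]
    rwa [show l + n + 1 = l + 1 + n by ring]

theorem fg_of_le {X Y : Submodule ℤ K} (hY : Y.FG) (h : X ≤ Y) : X.FG := by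
  have : Module.Finite ℤ Y := Module.Finite.iff_fg.2 hY
  have h2 : (X.comap Y.subtype).FG := IsNoetherian.noetherian _
  have := h2.map Y.subtype
  rwa [Submodule.map_comap_eq, Submodule.range_subtype, inf_eq_right.2 h] at this

theorem rank_lt_of_fg {Y : Submodule ℤ K} (hY : Y.FG) : Module.rank ℤ Y < Cardinal.aleph0 := by
  have : Module.Finite ℤ Y := Module.Finite.iff_fg.2 hY
  exact Module.rank_lt_aleph0 ℤ Y

variable (T : Module.End ℤ K) (S : Module.End ℤ L) (ρ : K →ₗ[ℤ] L) (B P D O : Submodule ℤ K)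

/-- Telescoping: `S ^ (n + 1) ρ - ρ T ^ (n + 1)` equals `S ^ n (S ρ - ρ T) + (S ^ n ρ - ρ T ^ n) T`,
so each step adds one more translate of the error group `ρ(D)`. -/
theorem pow_comm_mod (hTB : ∀ x, T x ∈ B)
    (hcomm : ∀ b ∈ B, ρ (T b) - S (ρ b) ∈ D.map ρ) (n : ℕ) : ∀ b ∈ B,
    (S ^ n) (ρ b) - ρ ((T ^ n) b) ∈ ⨆ a : Fin n, (D.map ρ).map (S ^ (a : ℕ)) := by
  induction n with
  | zero => intro b _; simp
  | succ n ih =>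
    intro b hb
    have h1 := ih (T b) (hTB b)
    have h2 : (S ^ n) (S (ρ b) - ρ (T b)) ∈ (D.map ρ).map (S ^ n) := by
      refine Submodule.mem_map_of_mem ?_
      rw [← neg_sub]; exact Submodule.neg_mem _ (hcomm b hb)
    have e : (S ^ (n + 1)) (ρ b) - ρ ((T ^ (n + 1)) b) =
        (S ^ n) (S (ρ b) - ρ (T b)) + ((S ^ n) (ρ (T b)) - ρ ((T ^ n) (T b))) := by
      rw [pow_succ, pow_succ, Module.End.mul_apply, Module.End.mul_apply, map_sub]; abel
    rw [e]
    refine Submodule.add_mem _ (Submodule.mem_iSup_of_mem (Fin.last n) h2) ?_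
    refine (iSup_le fun a => ?_ : (⨆ a : Fin n, (D.map ρ).map (S ^ (a : ℕ))) ≤ _) h1
    exact le_iSup (fun a : Fin (n + 1) => (D.map ρ).map (S ^ (a : ℕ))) a.castSucc

/-- If `T` is, up to finitely generated subgroups, a perturbation of `S`, and if the kernels of the
powers of `S` stabilize, then so do those of the powers of `T`. -/
theorem exists_ker_pow_stable [IsAddTorsionFree K] (hTB : ∀ x, T x ∈ B)
    (hker : ∀ b ∈ B, ρ b = 0 → b ∈ P) (hP : P.FG) (hD : D.FG) (hDO : D ≤ O) (hOB : O ≤ B)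
    (hTO : ∀ x ∈ O, T x ∈ O) {N : ℕ} (hON : (O.map (T ^ N)).FG)
    (hcomm : ∀ b ∈ B, ρ (T b) - S (ρ b) ∈ D.map ρ) {n : ℕ}
    (hS : ∀ y, (S ^ (n + 1)) y = 0 → (S ^ n) y = 0) :
    ∃ m : ℕ, ∀ l x, (T ^ l) x = 0 → (T ^ m) x = 0 := by
  have hSO : ∀ y ∈ O.map ρ, S y ∈ O.map ρ := by
    rintro _ ⟨x, hx, rfl⟩
    have := Submodule.sub_mem _ (Submodule.mem_map_of_mem (f := ρ) (hTO x hx))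
      (Submodule.map_mono hDO (hcomm x (hOB hx)))
    rwa [sub_sub_cancel] at this
  have hSO' : ∀ a, ∀ y ∈ O.map ρ, (S ^ a) y ∈ O.map ρ := by
    intro a
    induction a with
    | zero => intro y hy; simpa using hy
    | succ a ih => intro y hy; rw [pow_succ, Module.End.mul_apply]; exact ih _ (hSO y hy)
  -- The summand `n` makes every `S ^ l` injective on the image of `S ^ M`; the summand `N` makes `T
  -- ^ M (O)` finitely generated.
  set M := n + N
  set Δ : ℕ → Submodule ℤ L := fun n => ⨆ a : Fin n, (D.map ρ).map (S ^ (a : ℕ)) with hΔ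
  have hΔfg : ∀ n, (Δ n).FG := fun n => Submodule.fg_iSup _ fun a => (hD.map _).map _
  have hΔO : ∀ n, Δ n ≤ O.map ρ := fun n => iSup_le fun a => by
    rintro _ ⟨y, hy, rfl⟩
    exact hSO' _ _ (Submodule.map_mono hDO hy)
  have hOM : (O.map (T ^ M)).FG := by
    have := hON.map (T ^ n)
    rwa [← Submodule.map_comp, ← Module.End.mul_eq_comp, ← pow_add] at this
  -- Finiteness passes from `T` to `S`: the group `S ^ M ρ(O)` lies in `ρ(T ^ M (O)) + Δ M`.
  have hOL : ((O.map ρ).map (S ^ M)).FG := by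
    refine fg_of_le ((hOM.map ρ).sup (hΔfg M)) ?_
    rintro _ ⟨_, ⟨x, hx, rfl⟩, rfl⟩
    have := pow_comm_mod T S ρ B D hTB hcomm M x (hOB hx)
    rw [← sub_add_cancel ((S ^ M) (ρ x)) (ρ ((T ^ M) x))]
    exact Submodule.add_mem _ (Submodule.mem_sup_right this)
      (Submodule.mem_sup_left (Submodule.mem_map_of_mem (Submodule.mem_map_of_mem hx)))
  -- The bound is chosen before `l` and `x`; its independence of `l` is what makes the kernels
  -- stabilize.
  obtain ⟨R, hR⟩ : ∃ R : ℕ, Module.rank ℤ ((O.map ρ).map (S ^ M)) + Module.rank ℤ (Δ M) +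
      Module.rank ℤ P = R :=
    ⟨_, (Cardinal.cast_toNat_of_lt_aleph0 (Cardinal.add_lt_aleph0 (Cardinal.add_lt_aleph0
      (rank_lt_of_fg hOL) (rank_lt_of_fg (hΔfg M))) (rank_lt_of_fg hP))).symm⟩
  have main : ∀ l, ∀ x ∈ B, (T ^ l) x = 0 → (T ^ (M + R)) x = 0 := by
    intro l x hx hxl
    -- `E` contains `x` because `T ^ l x = 0` leaves `S ^ l (ρ x)` inside the error group `Δ l`,
    -- which is contained in `ρ(O)`.
    let E : Submodule ℤ K := B ⊓ (O.map ρ).comap ((S ^ l) ∘ₗ ρ)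
    have hTE : ∀ y ∈ E, T y ∈ E := by
      rintro y ⟨hyB, hy⟩
      refine ⟨hTB y, ?_⟩
      have h1 : ρ (T y) = S (ρ y) + (ρ (T y) - S (ρ y)) := by abel
      change (S ^ l) (ρ (T y)) ∈ O.map ρ
      rw [h1, map_add]
      refine Submodule.add_mem _ ?_ (hSO' _ _ (Submodule.map_mono hDO (hcomm y hyB)))
      rw [← Module.End.mul_apply, ← pow_succ, pow_succ', Module.End.mul_apply]
      exact hSO _ hy
    have hTE' : ∀ a, ∀ y ∈ E, (T ^ a) y ∈ E := by
      intro a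
      induction a with
      | zero => intro y hy; simpa using hy
      | succ a ih => intro y hy; rw [pow_succ, Module.End.mul_apply]; exact ih _ (hTE y hy)
    have hxE : x ∈ E := by
      refine ⟨hx, hΔO l ?_⟩
      have := pow_comm_mod T S ρ B D hTB hcomm l x hx
      rwa [hxl, map_zero, sub_zero] at this
    let V := E.map (T ^ M)
    -- Rank-nullity for `ρ` restricted to `V`: its kernel lies in `P`, and its range lies in `S ^ M
    -- ρ(E) + Δ M`.
    have hrank : Module.rank ℤ V ≤ R := by
      let g : V →ₗ[ℤ] L := ρ ∘ₗ V.subtype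
      have h1 : Module.rank ℤ V = Module.rank ℤ (LinearMap.range g) +
          Module.rank ℤ (LinearMap.ker g) := by
        rw [← (g.quotKerEquivRange).rank_eq, rank_quotient_add_rank_of_isDomain]
      have h2 : Module.rank ℤ (LinearMap.ker g) ≤ Module.rank ℤ P := by
        have hmem : ∀ y : LinearMap.ker g, (V.subtype ∘ₗ (LinearMap.ker g).subtype) y ∈ P := by
          rintro ⟨⟨y, hy⟩, hy'⟩
          refine hker y ?_ hy'
          obtain ⟨z, hz, rfl⟩ := hy
          exact (hTE' M z hz).1
        refine LinearMap.rank_le_of_injective (LinearMap.codRestrict P _ hmem) ?_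
        intro a b hab
        have := congrArg Subtype.val hab
        exact Subtype.ext (Subtype.ext this)
      let W := (E.map ρ).map (S ^ M)
      -- `S ^ l` sends `ρ(E)` into `ρ(O)`, commutes with `S ^ M`, and is injective on the image of
      -- `S ^ M` since `n ≤ M`.
      have h3 : Module.rank ℤ W ≤ Module.rank ℤ ((O.map ρ).map (S ^ M)) := by
        have hmem : ∀ y : W, ((S ^ l) ∘ₗ W.subtype) y ∈ (O.map ρ).map (S ^ M) := by
          rintro ⟨_, ⟨_, ⟨z, hz, rfl⟩, rfl⟩⟩
          refine ⟨(S ^ l) (ρ z), hz.2, ?_⟩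
          change _ = (S ^ l) ((S ^ M) (ρ z))
          rw [← Module.End.mul_apply, ← Module.End.mul_apply, ← pow_add, ← pow_add, add_comm]
        refine LinearMap.rank_le_of_injective (LinearMap.codRestrict _ _ hmem) ?_
        rw [← LinearMap.ker_eq_bot, LinearMap.ker_eq_bot']
        rintro ⟨_, ⟨y, hy, rfl⟩⟩ h
        have h' : (S ^ l) ((S ^ M) y) = 0 := congrArg Subtype.val h
        refine Subtype.ext (?_ : (S ^ M) y = 0)
        rw [← Module.End.mul_apply, ← pow_add, show l + (n + N) = (l + N) + n by ring] at h'
        have := pow_apply_eq_zero_of_le S hS (l + N) y h'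
        rw [show M = N + n from add_comm _ _, pow_add, Module.End.mul_apply, this, map_zero]
      have h4 : LinearMap.range g ≤ W ⊔ Δ M := by
        rintro _ ⟨⟨_, ⟨z, hz, rfl⟩⟩, rfl⟩
        have := pow_comm_mod T S ρ B D hTB hcomm M z hz.1
        change ρ ((T ^ M) z) ∈ _
        rw [← sub_sub_cancel ((S ^ M) (ρ z)) (ρ ((T ^ M) z))]
        exact Submodule.sub_mem _ (Submodule.mem_sup_left
          (Submodule.mem_map_of_mem (Submodule.mem_map_of_mem hz))) (Submodule.mem_sup_right this)
      have h5 : Module.rank ℤ (LinearMap.range g) ≤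
          Module.rank ℤ ((O.map ρ).map (S ^ M)) + Module.rank ℤ (Δ M) :=
        (Submodule.rank_mono h4).trans ((Submodule.rank_add_le_rank_add_rank _ _).trans
          (add_le_add_left h3 _))
      rw [h1, ← hR]
      exact add_le_add h5 h2
    -- Otherwise `V` would contain the `R + 1` independent elements `T ^ i (T ^ M x)`, `0 ≤ i ≤ R`.
    by_contra hne
    have hli := linearIndependent_pow_of_nilpotent T ((T ^ M) x) R
      ⟨l, by rw [← Module.End.mul_apply, ← pow_add, add_comm, pow_add, Module.End.mul_apply, hxl,
        map_zero]⟩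
      (by rwa [← Module.End.mul_apply, ← pow_add, add_comm])
    have hmemV : ∀ i : Fin (R + 1), (T ^ (i : ℕ)) ((T ^ M) x) ∈ V := by
      intro i
      refine ⟨(T ^ (i : ℕ)) x, hTE' _ _ hxE, ?_⟩
      rw [← Module.End.mul_apply, ← Module.End.mul_apply, ← pow_add, ← pow_add, add_comm]
    have hli' : LinearIndependent ℤ (fun i : Fin (R + 1) => (⟨_, hmemV i⟩ : V)) :=
      LinearIndependent.of_comp V.subtype hli
    have := hli'.cardinal_lift_le_rank
    simp only [Cardinal.mk_fin, Cardinal.lift_natCast] at this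
    have h6 : ((R + 1 : ℕ) : Cardinal) ≤ R := by
      refine this.trans ?_
      simpa only [Cardinal.lift_uzero] using hrank
    exact absurd (Nat.cast_le.1 h6) (by omega)
  -- The extra power moves an arbitrary `x` into `B`.
  refine ⟨M + R + 1, fun l x hx => ?_⟩
  rw [pow_succ, Module.End.mul_apply]
  refine main l (T x) (hTB x) ?_
  rw [← Module.End.mul_apply, ← pow_succ, pow_succ', Module.End.mul_apply, hx, map_zero]

end KernelStability


/-! ### Multiplicity of an indecomposable module as a direct summand -/

section RadicalHom

variable {R : Type*} [Ring R] {X M N : Type*} [AddCommGroup X] [Module R X] [AddCommGroup M]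
  [Module R M] [AddCommGroup N] [Module R N]

/-- An endomorphism of a module of finite length without nontrivial direct summands is invertible
or nilpotent. -/
theorem isUnit_or_isNilpotent_of_isCompl [IsArtinian R X] [IsNoetherian R X]
    (hX : ∀ p q : Submodule R X, IsCompl p q → p = ⊥ ∨ q = ⊥) (f : Module.End R X) :
    IsUnit f ∨ IsNilpotent f := by
  -- Fitting's lemma. The exponent `n + 1` below is used because it is nonzero, so that
  -- invertibility of the power gives invertibility of `f`.
  obtain ⟨n, hn⟩ := Filter.eventually_atTop.1 (LinearMap.eventually_isCompl_ker_pow_range_pow f)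
  have hc := hn (n + 1) n.le_succ
  rcases hX _ _ hc with h | h
  · left
    rw [h] at hc
    have hr : LinearMap.range (f ^ (n + 1)) = ⊤ := by simpa using hc.sup_eq_top
    have hu : IsUnit (f ^ (n + 1)) := (Module.End.isUnit_iff _).2
      ⟨LinearMap.ker_eq_bot.1 h, LinearMap.range_eq_top.1 hr⟩
    exact (isUnit_pow_iff n.succ_ne_zero).1 hu
  · exact Or.inr ⟨n + 1, LinearMap.range_eq_bot.1 h⟩

/-- Postcomposition, as a map of modules over the endomorphisms of the source. -/
def postcomp (X : Type*) [AddCommGroup X] [Module R X] (h : M →ₗ[R] N) :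
    (X →ₗ[R] M) →ₗ[(Module.End R X)ᵈᵐᵃ] (X →ₗ[R] N) where
  toFun f := h ∘ₗ f
  map_add' f g := LinearMap.comp_add f g h
  map_smul' a f := by ext x; rfl

variable [IsNoetherian R X] (hX : ∀ f : Module.End R X, IsUnit f ∨ IsNilpotent f)

theorem isUnit_or_isUnit_of_add_eq_one {R X : Type*} [Ring R] [AddCommGroup X] [Module R X]
    (hX : ∀ f : Module.End R X, IsUnit f ∨ IsNilpotent f) {a b : Module.End R X} (h : a + b = 1) :
    IsUnit a ∨ IsUnit b := by
  rcases hX a with ha | ha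
  · exact Or.inl ha
  · right
    rw [← eq_sub_iff_add_eq'] at h
    rw [h]
    exact ha.isUnit_one_sub

/-- The maps `X → M` that do not split off any copy of `X` from `M`. -/
def radHom (M : Type*) [AddCommGroup M] [Module R M] :
    Submodule (Module.End R X)ᵈᵐᵃ (X →ₗ[R] M) where
  -- `Subsingleton X` plays the role of falsity; in this form zero belongs to the set without
  -- assuming `X` nontrivial.
  carrier := {f | ∀ (g : M →ₗ[R] X), IsUnit (g ∘ₗ f : Module.End R X) → Subsingleton X}
  zero_mem' g h := by
    rw [LinearMap.comp_zero] at h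
    have := ((Module.End.isUnit_iff _).1 h).1
    exact ⟨fun a b => this rfl⟩
  add_mem' := by
    intro a b ha hb g h
    obtain ⟨u, hu⟩ := h
    have h1 : (((↑u⁻¹ : Module.End R X) ∘ₗ g) ∘ₗ a : Module.End R X) +
        (((↑u⁻¹ : Module.End R X) ∘ₗ g) ∘ₗ b : Module.End R X) = 1 := by
      rw [← LinearMap.comp_add, LinearMap.comp_assoc, LinearMap.comp_add, ← LinearMap.comp_add, ← hu]
      exact u.inv_mul
    rcases isUnit_or_isUnit_of_add_eq_one hX h1 with h | h
    · exact ha _ h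
    · exact hb _ h
  smul_mem' := by
    intro a f hf g h
    refine hf g ?_
    rw [Module.End.isUnit_iff] at h ⊢
    -- Bijectivity of `g ∘ f ∘ a` gives surjectivity of `g ∘ f`, and a surjective endomorphism of a
    -- Noetherian module is bijective.
    refine IsNoetherian.bijective_of_surjective_endomorphism _ fun y => ?_
    obtain ⟨x, hx⟩ := h.2 y
    exact ⟨DomMulAct.mk.symm a • x, hx⟩

theorem postcomp_mem_radHom {f : X →ₗ[R] M} (hf : f ∈ radHom hX M) (h : M →ₗ[R] N) :
    h ∘ₗ f ∈ radHom hX N := fun g hg => hf (g ∘ₗ h) hg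

/-- The multiplicity of `X` as a direct summand of `M`. -/
noncomputable def multiplicityIn (M : Type*) [AddCommGroup M] [Module R M] : ℕ∞ :=
  Module.length (Module.End R X)ᵈᵐᵃ ((X →ₗ[R] M) ⧸ radHom hX M)

/-- Isolates the additivity of the multiplicity: `H`, `H₁`, `H₂` will be the groups of maps from `X`
into a module and its two summands, and `r`, `r₁`, `r₂` the maps that split off no copy of `X`. -/
theorem length_quotient_eq_add {E H H₁ H₂ : Type*} [Ring E] [AddCommGroup H] [AddCommGroup H₁]
    [AddCommGroup H₂] [Module E H] [Module E H₁] [Module E H₂] (a : H →ₗ[E] H₁) (b : H →ₗ[E] H₂)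
    (r : Submodule E H) (r₁ : Submodule E H₁) (r₂ : Submodule E H₂)
    (hs : ∀ x y, ∃ z, a z = x ∧ b z = y) (hr : ∀ z, z ∈ r ↔ a z ∈ r₁ ∧ b z ∈ r₂) :
    Module.length E (H ⧸ r) = Module.length E (H₁ ⧸ r₁) + Module.length E (H₂ ⧸ r₂) := by
  let F : H →ₗ[E] ((H₁ ⧸ r₁) × (H₂ ⧸ r₂)) := LinearMap.prod (r₁.mkQ ∘ₗ a) (r₂.mkQ ∘ₗ b)
  have hF : Function.Surjective F := by
    rintro ⟨x, y⟩
    obtain ⟨x, rfl⟩ := Submodule.mkQ_surjective _ x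
    obtain ⟨y, rfl⟩ := Submodule.mkQ_surjective _ y
    obtain ⟨z, rfl, rfl⟩ := hs x y
    exact ⟨z, rfl⟩
  have hk : LinearMap.ker F = r := by
    ext z
    rw [hr]
    exact Prod.ext_iff.trans (and_congr (Submodule.Quotient.mk_eq_zero _)
      (Submodule.Quotient.mk_eq_zero _))
  rw [← Module.length_prod, ← (LinearMap.quotKerEquivOfSurjective F hF).length_eq]
  exact (Submodule.quotEquivOfEq _ _ hk.symm).length_eq

theorem multiplicityIn_prod {M' M'' : Type*} [AddCommGroup M'] [Module R M'] [AddCommGroup M'']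
    [Module R M''] (e : M ≃ₗ[R] (M' × M'')) :
    multiplicityIn hX M = multiplicityIn hX M' + multiplicityIn hX M'' := by
  refine length_quotient_eq_add (postcomp X (LinearMap.fst R M' M'' ∘ₗ e.toLinearMap))
    (postcomp X (LinearMap.snd R M' M'' ∘ₗ e.toLinearMap)) _ _ _ (fun a b => ?_) (fun f => ?_)
  · refine ⟨e.symm.toLinearMap ∘ₗ (a.prod b), ?_, ?_⟩
    · exact LinearMap.ext fun x => congrArg Prod.fst (e.apply_symm_apply (a x, b x))
    · exact LinearMap.ext fun x => congrArg Prod.snd (e.apply_symm_apply (a x, b x))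
  · refine ⟨fun h => ⟨postcomp_mem_radHom hX h _, postcomp_mem_radHom hX h _⟩, fun h => ?_⟩
    -- `f` is the sum of its two components, each pushed back into `M`.
    have h2 := (radHom hX M).add_mem
      (postcomp_mem_radHom hX h.1 (e.symm.toLinearMap ∘ₗ LinearMap.inl R M' M''))
      (postcomp_mem_radHom hX h.2 (e.symm.toLinearMap ∘ₗ LinearMap.inr R M' M''))
    convert h2 using 1
    refine LinearMap.ext fun x => ?_
    change f x = e.symm ((e (f x)).1, 0) + e.symm (0, (e (f x)).2)
    rw [← map_add]
    simp

theorem multiplicityIn_eq_zero [Nontrivial X]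
    (h : ∀ (f : X →ₗ[R] M) (g : M →ₗ[R] X), ¬ IsUnit (g ∘ₗ f : Module.End R X)) :
    multiplicityIn hX M = 0 := by
  unfold multiplicityIn
  rw [Module.length_eq_zero_iff, Submodule.Quotient.subsingleton_iff, eq_top_iff]
  intro f _ g hg
  exact absurd hg (h f g)

/-- The endomorphism ring is local: an endomorphism outside the radical is injective, hence not
nilpotent, hence a unit. It therefore generates all of `End X`, so the radical is a maximal
submodule. -/
theorem multiplicityIn_self [Nontrivial X] : multiplicityIn hX X = 1 := by
  unfold multiplicityIn
  rw [Module.length_eq_one_iff, isSimpleModule_iff_isCoatom]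
  constructor
  · intro h
    have h1 : (LinearMap.id : X →ₗ[R] X) ∈ radHom hX X := h ▸ trivial
    exact not_subsingleton X (h1 LinearMap.id isUnit_one)
  · intro p hp
    obtain ⟨f, hfp, hf⟩ := SetLike.exists_of_lt hp
    have hu : IsUnit (f : Module.End R X) := by
      by_contra hu
      refine hf fun g hg => absurd ?_ hu
      rw [Module.End.isUnit_iff] at hg ⊢
      have hi : Function.Injective f := fun a b hab => hg.1 (congrArg g hab)
      rcases hX f with h | h
      · exact (Module.End.isUnit_iff _).1 h
      · exact absurd ((Module.End.isUnit_iff _).2 ⟨hi, (by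
          obtain ⟨n, hn⟩ := h
          have : Function.Injective (f ^ n : Module.End R X) := by
            rw [Module.End.coe_pow]; exact hi.iterate n
          rw [hn] at this
          intro y
          exact ⟨0, this rfl⟩)⟩) hu
    rw [eq_top_iff]
    intro h _
    obtain ⟨u, hu⟩ := hu
    have := p.smul_mem (DomMulAct.mk ((↑u⁻¹ : Module.End R X) * h)) hfp
    convert this using 1
    ext x
    rw [DomMulAct.mk_smul_linearMap_apply, ← hu]
    change h x = ((u : Module.End R X) * (↑u⁻¹ * h)) x
    rw [← mul_assoc, u.mul_inv, one_mul]

end RadicalHom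

/-! ### Decomposition into indecomposables and torsion freeness of `K₀` -/

section KrullSchmidt

variable {A : Type u} [Ring A]

/-- An additive function on modules that vanishes on projective modules, as a function on `K₀`. -/
def K0.liftFun {H : Type*} [AddCommGroup H] (d : FGMod A → H)
    (hd : ∀ M M' M'' : FGMod A, (M ≃ₗ[Aᵐᵒᵖ] (M' × M'')) → d M = d M' + d M'')
    (hp : ∀ P : FGMod A, Module.Projective Aᵐᵒᵖ P → d P = 0) : K0 A →+ H :=
  QuotientAddGroup.lift _ (FreeAbelianGroup.lift d) (by
    rw [AddSubgroup.closure_le]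
    rintro x (⟨M, M', M'', ⟨e⟩, rfl⟩ | ⟨P, hP, rfl⟩)
    · simp [AddMonoidHom.mem_ker, hd _ _ _ e]
    · simp [AddMonoidHom.mem_ker, hp P hP])

theorem K0.liftFun_mk {H : Type*} [AddCommGroup H] (d : FGMod A → H) (hd) (hp) (M : FGMod A) :
    K0.liftFun d hd hp (K0.mk M) = d M :=
  FreeAbelianGroup.lift_apply_of d M

theorem K0.induction_mk {p : K0 A → Prop} (hmk : ∀ M, p (K0.mk M)) (hneg : ∀ x, p x → p (-x))
    (hadd : ∀ x y, p x → p y → p (x + y)) (x : K0 A) : p x := by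
  obtain ⟨x, rfl⟩ := QuotientAddGroup.mk_surjective x
  induction x using FreeAbelianGroup.induction_on with
  | zero =>
    have := hadd _ _ (hmk (FGModuleCat.of Aᵐᵒᵖ PUnit.{u + 1})) (hneg _ (hmk (FGModuleCat.of Aᵐᵒᵖ PUnit.{u + 1})))
    rwa [add_neg_cancel] at this
  | of M => exact hmk M
  | neg M h => exact hneg _ h
  | add x y hx hy => exact hadd _ _ hx hy

theorem K0.mk_prod' (M N : FGMod A) :
    K0.mk (FGModuleCat.of Aᵐᵒᵖ (M × N)) = K0.mk M + K0.mk N :=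
  K0.mk_prod (LinearEquiv.refl Aᵐᵒᵖ (M × N))

/-- Every element of `K₀(A)` is a difference of two classes of modules. -/
theorem K0.exists_eq_sub (x : K0 A) : ∃ M N : FGMod A, x = K0.mk M - K0.mk N := by
  induction x using K0.induction_mk with
  | hmk M =>
    refine ⟨M, FGModuleCat.of Aᵐᵒᵖ PUnit.{u + 1}, ?_⟩
    rw [K0.mk_projective (FGModuleCat.of Aᵐᵒᵖ PUnit.{u + 1})
      (inferInstanceAs (Module.Projective Aᵐᵒᵖ PUnit.{u + 1})), sub_zero]
  | hneg x h =>
    obtain ⟨M, N, rfl⟩ := h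
    exact ⟨N, M, neg_sub _ _⟩
  | hadd x y hx hy =>
    obtain ⟨M, N, rfl⟩ := hx
    obtain ⟨M', N', rfl⟩ := hy
    refine ⟨FGModuleCat.of Aᵐᵒᵖ (M × M'), FGModuleCat.of Aᵐᵒᵖ (N × N'), ?_⟩
    rw [K0.mk_prod' M M', K0.mk_prod' N N']
    abel

theorem IsSummand.trans_left {M X Y M' : FGMod A} (h : IsSummand M M')
    (e : M ≃ₗ[Aᵐᵒᵖ] (X × Y)) : IsSummand X M' := by
  obtain ⟨Z, ⟨f⟩⟩ := h
  exact ⟨FGModuleCat.of Aᵐᵒᵖ (Y × Z),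
    ⟨f.trans ((e.prodCongr (LinearEquiv.refl _ _)).trans (LinearEquiv.prodAssoc _ _ _ _))⟩⟩

variable [IsArtinianRing Aᵐᵒᵖ] [IsNoetherianRing Aᵐᵒᵖ]

/-- Modules of finite length are built from indecomposable ones by direct sums. -/
theorem FGMod.induction_indecomposable {p : FGMod A → Prop}
    (h0 : ∀ M : FGMod A, Subsingleton M → p M) (h1 : ∀ M, IsIndecomposable M → p M)
    (h2 : ∀ M X Y : FGMod A, (M ≃ₗ[Aᵐᵒᵖ] (X × Y)) → p X → p Y → p M) (M : FGMod A) : p M := by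
  have key : ∀ (n : ℕ) (M : FGMod A), Module.length Aᵐᵒᵖ M = n → p M := by
    intro n
    induction n using Nat.strong_induction_on with
    | _ n ih =>
    intro M hM
    by_cases hs : Subsingleton M
    · exact h0 M hs
    rw [not_subsingleton_iff_nontrivial] at hs
    by_cases hi : IsIndecomposable M
    · exact h1 M hi
    have hi' : ¬ ∀ X Y : FGMod A, Nonempty (M ≃ₗ[Aᵐᵒᵖ] (X × Y)) → Subsingleton X ∨ Subsingleton Y :=
      fun h => hi ⟨hs, h⟩
    push Not at hi'
    obtain ⟨X, Y, ⟨e⟩, hX, hY⟩ := hi'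
    have hlen : Module.length Aᵐᵒᵖ X + Module.length Aᵐᵒᵖ Y = n := by
      rw [← Module.length_prod, ← e.length_eq, hM]
    have hXpos : 0 < Module.length Aᵐᵒᵖ X := Module.length_pos
    have hYpos : 0 < Module.length Aᵐᵒᵖ Y := Module.length_pos
    obtain ⟨a, ha⟩ := ENat.ne_top_iff_exists.1 (Module.length_ne_top (R := Aᵐᵒᵖ) (M := X))
    obtain ⟨b, hb⟩ := ENat.ne_top_iff_exists.1 (Module.length_ne_top (R := Aᵐᵒᵖ) (M := Y))
    rw [← ha, ← hb] at hlen
    rw [← ha] at hXpos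
    rw [← hb] at hYpos
    norm_cast at hlen hXpos hYpos
    exact h2 M X Y e (ih a (by omega) X ha.symm) (ih b (by omega) Y hb.symm)
  obtain ⟨a, ha⟩ := ENat.ne_top_iff_exists.1 (Module.length_ne_top (R := Aᵐᵒᵖ) (M := M))
  exact key a M ha.symm

/-- The generators of `⟨add M'⟩` are indecomposable summands only; an arbitrary summand is reached
by decomposing it. -/
theorem mk_mem_addSpan (M : FGMod A) : ∀ M' : FGMod A, IsSummand M M' → K0.mk M ∈ addSpan M' := by
  induction M using FGMod.induction_indecomposable with
  | h0 M h =>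
    intro M' _
    rw [K0.mk_projective M Module.Projective.of_free]
    exact zero_mem _
  | h1 M h => exact fun M' hM' => AddSubgroup.subset_closure ⟨M, h, hM', rfl⟩
  | h2 M X Y e hX hY =>
    intro M' hM'
    rw [K0.mk_prod e]
    exact add_mem (hX M' (hM'.trans_left e))
      (hY M' (hM'.trans_left (e.trans (LinearEquiv.prodComm _ _ _))))

theorem K0.exists_mem_addSpan (x : K0 A) : ∃ M : FGMod A, x ∈ addSpan M := by
  obtain ⟨M, N, rfl⟩ := x.exists_eq_sub
  refine ⟨FGModuleCat.of Aᵐᵒᵖ (M × N), sub_mem (mk_mem_addSpan M _ ⟨N, ⟨LinearEquiv.refl _ _⟩⟩)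
    (mk_mem_addSpan N _ ⟨M, ⟨LinearEquiv.prodComm _ _ _⟩⟩)⟩

theorem IsIndecomposable.eq_bot_or_eq_bot {A : Type u} [Ring A] [IsNoetherianRing Aᵐᵒᵖ]
    {X : FGMod A} (h : IsIndecomposable X)
    (p q : Submodule Aᵐᵒᵖ X) (hpq : IsCompl p q) : p = ⊥ ∨ q = ⊥ := by
  have := h.2 (FGModuleCat.of Aᵐᵒᵖ p) (FGModuleCat.of Aᵐᵒᵖ q)
    ⟨(Submodule.prodEquivOfIsCompl p q hpq).symm⟩
  refine this.imp (fun h => ?_) (fun h => ?_)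
  · exact Submodule.subsingleton_iff_eq_bot.1 h
  · exact Submodule.subsingleton_iff_eq_bot.1 h

theorem IsIndecomposable.isUnit_or_isNilpotent {X : FGMod A} (h : IsIndecomposable X)
    (f : Module.End Aᵐᵒᵖ X) : IsUnit f ∨ IsNilpotent f :=
  isUnit_or_isNilpotent_of_isCompl h.eq_bot_or_eq_bot f

/-- A map from a nonzero module with a left inverse onto an indecomposable module is
an isomorphism. -/
theorem IsIndecomposable.nonempty_equiv {A : Type u} [Ring A] [IsNoetherianRing Aᵐᵒᵖ]
    {X Y : FGMod A} (hX : Nontrivial X)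
    (hY : IsIndecomposable Y) (f : X →ₗ[Aᵐᵒᵖ] Y) (g : Y →ₗ[Aᵐᵒᵖ] X)
    (h : IsUnit (g ∘ₗ f : Module.End Aᵐᵒᵖ X)) : Nonempty (X ≃ₗ[Aᵐᵒᵖ] Y) := by
  obtain ⟨u, hu⟩ := h
  let g' : Y →ₗ[Aᵐᵒᵖ] X := (↑u⁻¹ : Module.End Aᵐᵒᵖ X) ∘ₗ g
  have hgf : g' ∘ₗ f = LinearMap.id := by
    rw [LinearMap.comp_assoc, ← hu]; exact u.inv_mul
  have hgf' : ∀ x, g' (f x) = x := fun x => LinearMap.congr_fun hgf x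
  have hinj : Function.Injective f := Function.LeftInverse.injective hgf'
  have hc : IsCompl (LinearMap.range f) (LinearMap.ker g') := by
    -- The idempotent `f ∘ g'` splits `Y` into the image of `X` and the kernel of `g'`, one of which
    -- has to vanish.
    refine IsCompl.of_eq (eq_bot_iff.2 ?_) (eq_top_iff.2 fun y _ => ?_)
    · rintro _ ⟨⟨x, rfl⟩, hx⟩
      have : g' (f x) = 0 := hx
      rw [hgf'] at this
      simp [this]
    · rw [← add_sub_cancel (f (g' y)) y]
      refine Submodule.add_mem_sup ⟨_, rfl⟩ ?_
      rw [LinearMap.mem_ker, map_sub, hgf', sub_self]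
  rcases hY.eq_bot_or_eq_bot _ _ hc with h | h
  · exfalso
    obtain ⟨x, hx⟩ := exists_ne (0 : X)
    refine hx (hinj ?_)
    rw [LinearMap.range_eq_bot.1 h]; simp
  · refine ⟨LinearEquiv.ofBijective f ⟨hinj, ?_⟩⟩
    rw [h] at hc
    rw [← LinearMap.range_eq_top]
    simpa using hc.sup_eq_top

/-- By additivity only indecomposable `M` matter. There the multiplicity vanishes unless `M ≅ X`, in
which case it is bounded by the multiplicity of `X` in itself. -/
theorem multiplicityIn_ne_top {X : FGMod A} (h : IsIndecomposable X) (M : FGMod A) :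
    multiplicityIn h.isUnit_or_isNilpotent M ≠ ⊤ := by
  have := h.1
  induction M using FGMod.induction_indecomposable with
  | h0 M hM =>
    rw [multiplicityIn_eq_zero]
    · simp
    · intro f g hu
      obtain ⟨x, hx⟩ := exists_ne (0 : X)
      refine hx (((Module.End.isUnit_iff _).1 hu).1 ?_)
      simp [Subsingleton.elim (f x) 0]
  | h1 Y hY =>
    by_cases he : Nonempty (X ≃ₗ[Aᵐᵒᵖ] Y)
    · obtain ⟨e⟩ := he
      -- A zero summand turns the isomorphism into a decomposition, so that additivity also
      -- transports the value along it.
      have h1 := multiplicityIn_prod h.isUnit_or_isNilpotent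
        (e.trans (LinearEquiv.prodUnique (M₂ := PUnit.{u + 1})).symm)
      rw [multiplicityIn_self] at h1
      intro hY
      rw [hY] at h1
      simp at h1
    · rw [multiplicityIn_eq_zero]
      · simp
      · exact fun f g hu => he (hY.nonempty_equiv h.1 f g hu)
  | h2 M X' Y' e hX hY =>
    rw [multiplicityIn_prod _ e]
    simp [hX, hY]

/-- The multiplicity of a non-projective indecomposable module, as a function on `K₀(A)`. -/
noncomputable def K0.multiplicity {X : FGMod A} (h : IsIndecomposable X)
    (hX : ¬ Module.Projective Aᵐᵒᵖ X) : K0 A →+ ℤ :=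
  K0.liftFun (fun M => ((multiplicityIn h.isUnit_or_isNilpotent M).toNat : ℤ))
    (fun M M' M'' e => by
      rw [multiplicityIn_prod _ e, ENat.toNat_add (multiplicityIn_ne_top h _)
        (multiplicityIn_ne_top h _)]
      push_cast; rfl)
    (fun P hP => by
      have := h.1
      rw [multiplicityIn_eq_zero]
      · simp
      · rintro f g ⟨u, hu⟩
        refine hX (Module.Projective.of_split f ((↑u⁻¹ : Module.End Aᵐᵒᵖ X) ∘ₗ g) ?_)
        rw [LinearMap.comp_assoc, ← hu]; exact u.inv_mul)

theorem K0.multiplicity_mk_self {X : FGMod A} (h : IsIndecomposable X)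
    (hX : ¬ Module.Projective Aᵐᵒᵖ X) : K0.multiplicity h hX (K0.mk X) = 1 := by
  have := h.1
  unfold K0.multiplicity
  rw [K0.liftFun_mk, multiplicityIn_self]
  simp

theorem K0.multiplicity_mk_of_isEmpty {X Y : FGMod A} (h : IsIndecomposable X)
    (hX : ¬ Module.Projective Aᵐᵒᵖ X) (hY : IsIndecomposable Y)
    (he : ¬ Nonempty (X ≃ₗ[Aᵐᵒᵖ] Y)) : K0.multiplicity h hX (K0.mk Y) = 0 := by
  have := h.1
  unfold K0.multiplicity
  rw [K0.liftFun_mk, multiplicityIn_eq_zero]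
  · simp
  · exact fun f g hu => he (hY.nonempty_equiv h.1 f g hu)

variable (A) in
/-- Isomorphism of modules. -/
def isoSetoid : Setoid (FGMod A) where
  r X Y := Nonempty (X ≃ₗ[Aᵐᵒᵖ] Y)
  iseqv := ⟨fun _ => ⟨LinearEquiv.refl _ _⟩, fun ⟨e⟩ => ⟨e.symm⟩, fun ⟨e⟩ ⟨f⟩ => ⟨e.trans f⟩⟩

variable (A) in
/-- The isomorphism classes of non-projective indecomposable modules. -/
abbrev IndecClass : Type (u + 1) := {c : Quotient (isoSetoid A) //
  IsIndecomposable c.out ∧ ¬ Module.Projective Aᵐᵒᵖ c.out}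

theorem K0.exists_finsupp (x : K0 A) :
    ∃ a : IndecClass A →₀ ℤ, x = a.sum fun c n => n • K0.mk c.1.out := by
  classical
  have hmk : ∀ M : FGMod A, ∃ a : IndecClass A →₀ ℤ,
      K0.mk M = a.sum fun c n => n • K0.mk c.1.out := by
    intro M
    induction M using FGMod.induction_indecomposable with
    | h0 M h => exact ⟨0, by rw [K0.mk_projective M Module.Projective.of_free]; simp⟩
    | h1 M h =>
      by_cases hP : Module.Projective Aᵐᵒᵖ M
      · exact ⟨0, by rw [K0.mk_projective M hP]; simp⟩
      obtain ⟨e⟩ : Nonempty ((Quotient.mk (isoSetoid A) M).out ≃ₗ[Aᵐᵒᵖ] M) :=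
        Quotient.exact (Quotient.out_eq (Quotient.mk (isoSetoid A) M))
      refine ⟨Finsupp.single ⟨Quotient.mk (isoSetoid A) M, ?_, ?_⟩ 1, ?_⟩
      · refine ⟨?_, fun X Y ⟨f⟩ => h.2 X Y ⟨e.symm.trans f⟩⟩
        have := h.1
        exact e.toEquiv.nontrivial
      · exact fun h => hP (Module.Projective.of_equiv e)
      · rw [Finsupp.sum_single_index (by simp), one_smul]
        exact (K0.mk_eq_of_equiv e).symm
    | h2 M X Y e hX hY =>
      obtain ⟨a, ha⟩ := hX
      obtain ⟨b, hb⟩ := hY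
      exact ⟨a + b, by rw [K0.mk_prod e, ha, hb, Finsupp.sum_add_index'] <;> simp [add_smul]⟩
  induction x using K0.induction_mk with
  | hmk M => exact hmk M
  | hneg x h =>
    obtain ⟨a, rfl⟩ := h
    exact ⟨-a, by rw [Finsupp.sum_neg_index] <;> simp [Finsupp.sum]⟩
  | hadd x y hx hy =>
    obtain ⟨a, rfl⟩ := hx
    obtain ⟨b, rfl⟩ := hy
    exact ⟨a + b, by rw [Finsupp.sum_add_index'] <;> simp [add_smul]⟩

/-- The multiplicities of the non-projective indecomposables are coordinates on `K₀(A)`: on a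
combination of chosen representatives they return its coefficients. So `K₀(A)` embeds into a product
of copies of `ℤ`. -/
instance K0.isAddTorsionFree : IsAddTorsionFree (K0 A) := by
  classical
  have hinj : Function.Injective (AddMonoidHom.pi fun c : IndecClass A =>
      K0.multiplicity c.2.1 c.2.2) := by
    rw [injective_iff_map_eq_zero]
    intro x hx
    obtain ⟨a, rfl⟩ := x.exists_finsupp
    have ha : a = 0 := by
      ext c
      have h1 := congrFun hx c
      simp only [AddMonoidHom.pi_apply, Pi.zero_apply, Finsupp.sum, map_sum, map_zsmul] at h1
      rw [Finset.sum_eq_single c] at h1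
      · simpa [K0.multiplicity_mk_self] using h1
      · intro d _ hd
        rw [K0.multiplicity_mk_of_isEmpty _ _ d.2.1, smul_zero]
        rintro he
        refine hd (Subtype.ext ?_)
        rw [← Quotient.out_eq d.1, ← Quotient.out_eq c.1]
        exact (Quotient.sound he).symm
      · intro hc
        simp [Finsupp.notMem_support_iff.1 hc]
    rw [ha, Finsupp.sum_zero_index]
  exact hinj.isAddTorsionFree _

end KrullSchmidt


/-! ### The `φ`-dimension in terms of kernels of powers of `Ω̄` -/

section PhiDim

variable {A : Type u} [Ring A] [IsNoetherianRing Aᵐᵒᵖ]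

theorem exists_injOn_of_eta_lt {H : Type*} [AddCommGroup H] {T : AddMonoid.End H}
    {G : AddSubgroup H} {N : ℕ} (h : eta T G ≤ N) :
    ∀ m : ℕ, N ≤ m → Set.InjOn T (G.map (T ^ m) : AddSubgroup H) := by
  have h' : eta T G < (N + 1 : ℕ) := lt_of_le_of_lt h (by exact_mod_cast N.lt_succ_self)
  unfold eta at h'
  simp only [iInf_lt_iff] at h'
  obtain ⟨n, hn, hlt⟩ := h'
  have : n < N + 1 := by exact_mod_cast hlt
  exact fun m hm => hn m (by omega)

/-- If the `φ`-dimension is finite, then the kernels of the powers of `Ω̄` stabilize. -/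
theorem exists_ker_of_phiDim_lt_top [IsArtinianRing Aᵐᵒᵖ] (h : phiDim A < ⊤) :
    ∃ n : ℕ, ∀ x : K0 A, (omegaBar A ^ (n + 1)) x = 0 → (omegaBar A ^ n) x = 0 := by
  obtain ⟨n, hn⟩ := ENat.ne_top_iff_exists.1 h.ne
  refine ⟨n, fun x hx => ?_⟩
  obtain ⟨M, hM⟩ := x.exists_mem_addSpan
  have hle : eta (omegaBar A) (addSpan M) ≤ n := by
    rw [hn]; exact le_iSup (fun M : FGMod A => phi M) M
  have hinj := exists_injOn_of_eta_lt hle n le_rfl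
  -- Both `Ω̄ ^ n x` and `0` lie in `Ω̄ ^ n ⟨add M⟩`, where `Ω̄` is injective.
  refine hinj (AddSubgroup.mem_map_of_mem _ hM) (zero_mem _) ?_
  rw [map_zero, ← hx, pow_succ']
  rfl

/-- If the kernels of the powers of `Ω̄` stabilize, then the `φ`-dimension is finite. -/
theorem phiDim_lt_top_of_ker {n : ℕ}
    (h : ∀ l (x : K0 A), (omegaBar A ^ l) x = 0 → (omegaBar A ^ n) x = 0) : phiDim A < ⊤ := by
  refine lt_of_le_of_lt (iSup_le fun M => ?_) (ENat.natCast_lt_top n)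
  refine iInf₂_le n fun m hm => ?_
  rintro _ ⟨x, -, rfl⟩ _ ⟨y, -, rfl⟩ hxy
  have h1 : (omegaBar A ^ (m + 1)) (x - y) = 0 := by
    rw [map_sub, sub_eq_zero, pow_succ']
    exact hxy
  have h2 := h _ _ h1
  obtain ⟨d, rfl⟩ := Nat.exists_eq_add_of_le hm
  have h3 : (omegaBar A ^ (n + d)) (x - y) = 0 := by
    rw [add_comm, pow_add]
    exact (congrArg (omegaBar A ^ d) h2).trans (map_zero _)
  rw [map_sub, sub_eq_zero] at h3
  exact h3

end PhiDim

/-! ### Passage from `ℤ`-submodules to additive subgroups -/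

section AdditiveKernelStability

theorem toIntLinearMap_pow {H : Type*} [AddCommGroup H] (T : AddMonoid.End H) (n : ℕ) (x : H) :
    ((AddMonoidHom.toIntLinearMap T : Module.End ℤ H) ^ n) x = (T ^ n) x := by
  induction n generalizing x with
  | zero => rfl
  | succ n ih =>
    rw [pow_succ, pow_succ, Module.End.mul_apply]
    exact ih _

/-- A version of `exists_ker_pow_stable` for subgroups. -/
theorem exists_ker_pow_stable_addSubgroup {K L : Type v} [AddCommGroup K] [AddCommGroup L]
    [IsAddTorsionFree K] (T : AddMonoid.End K) (S : AddMonoid.End L) (ρ : K →+ L)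
    (B P D O : AddSubgroup K) (hTB : ∀ x, T x ∈ B) (hker : ∀ b ∈ B, ρ b = 0 → b ∈ P) (hP : P.FG)
    (hD : D.FG) (hDO : D ≤ O) (hOB : O ≤ B) (hTO : ∀ x ∈ O, T x ∈ O)
    (hON : ∃ N : ℕ, (O.map (T ^ N)).FG) (hcomm : ∀ b ∈ B, ρ (T b) - S (ρ b) ∈ D.map ρ)
    (hS : ∃ n : ℕ, ∀ y, (S ^ (n + 1)) y = 0 → (S ^ n) y = 0) :
    ∃ m : ℕ, ∀ l x, (T ^ l) x = 0 → (T ^ m) x = 0 := by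
  obtain ⟨N, hN⟩ := hON
  obtain ⟨n, hn⟩ := hS
  have hmap : (AddSubgroup.toIntSubmodule O).map (AddMonoidHom.toIntLinearMap T ^ N) =
      AddSubgroup.toIntSubmodule (O.map (T ^ N)) := by
    ext x
    constructor
    · rintro ⟨y, hy, rfl⟩
      exact ⟨y, hy, (toIntLinearMap_pow T N y).symm⟩
    · rintro ⟨y, hy, rfl⟩
      exact ⟨y, hy, toIntLinearMap_pow T N y⟩
  have fg : ∀ {H : Type v} [AddCommGroup H] (G : AddSubgroup H), G.FG →
      (AddSubgroup.toIntSubmodule G).FG := fun G h =>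
    Submodule.fg_iff_addSubgroup_fg _ |>.2 h
  obtain ⟨m, hm⟩ := exists_ker_pow_stable (AddMonoidHom.toIntLinearMap T)
    (AddMonoidHom.toIntLinearMap S) (AddMonoidHom.toIntLinearMap ρ)
    (AddSubgroup.toIntSubmodule B) (AddSubgroup.toIntSubmodule P) (AddSubgroup.toIntSubmodule D)
    (AddSubgroup.toIntSubmodule O) hTB hker (fg _ hP) (fg _ hD) hDO hOB hTO
    (N := N) (by rw [hmap]; exact fg _ hN) hcomm (n := n) (by
      intro y; rw [toIntLinearMap_pow, toIntLinearMap_pow]; exact hn y)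
  refine ⟨m, fun l x hx => ?_⟩
  rw [← toIntLinearMap_pow] at hx ⊢
  exact hm l x hx

end AdditiveKernelStability


/-! ### Projective covers over split basic rings -/

section SplitBasic

variable {k : Type*} [Field k] {R : Type*} [Ring R] [Algebra k R] {V : Type*}

/-- A complete system of orthogonal idempotents `e v` with characters `χ v` whose common kernel
is nil: the ring is basic and split, and the `e v` are its primitive idempotents. -/
structure IsSplitBasic [Fintype V] (e : V → R) (χ : V → R →ₐ[k] k) : Prop where
  idem : ∀ v, e v * e v = e v
  ortho : ∀ v w, v ≠ w → e v * e w = 0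
  sum_eq_one : ∑ v, e v = 1
  chi_self : ∀ v, χ v (e v) = 1
  chi_ne : ∀ v w, v ≠ w → χ v (e w) = 0
  nil : ∀ x, (∀ v, χ v x = 0) → IsNilpotent x

/-- The common kernel of a family of characters, as a left ideal. -/
def charKer (χ : V → R →ₐ[k] k) : Ideal R where
  carrier := {x | ∀ v, χ v x = 0}
  zero_mem' v := map_zero _
  add_mem' ha hb v := by rw [map_add, ha v, hb v, add_zero]
  smul_mem' c x hx v := by rw [smul_eq_mul, map_mul, hx v, mul_zero]

/-- The left ideal of the elements that are fixed by right multiplication with `a`; it is `Ra` if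
`a` is idempotent. -/
def rightFixed (a : R) : Submodule R R where
  carrier := {x | x * a = x}
  zero_mem' := zero_mul a
  add_mem' {x y} hx hy := by
    change (x + y) * a = x + y
    rw [add_mul, show x * a = x from hx, show y * a = y from hy]
  smul_mem' c x hx := by
    change c * x * a = c * x
    rw [mul_assoc, show x * a = x from hx]

theorem mem_rightFixed {a x : R} : x ∈ rightFixed a ↔ x * a = x := Iff.rfl

/-- Right multiplication by an idempotent. -/
def mulRightFixed {a : R} (ha : a * a = a) : R →ₗ[R] rightFixed a where
  toFun x := ⟨x * a, by rw [mem_rightFixed, mul_assoc, ha]⟩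
  map_add' x y := Subtype.ext (add_mul x y a)
  map_smul' c x := Subtype.ext (mul_assoc c x a)

theorem mulRightFixed_surjective {a : R} (ha : a * a = a) :
    Function.Surjective (mulRightFixed ha) := fun x => ⟨x, Subtype.ext x.2⟩

theorem projective_rightFixed {a : R} (ha : a * a = a) : Module.Projective R (rightFixed a) :=
  Module.Projective.of_split (rightFixed a).subtype (mulRightFixed ha)
    (LinearMap.ext fun x => Subtype.ext x.2)

theorem finite_rightFixed {a : R} (ha : a * a = a) : Module.Finite R (rightFixed a) :=
  Module.Finite.of_surjective _ (mulRightFixed_surjective ha)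

variable {M : Type*} [AddCommGroup M] [Module R M]

/-- The map from a direct sum of modules `R a` given by a family of elements. -/
def familyMap {σ : Type*} [Fintype σ] (a : σ → R) (m : σ → M) :
    (∀ s, rightFixed (a s)) →ₗ[R] M where
  toFun x := ∑ s, (x s : R) • m s
  map_add' x y := by simp [add_smul, Finset.sum_add_distrib]
  map_smul' c x := by simp [mul_smul, Finset.smul_sum]

theorem familyMap_apply {σ : Type*} [Fintype σ] (a : σ → R) (m : σ → M)
    (x : ∀ s, rightFixed (a s)) : familyMap a m x = ∑ s, (x s : R) • m s := rfl

theorem familyMap_surjective {σ : Type*} [Fintype σ] {a : σ → R} {m : σ → M}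
    (ha : ∀ s, a s * a s = a s) (hm : ∀ s, a s • m s = m s)
    (hs : Submodule.span R (Set.range m) = ⊤) : Function.Surjective (familyMap a m) := by
  classical
  rw [← LinearMap.range_eq_top, eq_top_iff, ← hs, Submodule.span_le]
  rintro _ ⟨s, rfl⟩
  refine ⟨Pi.single s ⟨a s, ha s⟩, ?_⟩
  rw [familyMap_apply, Finset.sum_eq_single s]
  · simp [hm]
  · intro t _ ht; simp [Pi.single_eq_of_ne ht]
  · simp

namespace IsSplitBasic

variable [Fintype V] {e : V → R} {χ : V → R →ₐ[k] k} (h : IsSplitBasic e χ)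

include h

theorem chi_eq_zero_of_mul_eq {v w : V} (hvw : v ≠ w) {x : R} (hx : x * e w = x) : χ v x = 0 := by
  rw [← hx, map_mul, h.chi_ne v w hvw, mul_zero]

/-- A nil left ideal lies in every maximal left ideal `m`: otherwise `1 = y + a x` with `y ∈ m` and
`a x` nilpotent, and `y` would be a unit. -/
theorem charKer_le_jacobson : charKer χ ≤ Ring.jacobson R := by
  rw [Ring.jacobson_eq_sInf_isMaximal]
  refine le_sInf fun m hm x hx => ?_
  by_contra hxm
  have hlt : m < m ⊔ Ideal.span {x} :=
    lt_of_le_of_ne le_sup_left fun heq => hxm (heq ▸ Submodule.mem_sup_right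
      (Ideal.mem_span_singleton_self x))
  have htop := hm.1.2 _ hlt
  have h1 : (1 : R) ∈ m ⊔ Ideal.span {x} := htop ▸ trivial
  obtain ⟨y, hy, z, hz, hyz⟩ := Submodule.mem_sup.1 h1
  obtain ⟨a, rfl⟩ := Ideal.mem_span_singleton'.1 hz
  have hnil : IsNilpotent (a * x) := h.nil _ fun v => by rw [map_mul, hx v, mul_zero]
  have hu : IsUnit y := by
    rw [eq_sub_of_add_eq hyz]
    exact hnil.isUnit_one_sub
  exact hm.ne_top (Ideal.eq_top_of_isUnit_mem _ hy hu)

theorem smul_mem_of_isCoatom {N : Submodule R M} (hN : IsCoatom N) {x : R} (hx : x ∈ charKer χ)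
    (m : M) : x • m ∈ N := by
  have h1 : x • m ∈ Ring.jacobson R • (⊤ : Submodule R M) :=
    Submodule.smul_mem_smul (h.charKer_le_jacobson hx) trivial
  exact (Submodule.mem_sInf.1 (Ring.jacobson_smul_top_le R M h1)) N hN

theorem smul_eq_zero_of_isSimpleModule [IsSimpleModule R M] {x : R} (hx : x ∈ charKer χ) (m : M) :
    x • m = 0 :=
  (Submodule.mem_bot R).1 (h.smul_mem_of_isCoatom isCoatom_bot hx m)

/-- A submodule of a direct sum of modules `R e` all of whose components are in the radical
is superfluous. -/
theorem eq_top_of_sup_eq_top {σ : Type*} [Fintype σ] {v : σ → V}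
    {K N : Submodule R (∀ s, rightFixed (e (v s)))} (hK : ∀ x ∈ K, ∀ s, (x s : R) ∈ charKer χ)
    (hKN : K ⊔ N = ⊤) : N = ⊤ := by
  classical
  have := fun s => finite_rightFixed (h.idem (v s))
  by_contra hN
  obtain ⟨N', hN', hle⟩ := (eq_top_or_exists_le_coatom N).resolve_left hN
  refine hN'.1 (eq_top_iff.2 (hKN ▸ sup_le (fun x hx => ?_) hle))
  -- Nakayama: written this way, `x` is a combination of elements of the module with coefficients in
  -- the radical, so it lies in every maximal submodule.
  have hx' : x = ∑ s, (x s : R) • (Pi.single s ⟨e (v s), h.idem _⟩ : ∀ s, rightFixed (e (v s))) := by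
    rw [← Finset.univ_sum_single x]
    refine Finset.sum_congr rfl fun s _ => ?_
    rw [Finset.univ_sum_single, ← Pi.single_smul]
    congr 1
    exact Subtype.ext (x s).2.symm
  rw [hx']
  exact Submodule.sum_mem _ fun s _ => h.smul_mem_of_isCoatom hN' (hK x hx s) _

/-- Every finitely generated module has a minimal cover by a direct sum of modules `R e`. -/
theorem exists_minimal_family [Module.Finite R M] : ∃ (r : ℕ) (v : Fin r → V) (m : Fin r → M),
    (∀ s, e (v s) • m s = m s) ∧ Submodule.span R (Set.range m) = ⊤ ∧
    ∀ x : ∀ s, rightFixed (e (v s)), familyMap (fun s => e (v s)) m x = 0 →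
      ∀ s, (x s : R) ∈ charKer χ := by
  classical
  let p : ℕ → Prop := fun r => ∃ (v : Fin r → V) (m : Fin r → M),
    (∀ s, e (v s) • m s = m s) ∧ Submodule.span R (Set.range m) = ⊤
  have hex : ∃ r, p r := by
    obtain ⟨n, s, hs⟩ := Module.Finite.exists_fin (R := R) (M := M)
    let E := Fintype.equivFin (Fin n × V)
    refine ⟨_, fun i => (E.symm i).2, fun i => e (E.symm i).2 • s (E.symm i).1, fun i => ?_, ?_⟩
    · rw [← mul_smul, h.idem]
    · rw [eq_top_iff, ← hs, Submodule.span_le]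
      rintro _ ⟨i, rfl⟩
      rw [← one_smul R (s i), ← h.sum_eq_one, Finset.sum_smul]
      refine Submodule.sum_mem _ fun v _ => Submodule.subset_span ⟨E (i, v), ?_⟩
      simp
  -- Minimality means the least number of generators, each fixed by one idempotent. A relation with
  -- a coefficient outside the radical would make the corresponding generator redundant.
  obtain ⟨v, m, hm, hs⟩ := Nat.find_spec hex
  have hmin := fun r => Nat.find_min hex (m := r)
  generalize Nat.find hex = r at v m hm hs hmin
  refine ⟨r, v, m, hm, hs, fun x hx t => ?_⟩
  by_contra hxt
  cases r with
  | zero => exact t.elim0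
  | succ r =>
  refine hmin r r.lt_succ_self ⟨v ∘ t.succAbove, m ∘ t.succAbove, fun s => hm _, ?_⟩
  set N := Submodule.span R (Set.range (m ∘ t.succAbove)) with hN
  have hmem : ∀ s, s ≠ t → m s ∈ N := fun s hst => by
    obtain ⟨s', rfl⟩ := Fin.exists_succAbove_eq hst
    exact Submodule.subset_span ⟨s', rfl⟩
  have hmt : m t ∈ N := by
    set c := χ (v t) (x t) with hc
    have hc0 : c ≠ 0 := by
      intro h0
      refine hxt fun w => ?_
      by_cases hw : w = v t
      · rw [hw]; exact h0
      · exact h.chi_eq_zero_of_mul_eq hw (x t).2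
    -- Modulo the radical, `e x e` is the scalar `c` times `e`. Since `c ≠ 0` and `j` is nilpotent,
    -- `c + j` is a unit, and it acts on `m t` as `e x` does.
    set j := e (v t) * (x t : R) * e (v t) - algebraMap k R c * e (v t) with hjdef
    have hj : j ∈ charKer χ := by
      intro w
      by_cases hw : w = v t
      · subst hw
        rw [hjdef]
        simp only [map_sub, map_mul, h.chi_self, AlgHom.commutes, one_mul, mul_one, ← hc]
        exact sub_self c
      · rw [hjdef]
        simp only [map_sub, map_mul, h.chi_ne w _ hw, mul_zero, sub_zero]
    have hu : IsUnit (algebraMap k R c + j) := by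
      have hcu : IsUnit (algebraMap k R c) := (isUnit_iff_ne_zero.2 hc0).map _
      have hnil : IsNilpotent j := h.nil j hj
      exact hnil.isUnit_add_left_of_commute hcu (Algebra.commutes c j).symm
    have hsum : (e (v t) * (x t : R)) • m t ∈ N := by
      have h1 := congrArg (e (v t) • ·) hx
      simp only [familyMap_apply, smul_zero, Finset.smul_sum] at h1
      rw [← Finset.add_sum_erase _ _ (Finset.mem_univ t)] at h1
      rw [mul_smul, eq_neg_of_add_eq_zero_left h1]
      refine N.neg_mem (Submodule.sum_mem _ fun s hs => ?_)
      exact N.smul_mem _ (N.smul_mem _ (hmem s (Finset.ne_of_mem_erase hs)))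
    have h2 : (algebraMap k R c + j) • m t ∈ N := by
      have : (algebraMap k R c + j) • m t = (e (v t) * (x t : R)) • m t := by
        conv_rhs => rw [← hm t, ← mul_smul]
        conv_lhs => rw [add_smul, hjdef, sub_smul, mul_smul (algebraMap k R c), hm t]
        rw [add_sub_cancel]
      rwa [this]
    obtain ⟨u, hu⟩ := hu
    have h3 := N.smul_mem (↑u⁻¹ : R) h2
    rwa [← hu, ← mul_smul, u.inv_mul, one_smul] at h3
  rw [eq_top_iff, ← hs, Submodule.span_le]
  rintro _ ⟨s, rfl⟩
  by_cases hst : s = t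
  · rw [hst]; exact hmt
  · exact hmem s hst

/-- The minimal cover splits because the module is projective; its kernel is superfluous, so the
section is onto. -/
theorem exists_equiv_of_projective [Module.Finite R M] [Module.Projective R M] :
    ∃ (r : ℕ) (v : Fin r → V), Nonempty ((∀ s, rightFixed (e (v s))) ≃ₗ[R] M) := by
  obtain ⟨r, v, m, hm, hs, hk⟩ := h.exists_minimal_family (M := M)
  have hsurj := familyMap_surjective (fun s => h.idem (v s)) hm hs
  obtain ⟨g, hg⟩ := Module.projective_lifting_property (familyMap (fun s => e (v s)) m)
    LinearMap.id hsurj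
  have hg' : ∀ y, familyMap (fun s => e (v s)) m (g y) = y := LinearMap.congr_fun hg
  have htop : LinearMap.range g = ⊤ := by
    refine h.eq_top_of_sup_eq_top (K := LinearMap.ker (familyMap (fun s => e (v s)) m))
      (fun x hx s => hk x hx s) (eq_top_iff.2 fun x _ => ?_)
    rw [← sub_add_cancel x (g (familyMap (fun s => e (v s)) m x))]
    refine Submodule.add_mem_sup ?_ ⟨_, rfl⟩
    rw [LinearMap.mem_ker, map_sub, hg', sub_self]
  refine ⟨r, v, ⟨(LinearEquiv.ofBijective g ⟨Function.LeftInverse.injective hg',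
    LinearMap.range_eq_top.1 htop⟩).symm⟩⟩

end IsSplitBasic

/-- The one-dimensional module given by a character. -/
def CharModule (_ : R →ₐ[k] k) := k

variable (ψ : R →ₐ[k] k)

instance : AddCommGroup (CharModule ψ) := inferInstanceAs (AddCommGroup k)
instance : Module R (CharModule ψ) := Module.compHom k (ψ : R →+* k)

/-- The element `1` of a one-dimensional module. -/
def CharModule.one : CharModule ψ := (1 : k)

variable {ψ} in
/-- The underlying scalar. -/
def CharModule.val (c : CharModule ψ) : k := c

theorem CharModule.smul_def (x : R) (c : CharModule ψ) : (x • c).val = ψ x * c.val := rfl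

theorem CharModule.ext {c d : CharModule ψ} (h : c.val = d.val) : c = d := h

theorem CharModule.val_one : (CharModule.one ψ).val = 1 := rfl

theorem CharModule.algebraMap_smul_one (c : CharModule ψ) :
    (algebraMap k R c.val) • CharModule.one ψ = c := by
  refine CharModule.ext ψ ?_
  rw [CharModule.smul_def, AlgHom.commutes, CharModule.val_one]
  exact mul_one c.val

instance : Module.Finite R (CharModule ψ) :=
  Module.Finite.of_surjective (LinearMap.toSpanSingleton R _ (CharModule.one ψ))
    fun c => ⟨algebraMap k R c.val, CharModule.algebraMap_smul_one ψ c⟩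

instance : Nontrivial (CharModule ψ) := inferInstanceAs (Nontrivial k)

instance : IsSimpleModule R (CharModule ψ) := by
  rw [isSimpleModule_iff_toSpanSingleton_surjective]
  refine ⟨inferInstance, fun m hm y => ⟨algebraMap k R (y.val * m.val⁻¹), ?_⟩⟩
  refine CharModule.ext ψ ?_
  rw [LinearMap.toSpanSingleton_apply, CharModule.smul_def, AlgHom.commutes]
  exact inv_mul_cancel_right₀ hm y.val

end SplitBasic

/-! ### The simple modules of a split basic ring -/

section SumOfSimples

variable {k : Type u} [Field k] {A : Type u} [Ring A] [Algebra k Aᵐᵒᵖ] {V : Type u} [Fintype V]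

/-- The direct sum of the one-dimensional modules given by a family of characters. -/
abbrev charSum (χ : V → Aᵐᵒᵖ →ₐ[k] k) : FGMod A := FGModuleCat.of Aᵐᵒᵖ (∀ v, CharModule (χ v))

/-- The idempotents separate the characters. Conversely, a simple module is killed by the radical,
so any nonzero vector in some `e v • T` spans a line on which the ring acts through `χ v`. -/
theorem IsSplitBasic.isSumOfSimples {e : V → Aᵐᵒᵖ} {χ : V → Aᵐᵒᵖ →ₐ[k] k}
    (h : IsSplitBasic e χ) : IsSumOfSimples (charSum χ) := by
  classical
  let E := Fintype.equivFin V
  refine ⟨Fintype.card V, fun i => FGModuleCat.of Aᵐᵒᵖ (CharModule (χ (E.symm i))),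
    fun i => inferInstanceAs (IsSimpleModule Aᵐᵒᵖ (CharModule (χ (E.symm i)))), ?_, ?_,
    ⟨LinearEquiv.piCongrLeft' Aᵐᵒᵖ (fun v => CharModule (χ v)) E⟩⟩
  · refine fun i j hij => ⟨fun f => ?_⟩
    have h1 := f.map_smul (e (E.symm i)) (CharModule.one (χ (E.symm i)))
    have hne : E.symm j ≠ E.symm i := fun h => hij (E.symm.injective h).symm
    have h2 : e (E.symm i) • CharModule.one (χ (E.symm i)) = CharModule.one (χ (E.symm i)) := by
      refine CharModule.ext _ ?_
      rw [CharModule.smul_def, h.chi_self, one_mul]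
    have h3 : ∀ c : CharModule (χ (E.symm j)), e (E.symm i) • c = 0 := fun c => by
      refine CharModule.ext _ ?_
      rw [CharModule.smul_def, h.chi_ne _ _ hne, zero_mul]; rfl
    have h4 := h1.trans (h3 _)
    have h5 : CharModule.one (χ (E.symm i)) = 0 := f.injective
      ((congrArg f h2).symm.trans (h4.trans (map_zero f).symm))
    exact one_ne_zero (α := k) h5
  · intro T hT
    obtain ⟨x, hx⟩ := @exists_ne T (IsSimpleModule.nontrivial Aᵐᵒᵖ T) 0
    obtain ⟨v, hv⟩ : ∃ v, e v • x ≠ 0 := by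
      by_contra! hall
      refine hx ?_
      rw [← one_smul Aᵐᵒᵖ x, ← h.sum_eq_one, Finset.sum_smul]
      exact Finset.sum_eq_zero fun v _ => hall v
    -- The element `(r - χ v r) * e v` is annihilated by all characters, hence acts by zero on the
    -- simple module `T`.
    have hact : ∀ r : Aᵐᵒᵖ, r • e v • x = algebraMap k Aᵐᵒᵖ (χ v r) • e v • x := by
      intro r
      rw [← sub_eq_zero, ← sub_smul, ← mul_smul]
      refine h.smul_eq_zero_of_isSimpleModule (M := T) (fun w => ?_) x
      by_cases hw : w = v
      · subst hw
        simp [h.chi_self]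
      · simp [h.chi_ne w v hw]
    let f : CharModule (χ v) →ₗ[Aᵐᵒᵖ] T :=
      { toFun := fun c => algebraMap k Aᵐᵒᵖ c.val • e v • x
        map_add' := fun a b => (congrArg (· • e v • x) (map_add (algebraMap k Aᵐᵒᵖ) a b)).trans
          (add_smul _ _ _)
        map_smul' := fun r c => by
          rw [CharModule.smul_def, map_mul, Algebra.commutes, mul_smul, ← hact, RingHom.id_apply,
            ← mul_smul (algebraMap k Aᵐᵒᵖ c.val), Algebra.commutes, mul_smul] }
    have hf : f ≠ 0 := by
      intro h0
      have := LinearMap.congr_fun h0 (CharModule.one (χ v))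
      refine hv ?_
      have h1 : f (CharModule.one (χ v)) = algebraMap k Aᵐᵒᵖ 1 • e v • x := rfl
      rw [h1, map_one, one_smul] at this
      exact this
    have hb := LinearMap.bijective_or_eq_zero f
    obtain ⟨i, rfl⟩ := E.symm.surjective v
    exact ⟨i, ⟨(LinearEquiv.ofBijective f (hb.resolve_right hf)).symm⟩⟩

end SumOfSimples


/-! ### Inflation and coinvariants along a surjective ring map -/

section ChangeOfRings

variable {R S : Type*} [Ring R] [Ring S] (q : R →+* S)

/-- An `S`-module, regarded as an `R`-module. -/
def Infl (_ : R →+* S) (N : Type*) := N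

instance (N : Type*) [AddCommGroup N] : AddCommGroup (Infl q N) := inferInstanceAs (AddCommGroup N)
instance (N : Type*) [AddCommGroup N] [Module S N] : Module R (Infl q N) := Module.compHom N q

variable {q}

/-- The underlying element of the `S`-module. -/
def Infl.val {N : Type*} (n : Infl q N) : N := n

theorem finite_infl (hq : Function.Surjective q) (N : Type*) [AddCommGroup N] [Module S N]
    [Module.Finite S N] : Module.Finite R (Infl q N) := by
  obtain ⟨n, s, hs⟩ := Module.Finite.exists_fin (R := S) (M := N)
  let s' : Fin n → Infl q N := s
  refine Module.Finite.of_surjective (Fintype.linearCombination R s') fun y => ?_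
  have hy : y.val ∈ Submodule.span S (Set.range s) := hs ▸ trivial
  obtain ⟨c, hc⟩ := (Submodule.mem_span_range_iff_exists_fun S).1 hy
  refine ⟨fun i => Function.surjInv hq (c i), ?_⟩
  rw [Fintype.linearCombination_apply]
  refine Eq.trans (Finset.sum_congr rfl fun i _ => ?_) hc
  change q (Function.surjInv hq (c i)) • s i = _
  rw [Function.surjInv_eq hq]

variable (q) in
/-- `M` is annihilated by the kernel of `q`. -/
def IsKilled (M : Type*) [AddCommGroup M] [Module R M] : Prop :=
  ∀ x, q x = 0 → ∀ m : M, x • m = 0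

/-- An `R`-module that is annihilated by the kernel of `q`, regarded as an `S`-module. -/
def Desc (_ : Function.Surjective q) {M : Type*} [AddCommGroup M] [Module R M]
    (_ : IsKilled q M) := M

section Desc

variable (hq : Function.Surjective q) {M : Type*} [AddCommGroup M] [Module R M]
  (hM : IsKilled q M)

instance : AddCommGroup (Desc hq hM) := inferInstanceAs (AddCommGroup M)

/-- The action of `R` on the module `M`. -/
local instance : Module R (Desc hq hM) := inferInstanceAs (Module R M)

noncomputable instance : SMul S (Desc hq hM) := ⟨fun c m => Function.surjInv hq c • m⟩

theorem Desc.smul_eq (r : R) (m : Desc hq hM) : q r • m = r • m := by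
  change Function.surjInv hq (q r) • m = r • m
  rw [← sub_eq_zero, ← sub_smul]
  exact hM _ (by rw [map_sub, Function.surjInv_eq hq, sub_self]) m

noncomputable instance : Module S (Desc hq hM) :=
  Function.Surjective.moduleLeft q hq (Desc.smul_eq hq hM)

end Desc

/-- The underlying element of the `R`-module. -/
def Desc.val {hq : Function.Surjective q} {M : Type*} [AddCommGroup M] [Module R M]
    {hM : IsKilled q M} (m : Desc hq hM) : M := m

theorem Desc.val_smul {hq : Function.Surjective q} {M : Type*} [AddCommGroup M] [Module R M]
    {hM : IsKilled q M} (r : R) (m : Desc hq hM) : (q r • m).val = r • m.val :=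
  Desc.smul_eq hq hM r m

/-- A module that is annihilated by the kernel of `q` is inflated. -/
def inflDescEquiv (hq : Function.Surjective q) {M : Type*} [AddCommGroup M] [Module R M]
    (hM : IsKilled q M) : M ≃ₗ[R] Infl q (Desc hq hM) :=
  { AddEquiv.refl M with map_smul' := fun r m => (Desc.smul_eq hq hM r m).symm }

theorem finite_desc (hq : Function.Surjective q) {M : Type*} [AddCommGroup M] [Module R M]
    (hM : IsKilled q M) [Module.Finite R M] : Module.Finite S (Desc hq hM) := by
  let f : M →ₛₗ[q] Desc hq hM :=
    { toFun := fun m => m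
      map_add' := fun _ _ => rfl
      map_smul' := fun r m => (Desc.smul_eq hq hM r m).symm }
  have : RingHomSurjective q := ⟨hq⟩
  exact Module.Finite.of_surjective f fun m => ⟨m, rfl⟩

variable (q) in
/-- The submodule generated by the action of the kernel of `q`. -/
def kerSmul (M : Type*) [AddCommGroup M] [Module R M] : Submodule R M :=
  Submodule.span R {y | ∃ (x : R) (m : M), q x = 0 ∧ x • m = y}

theorem smul_mem_kerSmul {M : Type*} [AddCommGroup M] [Module R M] {x : R} (hx : q x = 0) (m : M) :
    x • m ∈ kerSmul q M := Submodule.subset_span ⟨x, m, hx, rfl⟩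

theorem kerSmul_le_ker {M T : Type*} [AddCommGroup M] [Module R M] [AddCommGroup T] [Module S T]
    (f : M →ₛₗ[q] T) : kerSmul q M ≤ LinearMap.ker f := by
  refine Submodule.span_le.2 ?_
  rintro _ ⟨x, m, hx, rfl⟩
  change f (x • m) = 0
  rw [map_smulₛₗ, hx, zero_smul]

theorem map_mem_kerSmul {M Y : Type*} [AddCommGroup M] [Module R M] [AddCommGroup Y] [Module R Y]
    (j : Y →ₗ[R] M) {y : Y} (hy : y ∈ kerSmul q Y) : j y ∈ kerSmul q M := by
  refine (Submodule.span_le.2 ?_ : kerSmul q Y ≤ (kerSmul q M).comap j) hy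
  rintro _ ⟨x, z, hx, rfl⟩
  change j (x • z) ∈ kerSmul q M
  rw [map_smul]
  exact smul_mem_kerSmul hx _

theorem isKilled_quotient (M : Type*) [AddCommGroup M] [Module R M] :
    IsKilled q (M ⧸ kerSmul q M) := by
  intro x hx m
  obtain ⟨m, rfl⟩ := Submodule.mkQ_surjective _ m
  rw [← map_smul, Submodule.mkQ_apply, Submodule.Quotient.mk_eq_zero]
  exact smul_mem_kerSmul hx m

/-- The largest quotient of an `R`-module that is an `S`-module. -/
abbrev Coinv (hq : Function.Surjective q) (M : Type*) [AddCommGroup M] [Module R M] :=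
  Desc hq (isKilled_quotient (q := q) M)

section Coinv

variable (hq : Function.Surjective q) {M T : Type*} [AddCommGroup M] [Module R M]
  [AddCommGroup T] [Module S T]

/-- The universal property of the coinvariants. -/
def Coinv.lift (f : M →ₛₗ[q] T) : Coinv hq M →ₗ[S] T where
  toFun m := (kerSmul q M).liftQ f (kerSmul_le_ker f) m.val
  map_add' a b := map_add ((kerSmul q M).liftQ f (kerSmul_le_ker f)) _ _
  map_smul' c m := by
    obtain ⟨r, rfl⟩ := hq c
    rw [Desc.val_smul, map_smulₛₗ, RingHom.id_apply]

/-- The projection to the coinvariants. -/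
def Coinv.mk : M →ₛₗ[q] Coinv hq M where
  toFun m := (kerSmul q M).mkQ m
  map_add' := map_add (kerSmul q M).mkQ
  map_smul' r m := (map_smul (kerSmul q M).mkQ r m).trans
    (Desc.smul_eq hq (isKilled_quotient (q := q) M) r ((kerSmul q M).mkQ m)).symm

theorem Coinv.mk_surjective : Function.Surjective (Coinv.mk hq (M := M)) :=
  Submodule.mkQ_surjective (kerSmul q M)

theorem Coinv.lift_mk (f : M →ₛₗ[q] T) (m : M) : Coinv.lift hq f (Coinv.mk hq m) = f m := rfl

theorem Coinv.mk_eq_zero {m : M} : Coinv.mk hq m = 0 ↔ m ∈ kerSmul q M :=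
  Submodule.Quotient.mk_eq_zero _

/-- A surjection with kernel `kerSmul q M` identifies the coinvariants. -/
noncomputable def Coinv.equivOfKer (f : M →ₛₗ[q] T) (hf : Function.Surjective f)
    (hk : ∀ m, f m = 0 → m ∈ kerSmul q M) : Coinv hq M ≃ₗ[S] T :=
  LinearEquiv.ofBijective (Coinv.lift hq f) ⟨by
    rw [injective_iff_map_eq_zero]
    intro x hx
    obtain ⟨m, rfl⟩ := Coinv.mk_surjective hq x
    rw [Coinv.lift_mk] at hx
    exact (Coinv.mk_eq_zero hq).2 (hk m hx), fun t => by
    obtain ⟨m, rfl⟩ := hf t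
    exact ⟨Coinv.mk hq m, rfl⟩⟩

/-- Coinvariants are left adjoint to inflation, and inflation keeps surjections surjective; a lift
is found over `R` and then descended. -/
theorem Coinv.projective [Module.Projective R M] : Module.Projective S (Coinv hq M) := by
  refine Module.Projective.of_lifting_property'' fun f hf => ?_
  let f' : Infl q (Coinv hq M →₀ S) →ₗ[R] Infl q (Coinv hq M) :=
    { toFun := fun x => f x
      map_add' := f.map_add
      map_smul' := fun r a => f.map_smul (q r) a }
  let p : M →ₗ[R] Infl q (Coinv hq M) :=
    { toFun := fun x => Coinv.mk hq x
      map_add' := fun a b => (Coinv.mk hq).map_add a b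
      map_smul' := fun r a => (Coinv.mk hq).map_smulₛₗ r a }
  obtain ⟨g, hg⟩ := Module.projective_lifting_property f' p hf
  let g' : M →ₛₗ[q] (Coinv hq M →₀ S) :=
    { toFun := fun x => g x
      map_add' := fun a b => g.map_add a b
      map_smul' := fun r a => g.map_smul r a }
  refine ⟨Coinv.lift hq g', LinearMap.ext fun x => ?_⟩
  obtain ⟨m, rfl⟩ := Coinv.mk_surjective hq x
  exact LinearMap.congr_fun hg m

/-- Coinvariants commute with finite direct sums. -/
noncomputable def Coinv.prodEquiv {M' M'' : Type*} [AddCommGroup M'] [AddCommGroup M'']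
    [Module R M'] [Module R M''] (E : M ≃ₗ[R] (M' × M'')) :
    Coinv hq M ≃ₗ[S] (Coinv hq M' × Coinv hq M'') :=
  Coinv.equivOfKer hq
    { toFun := fun m => (Coinv.mk hq (E m).1, Coinv.mk hq (E m).2)
      map_add' := fun a b => by simp
      map_smul' := fun r a => by simp }
    (by
      rintro ⟨a, b⟩
      obtain ⟨a, rfl⟩ := Coinv.mk_surjective hq a
      obtain ⟨b, rfl⟩ := Coinv.mk_surjective hq b
      exact ⟨E.symm (a, b), by simp⟩)
    (by
      intro m hm
      have h1 := (Coinv.mk_eq_zero hq).1 (congrArg Prod.fst hm)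
      have h2 := (Coinv.mk_eq_zero hq).1 (congrArg Prod.snd hm)
      have h3 := map_mem_kerSmul (E.symm.toLinearMap ∘ₗ LinearMap.inl R M' M'') h1
      have h4 := map_mem_kerSmul (E.symm.toLinearMap ∘ₗ LinearMap.inr R M' M'') h2
      have h5 := add_mem h3 h4
      simp only [LinearMap.comp_apply, LinearEquiv.coe_coe, ← map_add, LinearMap.inl_apply,
        LinearMap.inr_apply, Prod.mk_add_mk, add_zero, zero_add, Prod.mk.eta,
        LinearEquiv.symm_apply_apply] at h5
      exact h5)

end Coinv

end ChangeOfRings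

/-! ### Inflation and coinvariants on `K₀` -/

section ChangeOfRingsK0

variable {C B : Type u} [Ring C] [Ring B] {q : Cᵐᵒᵖ →+* Bᵐᵒᵖ} (hq : Function.Surjective q)

/-- A `B`-module, regarded as a `C`-module. -/
def inflMod (N : FGMod B) : FGMod C :=
  have := finite_infl hq N
  FGModuleCat.of Cᵐᵒᵖ (Infl q N)

/-- A `C`-module that is annihilated by the kernel of `q`, regarded as a `B`-module. -/
noncomputable def descMod (M : FGMod C) (hM : IsKilled q M) : FGMod B :=
  have := finite_desc hq hM
  FGModuleCat.of Bᵐᵒᵖ (Desc hq hM)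

theorem mk_inflMod_descMod (M : FGMod C) (hM : IsKilled q M) :
    K0.mk (inflMod hq (descMod hq M hM)) = K0.mk M :=
  (K0.mk_eq_of_equiv (M' := inflMod hq (descMod hq M hM)) (inflDescEquiv hq hM)).symm

theorem mk_inflMod_prod {N N' N'' : FGMod B} (E : N ≃ₗ[Bᵐᵒᵖ] (N' × N'')) :
    K0.mk (inflMod hq N) = K0.mk (inflMod hq N') + K0.mk (inflMod hq N'') := by
  have E' : Infl q N ≃ₗ[Cᵐᵒᵖ] (Infl q N' × Infl q N'') :=
    { E.toAddEquiv with map_smul' := fun r n => E.map_smul (q r) n }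
  exact K0.mk_prod (M := inflMod hq N) (M' := inflMod hq N') (M'' := inflMod hq N'') E'

/-- The map induced on `K₀` by taking coinvariants. -/
noncomputable def coinvHom : K0 C →+ K0 B :=
  K0.liftFun (fun M => K0.mk (descMod hq
      (FGModuleCat.of Cᵐᵒᵖ (M ⧸ kerSmul q M)) (isKilled_quotient (q := q) M)))
    (fun M M' M'' E => K0.mk_prod
      (M := descMod hq (FGModuleCat.of Cᵐᵒᵖ (M ⧸ kerSmul q M)) (isKilled_quotient (q := q) M))
      (M' := descMod hq (FGModuleCat.of Cᵐᵒᵖ (M' ⧸ kerSmul q M')) (isKilled_quotient (q := q) M'))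
      (M'' := descMod hq (FGModuleCat.of Cᵐᵒᵖ (M'' ⧸ kerSmul q M''))
        (isKilled_quotient (q := q) M'')) (Coinv.prodEquiv hq E))
    (fun P _ => K0.mk_projective _ (Coinv.projective hq (M := P)))

theorem coinvHom_mk_inflMod (N : FGMod B) : coinvHom hq (K0.mk (inflMod hq N)) = K0.mk N := by
  unfold coinvHom
  rw [K0.liftFun_mk]
  refine K0.mk_eq_of_equiv (M' := N) (Coinv.equivOfKer (M := Infl q N) (T := N) hq
    { toFun := fun n => n
      map_add' := fun _ _ => rfl
      map_smul' := fun _ _ => rfl } (fun n => ⟨n, rfl⟩) ?_)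
  intro m hm
  have hm' : m = 0 := hm
  rw [hm']
  exact Submodule.zero_mem _

theorem coinvHom_mk_eq_zero (M : FGMod C) (hM : ∀ m : M, m ∈ kerSmul q M) :
    coinvHom hq (K0.mk M) = 0 := by
  unfold coinvHom
  rw [K0.liftFun_mk]
  refine K0.mk_projective _ ?_
  have : Subsingleton (Coinv hq M) := ⟨fun a b => by
    obtain ⟨a, rfl⟩ := Coinv.mk_surjective hq a
    obtain ⟨b, rfl⟩ := Coinv.mk_surjective hq b
    rw [(Coinv.mk_eq_zero hq).2 (hM a), (Coinv.mk_eq_zero hq).2 (hM b)]⟩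
  exact inferInstanceAs (Module.Projective Bᵐᵒᵖ (Coinv hq M))

end ChangeOfRingsK0


theorem projective_pi {R : Type*} [Ring R] {σ : Type*} [Fintype σ] {M : σ → Type*}
    [∀ s, AddCommGroup (M s)] [∀ s, Module R (M s)] [∀ s, Module.Projective R (M s)] :
    Module.Projective R (∀ s, M s) := by
  classical
  exact Module.Projective.of_equiv (DFinsupp.linearEquivFunOnFintype (R := R) (M := M))

/-! ### Finite direct sums and retracts -/

section FiniteSums

variable {A : Type u} [Ring A]

theorem K0.mk_pi {n : ℕ} : ∀ {M : FGMod A} (X : Fin n → FGMod A) (_ : M ≃ₗ[Aᵐᵒᵖ] (∀ i, X i)),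
    K0.mk M = ∑ i, K0.mk (X i) := by
  induction n with
  | zero =>
    intro M X E
    have : Subsingleton M := E.toEquiv.subsingleton
    rw [K0.mk_projective M Module.Projective.of_free]
    simp
  | succ n ih =>
    intro M X E
    let Y : FGMod A := FGModuleCat.of Aᵐᵒᵖ (∀ i : Fin n, X i.succ)
    have hY : K0.mk Y = ∑ i : Fin n, K0.mk (X i.succ) := ih _ (LinearEquiv.refl _ _)
    have E' : M ≃ₗ[Aᵐᵒᵖ] (X 0 × Y) := E.trans (Fin.consLinearEquiv Aᵐᵒᵖ (fun i => X i)).symm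
    rw [K0.mk_prod E', hY, Fin.sum_univ_succ]

/-- A retract is a direct summand. -/
theorem isSummand_of_retract [IsNoetherianRing Aᵐᵒᵖ] {X M : FGMod A} (f : X →ₗ[Aᵐᵒᵖ] M)
    (g : M →ₗ[Aᵐᵒᵖ] X) (hgf : ∀ x, g (f x) = x) : IsSummand X M := by
  refine ⟨FGModuleCat.of Aᵐᵒᵖ (LinearMap.ker g), ⟨?_⟩⟩
  exact
    { toFun := fun m => (g m, ⟨m - f (g m), by rw [LinearMap.mem_ker, map_sub, hgf, sub_self]⟩)
      invFun := fun y => f y.1 + y.2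
      map_add' := fun a b => Prod.ext (map_add g a b) (Subtype.ext (by simp; abel))
      map_smul' := fun c a => Prod.ext (map_smul g c a) (Subtype.ext (by simp [smul_sub]))
      left_inv := fun m => by simp
      right_inv := fun y => by
        have h : g y.2 = 0 := y.2.2
        refine Prod.ext ?_ (Subtype.ext ?_)
        · simp [hgf, h]
        · simp [hgf, h] }

end FiniteSums

/-! ### Glued algebras: splitting of radical modules into parts -/

section Gluing

variable {k : Type u} [Field k] {n : ℕ} {V : Fin n → Type u} [∀ i, Fintype (V i)]
  {C : Type u} [Ring C] [Algebra k Cᵐᵒᵖ] {A : Fin n → Type u} [∀ i, Ring (A i)]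
  [∀ i, Algebra k (A i)ᵐᵒᵖ]

/-- The relation between an algebra `C` and quotients `A i` of it, as for quivers glued along
connecting arrows. -/
structure IsGluing (e : (Σ i, V i) → Cᵐᵒᵖ) (χ : (Σ i, V i) → Cᵐᵒᵖ →ₐ[k] k)
    (e' : ∀ i, V i → (A i)ᵐᵒᵖ) (χ' : ∀ i, V i → (A i)ᵐᵒᵖ →ₐ[k] k)
    (q : ∀ i, Cᵐᵒᵖ →+* (A i)ᵐᵒᵖ) : Prop where
  basic : IsSplitBasic e χ
  basic' : ∀ i, IsSplitBasic (e' i) (χ' i)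
  surj : ∀ i, Function.Surjective (q i)
  q_self : ∀ i v, q i (e ⟨i, v⟩) = e' i v
  q_ne : ∀ i j v, i ≠ j → q i (e ⟨j, v⟩) = 0
  chi : ∀ i v x, χ ⟨i, v⟩ x = χ' i v (q i x)
  -- The product is taken in the opposite ring: for paths it reads `y` followed by `x`, a radical
  -- element followed by what all parts kill.
  mul_eq_zero : ∀ x y, (∀ i, q i x = 0) → y ∈ charKer χ → x * y = 0
  corner : ∀ i x, q i x = 0 → (∑ v, e ⟨i, v⟩) * x * (∑ v, e ⟨i, v⟩) = 0

/-- The sum of the idempotents of the `i`-th part. -/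
def partIdem (e : (Σ i, V i) → Cᵐᵒᵖ) (i : Fin n) : Cᵐᵒᵖ := ∑ v, e ⟨i, v⟩

/-- A module that is annihilated by the intersection of the kernels. -/
def IsKilledByAll (q : ∀ i, Cᵐᵒᵖ →+* (A i)ᵐᵒᵖ) (W : Type*) [AddCommGroup W] [Module Cᵐᵒᵖ W] : Prop :=
  ∀ x, (∀ i, q i x = 0) → ∀ w : W, x • w = 0

namespace IsGluing

variable {e : (Σ i, V i) → Cᵐᵒᵖ} {χ : (Σ i, V i) → Cᵐᵒᵖ →ₐ[k] k}
  {e' : ∀ i, V i → (A i)ᵐᵒᵖ} {χ' : ∀ i, V i → (A i)ᵐᵒᵖ →ₐ[k] k}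
  {q : ∀ i, Cᵐᵒᵖ →+* (A i)ᵐᵒᵖ} (h : IsGluing e χ e' χ' q)

include h

theorem mul_partIdem_self (i : Fin n) (v : V i) : e ⟨i, v⟩ * partIdem e i = e ⟨i, v⟩ := by
  classical
  rw [partIdem, Finset.mul_sum, Finset.sum_eq_single v, h.basic.idem]
  · intro w _ hw
    exact h.basic.ortho _ _ fun heq => hw (by simpa using heq.symm)
  · simp

theorem partIdem_mul_of_ne {i j : Fin n} (hij : i ≠ j) (v : V j) :
    partIdem e i * e ⟨j, v⟩ = 0 := by
  rw [partIdem, Finset.sum_mul]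
  exact Finset.sum_eq_zero fun w _ => h.basic.ortho _ _ fun heq => hij (congrArg Sigma.fst heq)

theorem partIdem_idem (i : Fin n) : partIdem e i * partIdem e i = partIdem e i := by
  conv_lhs => rw [partIdem, Finset.sum_mul]
  exact Finset.sum_congr rfl fun v _ => h.mul_partIdem_self i v

theorem partIdem_ortho {i j : Fin n} (hij : i ≠ j) : partIdem e i * partIdem e j = 0 := by
  conv_lhs => rw [partIdem, partIdem, Finset.mul_sum]
  exact Finset.sum_eq_zero fun v _ => h.partIdem_mul_of_ne hij v

theorem sum_partIdem : ∑ i, partIdem e i = 1 := by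
  rw [← h.basic.sum_eq_one, Fintype.sum_sigma]
  rfl

theorem q_partIdem_self (i : Fin n) : q i (partIdem e i) = 1 := by
  rw [partIdem, map_sum, ← (h.basic' i).sum_eq_one]
  exact Finset.sum_congr rfl fun v _ => h.q_self i v

theorem q_partIdem_ne {i j : Fin n} (hij : i ≠ j) : q i (partIdem e j) = 0 := by
  rw [partIdem, map_sum]
  exact Finset.sum_eq_zero fun v _ => h.q_ne i j v hij

section Pieces

variable {W : Type u} [AddCommGroup W] [Module Cᵐᵒᵖ W] (hW : IsKilledByAll q W)

-- The idempotent of a part becomes central modulo the intersection of the kernels: every `q j`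
-- sends it to `0` or `1`, so each commutator is killed by all `q j`.
include hW in
theorem partIdem_smul_comm (i : Fin n) (r : Cᵐᵒᵖ) (w : W) :
    partIdem e i • r • w = r • partIdem e i • w := by
  rw [← sub_eq_zero, ← mul_smul, ← mul_smul, ← sub_smul]
  refine hW _ (fun j => ?_) w
  by_cases hj : j = i
  · subst hj
    rw [map_sub, map_mul, map_mul, h.q_partIdem_self, one_mul, mul_one, sub_self]
  · rw [map_sub, map_mul, map_mul, h.q_partIdem_ne hj, zero_mul, mul_zero, sub_self]

/-- The part of a module over the product of the `A i` that belongs to `A i`. -/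
def piece (i : Fin n) : Submodule Cᵐᵒᵖ W where
  carrier := {w | partIdem e i • w = w}
  zero_mem' := smul_zero _
  add_mem' {a b} ha hb := by
    change partIdem e i • (a + b) = a + b
    rw [smul_add, show partIdem e i • a = a from ha, show partIdem e i • b = b from hb]
  smul_mem' r a ha := by
    change partIdem e i • r • a = r • a
    rw [h.partIdem_smul_comm hW, show partIdem e i • a = a from ha]

theorem mem_piece {i : Fin n} {w : W} : w ∈ h.piece hW i ↔ partIdem e i • w = w := Iff.rfl

theorem isKilled_piece (i : Fin n) : IsKilled (q i) (h.piece hW i) := by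
  rintro x hx ⟨w, hw⟩
  refine Subtype.ext ?_
  change x • w = 0
  rw [← show partIdem e i • w = w from hw, ← mul_smul]
  refine hW _ (fun j => ?_) w
  by_cases hj : j = i
  · subst hj; rw [map_mul, hx, zero_mul]
  · rw [map_mul, h.q_partIdem_ne hj, mul_zero]

/-- The decomposition of a module over the product of the `A i`. -/
def pieceEquiv : W ≃ₗ[Cᵐᵒᵖ] (∀ i, h.piece hW i) where
  toFun w i := ⟨partIdem e i • w, by rw [mem_piece, ← mul_smul, h.partIdem_idem]⟩
  map_add' a b := by ext i; exact smul_add _ _ _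
  map_smul' r a := by ext i; exact h.partIdem_smul_comm hW i r a
  invFun f := ∑ i, (f i : W)
  left_inv w := by
    change ∑ i, partIdem e i • w = w
    rw [← Finset.sum_smul, h.sum_partIdem, one_smul]
  right_inv f := by
    ext i
    change partIdem e i • ∑ j, (f j : W) = f i
    rw [Finset.smul_sum, Finset.sum_eq_single i]
    · exact (f i).2
    · intro j _ hj
      rw [← show partIdem e j • (f j : W) = f j from (f j).2, ← mul_smul,
        h.partIdem_ortho hj.symm, zero_smul]
    · simp

theorem mk_eq_sum_piece [IsNoetherianRing Cᵐᵒᵖ] [Module.Finite Cᵐᵒᵖ W] :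
    K0.mk (FGModuleCat.of Cᵐᵒᵖ W) =
      ∑ i, K0.mk (FGModuleCat.of Cᵐᵒᵖ (h.piece hW i)) :=
  K0.mk_pi (M := FGModuleCat.of Cᵐᵒᵖ W) (fun i => FGModuleCat.of Cᵐᵒᵖ (h.piece hW i))
    (h.pieceEquiv hW)

end Pieces

/-- The direct sum of the radicals of the modules `C e`. -/
theorem isKilledByAll_of_components {σ : Type*} [Fintype σ] {a : σ → Cᵐᵒᵖ}
    {K : Submodule Cᵐᵒᵖ (∀ s, rightFixed (a s))} (hK : ∀ x ∈ K, ∀ s, (x s : Cᵐᵒᵖ) ∈ charKer χ) :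
    IsKilledByAll q K := by
  rintro x hx ⟨y, hy⟩
  refine Subtype.ext (funext fun s => Subtype.ext ?_)
  exact h.mul_eq_zero x _ hx (hK y hy s)

/-- This makes `radicalPiece` meaningful: the radical of `C e` decomposes into parts. -/
theorem isKilledByAll_radical (w : Σ i, V i) :
    IsKilledByAll q (charKer χ ⊓ rightFixed (e w) : Submodule Cᵐᵒᵖ Cᵐᵒᵖ) := by
  rintro x hx ⟨y, hy⟩
  exact Subtype.ext (h.mul_eq_zero x y hx hy.1)

variable [IsNoetherianRing Cᵐᵒᵖ]

/-- The part in `A j` of the radical of the indecomposable projective module of a vertex. -/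
noncomputable def radicalPiece (j : Fin n) (w : Σ i, V i) : FGMod C :=
  FGModuleCat.of Cᵐᵒᵖ (h.piece (h.isKilledByAll_radical w) j)

/-- The subgroup generated by the inflations of modules over the `A i`. -/
def inflSpan : AddSubgroup (K0 C) :=
  AddSubgroup.closure {x | ∃ (i : Fin n) (N : FGMod (A i)), x = K0.mk (inflMod (h.surj i) N)}

/-- The subgroup generated by the radical pieces in other parts. -/
def radicalSpan : AddSubgroup (K0 C) :=
  AddSubgroup.closure {x | ∃ (j : Fin n) (w : Σ i, V i), w.1 ≠ j ∧ x = K0.mk (h.radicalPiece j w)}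

omit [IsNoetherianRing Cᵐᵒᵖ] in
theorem mk_mem_inflSpan {M : FGMod C} (i : Fin n) (hM : IsKilled (q i) M) :
    K0.mk M ∈ h.inflSpan :=
  AddSubgroup.subset_closure ⟨i, descMod (h.surj i) M hM, (mk_inflMod_descMod _ M hM).symm⟩

theorem radicalSpan_fg : h.radicalSpan.FG := by
  classical
  refine (AddSubgroup.fg_iff _).2 ⟨_, rfl, Set.Finite.subset (Set.finite_range
    fun p : Fin n × (Σ i, V i) => K0.mk (h.radicalPiece p.1 p.2)) ?_⟩
  rintro _ ⟨j, w, -, rfl⟩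
  exact ⟨(j, w), rfl⟩

/-- All syzygies over `C` are direct sums of inflated modules. -/
theorem omegaBar_mem_inflSpan (x : K0 C) : omegaBar C x ∈ h.inflSpan := by
  induction x using K0.induction_mk with
  | hneg x hx => rw [map_neg]; exact neg_mem hx
  | hadd x y hx hy => rw [map_add]; exact add_mem hx hy
  | hmk M =>
  obtain ⟨r, v, m, hm, hs, hk⟩ := h.basic.exists_minimal_family (M := M)
  have hfin := fun s => finite_rightFixed (h.basic.idem (v s))
  have hproj := fun s => projective_rightFixed (h.basic.idem (v s))
  let P : FGMod C := FGModuleCat.of Cᵐᵒᵖ (∀ s, rightFixed (e (v s)))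
  let f : P →ₗ[Cᵐᵒᵖ] M := familyMap (fun s => e (v s)) m
  have hP : Module.Projective Cᵐᵒᵖ P :=
    projective_pi (M := fun s => rightFixed (e (v s)))
  have hf : Function.Surjective f := familyMap_surjective (fun s => h.basic.idem (v s)) hm hs
  -- Minimality of the cover places its kernel in the radical, where `mul_eq_zero` applies.
  have hK : IsKilledByAll q (LinearMap.ker f) :=
    h.isKilledByAll_of_components (K := LinearMap.ker f) hk
  rw [omegaBar_mk, omegaClass_eq f hP hf, h.mk_eq_sum_piece hK]
  exact sum_mem fun i _ => h.mk_mem_inflSpan i (h.isKilled_piece hK i)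

end IsGluing

end Gluing


/-! ### Glued algebras: syzygies, coinvariants and the finiteness criterion -/

section Gluing

variable {k : Type u} [Field k] {n : ℕ} {V : Fin n → Type u} [∀ i, Fintype (V i)]
  {C : Type u} [Ring C] [Algebra k Cᵐᵒᵖ] {A : Fin n → Type u} [∀ i, Ring (A i)]
  [∀ i, Algebra k (A i)ᵐᵒᵖ]

namespace IsGluing

variable {e : (Σ i, V i) → Cᵐᵒᵖ} {χ : (Σ i, V i) → Cᵐᵒᵖ →ₐ[k] k}
  {e' : ∀ i, V i → (A i)ᵐᵒᵖ} {χ' : ∀ i, V i → (A i)ᵐᵒᵖ →ₐ[k] k}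
  {q : ∀ i, Cᵐᵒᵖ →+* (A i)ᵐᵒᵖ} (h : IsGluing e χ e' χ' q)

include h

/-- The projection `⨁ C e → ⨁ A e`. -/
def projMap (i : Fin n) {σ : Type*} (v : σ → V i) :
    (∀ s, rightFixed (e ⟨i, v s⟩)) →ₛₗ[q i] (∀ s, rightFixed (e' i (v s))) where
  toFun x s := ⟨q i (x s), by rw [mem_rightFixed, ← h.q_self, ← map_mul, (x s).2]⟩
  map_add' x y := by ext s; exact map_add (q i) _ _
  map_smul' c x := by ext s; exact map_mul (q i) _ _

theorem projMap_surjective (i : Fin n) {σ : Type*} (v : σ → V i) :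
    Function.Surjective (h.projMap i v) := by
  intro y
  choose z hz using fun s => h.surj i (y s : (A i)ᵐᵒᵖ)
  refine ⟨fun s => ⟨z s * e ⟨i, v s⟩, ?_⟩, ?_⟩
  · rw [mem_rightFixed, mul_assoc, h.basic.idem]
  · ext s
    change q i (z s * e ⟨i, v s⟩) = y s
    rw [map_mul, hz, h.q_self]
    exact (y s).2

/-- Each component lies in `C e` with `e` a vertex of the `i`-th part; if it is also fixed on the
left by the idempotent of that part, it belongs to the corner, on which `q i` is injective. -/
theorem eq_zero_of_projMap_eq_zero {i : Fin n} {σ : Type*} {v : σ → V i}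
    {x : ∀ s, rightFixed (e ⟨i, v s⟩)} (hx : h.projMap i v x = 0) (hx' : partIdem e i • x = x) :
    x = 0 := by
  ext s
  have h1 : q i (x s) = 0 := congrArg Subtype.val (congrFun hx s)
  have h2 : partIdem e i * (x s : Cᵐᵒᵖ) = x s := congrArg Subtype.val (congrFun hx' s)
  have h3 : (x s : Cᵐᵒᵖ) * partIdem e i = x s := by
    rw [← show (x s : Cᵐᵒᵖ) * e ⟨i, v s⟩ = x s from (x s).2, mul_assoc, h.mul_partIdem_self]
  have h4 := h.corner i _ h1
  change partIdem e i * (x s : Cᵐᵒᵖ) * partIdem e i = 0 at h4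
  rwa [h2, h3] at h4

theorem mem_charKer_of_projMap {i : Fin n} {σ : Type*} {v : σ → V i}
    {x : ∀ s, rightFixed (e ⟨i, v s⟩)} {s : σ}
    (hx : ((h.projMap i v x s : rightFixed (e' i (v s))) : (A i)ᵐᵒᵖ) ∈ charKer (χ' i)) :
    (x s : Cᵐᵒᵖ) ∈ charKer χ := by
  rintro ⟨j, w⟩
  by_cases hj : j = i
  · subst hj
    rw [h.chi]
    exact hx w
  · exact h.basic.chi_eq_zero_of_mul_eq (fun heq => hj (congrArg Sigma.fst heq)) (x s).2

variable [IsNoetherianRing Cᵐᵒᵖ] [∀ i, IsNoetherianRing (A i)ᵐᵒᵖ]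

/-- The syzygy over `C` of an `A i`-module is its syzygy over `A i`, up to radical pieces. -/
theorem exists_isSyzygy (i : Fin n) (N : FGMod (A i)) : ∃ Ω : FGMod (A i), IsSyzygy N Ω ∧
    omegaBar C (K0.mk (inflMod (h.surj i) N)) - K0.mk (inflMod (h.surj i) Ω) ∈ h.radicalSpan := by
  obtain ⟨r, v, m, hm, hs, hk⟩ := (h.basic' i).exists_minimal_family (M := N)
  have hfin := fun s => finite_rightFixed (h.basic.idem ⟨i, v s⟩)
  have hproj := fun s => projective_rightFixed (h.basic.idem ⟨i, v s⟩)
  have hfin' := fun s => finite_rightFixed ((h.basic' i).idem (v s))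
  have hproj' := fun s => projective_rightFixed ((h.basic' i).idem (v s))
  let P' : FGMod (A i) := FGModuleCat.of (A i)ᵐᵒᵖ (∀ s, rightFixed (e' i (v s)))
  let f' : P' →ₗ[(A i)ᵐᵒᵖ] N := familyMap (fun s => e' i (v s)) m
  have hP' : Module.Projective (A i)ᵐᵒᵖ P' := projective_pi (M := fun s => rightFixed (e' i (v s)))
  have hf' : Function.Surjective f' := familyMap_surjective (fun s => (h.basic' i).idem (v s)) hm hs
  refine ⟨kerMod f', ⟨P', f', hP', hf', fun N' hN' => (h.basic' i).eq_top_of_sup_eq_top hk hN',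
    ⟨LinearEquiv.refl _ _⟩⟩, ?_⟩
  let P : FGMod C := FGModuleCat.of Cᵐᵒᵖ (∀ s, rightFixed (e ⟨i, v s⟩))
  have hP : Module.Projective Cᵐᵒᵖ P := projective_pi (M := fun s => rightFixed (e ⟨i, v s⟩))
  let Φ := h.projMap i v
  -- The minimal cover over `A i`, composed with `⨁ C e → ⨁ A e`, is a cover over `C` whose kernel
  -- still lies in the radical.
  let f : P →ₗ[Cᵐᵒᵖ] inflMod (h.surj i) N :=
    { toFun := fun x => f' (Φ x)
      map_add' := fun a b => (congrArg f' (Φ.map_add a b)).trans (f'.map_add _ _)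
      map_smul' := fun c a => (congrArg f' (Φ.map_smulₛₗ c a)).trans (f'.map_smul _ _) }
  have hf : Function.Surjective f := hf'.comp (h.projMap_surjective i v)
  have hmem : ∀ x ∈ LinearMap.ker f, ∀ s, ((x : ∀ s, rightFixed (e ⟨i, v s⟩)) s : Cᵐᵒᵖ) ∈ charKer χ :=
    fun x hx s => h.mem_charKer_of_projMap (hk (Φ x) hx s)
  have hK : IsKilledByAll q (LinearMap.ker f) :=
    h.isKilledByAll_of_components (K := LinearMap.ker f) hmem
  -- The projection `Φ` restricts to a bijection from the part in `A i` of `P` onto `P'`: it is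
  -- injective by the corner condition, and surjective because `q i` sends the idempotent of the
  -- part to `1`.
  have hself : K0.mk (FGModuleCat.of Cᵐᵒᵖ (h.piece hK i)) = K0.mk (inflMod (h.surj i) (kerMod f')) := by
    let g : h.piece hK i →ₗ[Cᵐᵒᵖ] Infl (q i) (LinearMap.ker f') :=
      { toFun := fun x => (⟨Φ x.1.1, x.1.2⟩ : LinearMap.ker f')
        map_add' := fun a b => Subtype.ext (Φ.map_add a.1.1 b.1.1)
        map_smul' := fun c a => Subtype.ext (Φ.map_smulₛₗ c a.1.1) }
    refine K0.mk_eq_of_equiv (M := FGModuleCat.of Cᵐᵒᵖ (h.piece hK i))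
      (M' := inflMod (h.surj i) (kerMod f')) (LinearEquiv.ofBijective g ⟨?_, ?_⟩)
    · rw [injective_iff_map_eq_zero]
      rintro ⟨⟨x, hx⟩, hx'⟩ h0
      exact Subtype.ext (Subtype.ext (h.eq_zero_of_projMap_eq_zero (congrArg Subtype.val h0)
        (congrArg Subtype.val hx')))
    · rintro ⟨y, hy⟩
      obtain ⟨x, rfl⟩ := h.projMap_surjective i v y
      have hΦ : Φ (partIdem e i • x) = Φ x := by
        rw [map_smulₛₗ, h.q_partIdem_self, one_smul]
      refine ⟨⟨⟨partIdem e i • x, ?_⟩, ?_⟩, ?_⟩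
      · change f' (Φ (partIdem e i • x)) = 0
        rw [hΦ]; exact hy
      · refine Subtype.ext ?_
        change partIdem e i • partIdem e i • x = partIdem e i • x
        rw [← mul_smul, h.partIdem_idem]
      · exact Subtype.ext hΦ
  -- For `j ≠ i`, `Φ` kills the whole part in `A j`, since `q i` kills its idempotent. That part of
  -- the kernel is therefore the full part in `A j` of the radical of `P`, a sum of radical pieces.
  have hother : ∀ j, j ≠ i → K0.mk (FGModuleCat.of Cᵐᵒᵖ (h.piece hK j)) ∈ h.radicalSpan := by
    intro j hj
    have hpiece : ∀ (x : h.piece hK j) s, partIdem e j * (x.1.1 s : Cᵐᵒᵖ) = x.1.1 s := fun x s =>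
      congrArg Subtype.val (congrFun (congrArg Subtype.val x.2) s)
    let g : h.piece hK j →ₗ[Cᵐᵒᵖ]
        (∀ s, h.piece (h.isKilledByAll_radical ⟨i, v s⟩) j) :=
      { toFun := fun x s => ⟨⟨(x.1.1 s : Cᵐᵒᵖ), hmem x.1.1 x.1.2 s, (x.1.1 s).2⟩,
          Subtype.ext (hpiece x s)⟩
        map_add' := fun _ _ => rfl
        map_smul' := fun _ _ => rfl }
    have hg : Function.Bijective g := by
      constructor
      · intro x y hxy
        refine Subtype.ext (Subtype.ext (funext fun s => Subtype.ext ?_))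
        exact congrArg (fun z : h.piece (h.isKilledByAll_radical ⟨i, v s⟩) j => (z.1.1 : Cᵐᵒᵖ))
          (congrFun hxy s)
      · intro y
        let x : ∀ s, rightFixed (e ⟨i, v s⟩) := fun s => ⟨(y s).1.1, (y s).1.2.2⟩
        have hpx : ∀ s, partIdem e j * (x s : Cᵐᵒᵖ) = x s := fun s =>
          congrArg Subtype.val (y s).2
        have hx0 : Φ x = 0 := by
          ext s
          change q i (x s : Cᵐᵒᵖ) = 0
          rw [← hpx s, map_mul, h.q_partIdem_ne hj.symm, zero_mul]
        refine ⟨⟨⟨x, ?_⟩, ?_⟩, ?_⟩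
        · change f' (Φ x) = 0
          rw [hx0, map_zero]
        · exact Subtype.ext (funext fun s => Subtype.ext (hpx s))
        · rfl
    have h1 := K0.mk_pi (M := FGModuleCat.of Cᵐᵒᵖ (h.piece hK j))
      (fun s => h.radicalPiece j ⟨i, v s⟩) (LinearEquiv.ofBijective g hg)
    rw [h1]
    exact sum_mem fun s _ => AddSubgroup.subset_closure ⟨j, ⟨i, v s⟩, hj.symm, rfl⟩
  have hsum : omegaBar C (K0.mk (inflMod (h.surj i) N)) =
      ∑ j, K0.mk (FGModuleCat.of Cᵐᵒᵖ (h.piece hK j)) := by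
    rw [omegaBar_mk, omegaClass_eq f hP hf, h.mk_eq_sum_piece hK]
  rw [hsum, ← Finset.add_sum_erase _ _ (Finset.mem_univ i), hself, add_sub_cancel_left]
  exact sum_mem fun j hj => hother j (Finset.ne_of_mem_erase hj)

/-- The subgroup generated by the inflations of projective modules over the `A i`. -/
def inflProjSpan : AddSubgroup (K0 C) :=
  AddSubgroup.closure {x | ∃ (i : Fin n) (N : FGMod (A i)), Module.Projective (A i)ᵐᵒᵖ N ∧
    x = K0.mk (inflMod (h.surj i) N)}

-- Every projective `A i`-module is a sum of the finitely many indecomposable ones given by the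
-- vertices.
omit [IsNoetherianRing Cᵐᵒᵖ] [∀ i, IsNoetherianRing (A i)ᵐᵒᵖ] in
theorem inflProjSpan_fg : h.inflProjSpan.FG := by
  classical
  have hfin := fun i v => finite_rightFixed ((h.basic' i).idem v)
  have hproj := fun i v => projective_rightFixed ((h.basic' i).idem v)
  refine (AddSubgroup.fg_iff _).2 ⟨Set.range fun p : Σ i, V i => K0.mk (inflMod (h.surj p.1)
    (FGModuleCat.of (A p.1)ᵐᵒᵖ (rightFixed (e' p.1 p.2)))), le_antisymm ?_ ?_, Set.finite_range _⟩
  · rw [AddSubgroup.closure_le]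
    rintro _ ⟨p, rfl⟩
    exact AddSubgroup.subset_closure ⟨p.1, _, hproj p.1 p.2, rfl⟩
  · unfold inflProjSpan
    rw [AddSubgroup.closure_le]
    rintro _ ⟨i, N, hN, rfl⟩
    obtain ⟨r, v, ⟨E⟩⟩ := (h.basic' i).exists_equiv_of_projective (M := N)
    let F : Infl (q i) N ≃ₗ[Cᵐᵒᵖ] (∀ s, Infl (q i) (rightFixed (e' i (v s)))) :=
      { E.symm.toAddEquiv with map_smul' := fun c a => E.symm.map_smul (q i c) a }
    have h1 := K0.mk_pi (M := inflMod (h.surj i) N) (fun s => inflMod (h.surj i)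
      (FGModuleCat.of (A i)ᵐᵒᵖ (rightFixed (e' i (v s))))) F
    rw [h1]
    exact sum_mem fun s _ => AddSubgroup.subset_closure ⟨⟨i, v s⟩, rfl⟩

/-- The map `K₀(C) → ⨁ K₀(A i)` induced by coinvariants. -/
noncomputable def coinvPi : K0 C →+ (∀ i, K0 (A i)) := AddMonoidHom.pi fun i => coinvHom (h.surj i)

-- An `A i`-module has no coinvariants in another part `j`: the idempotent of part `i` acts as the
-- identity and lies in the kernel of `q j`.
omit [IsNoetherianRing Cᵐᵒᵖ] [∀ i, IsNoetherianRing (A i)ᵐᵒᵖ] in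
theorem coinvPi_mk_inflMod (i : Fin n) (N : FGMod (A i)) :
    h.coinvPi (K0.mk (inflMod (h.surj i) N)) = Pi.single i (K0.mk N) := by
  funext j
  have h0 : h.coinvPi (K0.mk (inflMod (h.surj i) N)) j =
    coinvHom (h.surj j) (K0.mk (inflMod (h.surj i) N)) := rfl
  rw [h0]
  by_cases hj : j = i
  · subst hj
    rw [coinvHom_mk_inflMod, Pi.single_eq_same]
  · rw [Pi.single_eq_of_ne hj]
    refine coinvHom_mk_eq_zero _ _ fun m => ?_
    have h1 : ∀ m : Infl (q i) N, partIdem e i • m = m := fun m => by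
      change q i (partIdem e i) • m.val = m
      rw [h.q_partIdem_self, one_smul]
      rfl
    have h2 := smul_mem_kerSmul (q := q j) (h.q_partIdem_ne hj) m
    exact (congrArg (· ∈ kerSmul (q j) (inflMod (h.surj i) N)) (h1 m)).mp h2

-- Inflation is not defined on `K₀(A i)`, since inflated projectives need not be projective. It is
-- defined modulo `inflProjSpan`, and there it inverts `coinvPi` on the inflated classes.
omit [IsNoetherianRing Cᵐᵒᵖ] [∀ i, IsNoetherianRing (A i)ᵐᵒᵖ] in
theorem mem_inflProjSpan_of_coinvPi_eq_zero {b : K0 C} (hb : b ∈ h.inflSpan)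
    (h0 : h.coinvPi b = 0) : b ∈ h.inflProjSpan := by
  classical
  let J : ∀ i, K0 (A i) →+ K0 C ⧸ h.inflProjSpan := fun i =>
    K0.liftFun (fun N => QuotientAddGroup.mk (K0.mk (inflMod (h.surj i) N)))
      (fun M M' M'' E => by rw [mk_inflMod_prod (h.surj i) E]; rfl)
      (fun P hP => (QuotientAddGroup.eq_zero_iff _).2 (AddSubgroup.subset_closure ⟨i, P, hP, rfl⟩))
  have key : ∀ b ∈ h.inflSpan, ∑ i, J i (h.coinvPi b i) = QuotientAddGroup.mk b := by
    intro b hb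
    induction hb using AddSubgroup.closure_induction with
    | mem x hx =>
      obtain ⟨i, N, rfl⟩ := hx
      rw [Finset.sum_eq_single i]
      · rw [h.coinvPi_mk_inflMod, Pi.single_eq_same, K0.liftFun_mk]
      · intro j _ hj
        rw [h.coinvPi_mk_inflMod, Pi.single_eq_of_ne hj, map_zero]
      · simp
    | zero => simp
    | add x y _ _ hx hy =>
      simp only [map_add, Pi.add_apply, Finset.sum_add_distrib, hx, hy]
      rfl
    | neg x _ hx =>
      simp only [map_neg, Pi.neg_apply, Finset.sum_neg_distrib, hx]
      rfl
  have h1 := key b hb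
  rw [h0] at h1
  simp only [Pi.zero_apply, map_zero, Finset.sum_const_zero] at h1
  exact (QuotientAddGroup.eq_zero_iff _).1 h1.symm

/-- Syzygies commute with coinvariants up to radical pieces. -/
theorem coinvPi_omegaBar_sub_mem {b : K0 C} (hb : b ∈ h.inflSpan) :
    h.coinvPi (omegaBar C b) - (fun i => omegaBar (A i) (h.coinvPi b i)) ∈
      h.radicalSpan.map h.coinvPi := by
  induction hb using AddSubgroup.closure_induction with
  | mem x hx =>
    obtain ⟨i, N, rfl⟩ := hx
    obtain ⟨Ω, hΩ, hmem⟩ := h.exists_isSyzygy i N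
    refine ⟨_, hmem, ?_⟩
    rw [map_sub, h.coinvPi_mk_inflMod, h.coinvPi_mk_inflMod]
    congr 1
    funext j
    by_cases hj : j = i
    · subst hj
      rw [Pi.single_eq_same, Pi.single_eq_same, omegaBar_mk_of_isSyzygy hΩ]
    · rw [Pi.single_eq_of_ne hj, Pi.single_eq_of_ne hj, map_zero]
  | zero =>
    convert zero_mem (h.radicalSpan.map h.coinvPi)
    funext i
    simp
  | add x y _ _ hx hy =>
    convert add_mem hx hy using 1
    funext i
    simp only [map_add, Pi.add_apply, Pi.sub_apply]
    abel
  | neg x _ hx =>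
    convert neg_mem hx using 1
    funext i
    simp only [map_neg, Pi.neg_apply, Pi.sub_apply]
    abel

/-- The main finiteness criterion for glued algebras. -/
theorem phiDim_lt_top [IsArtinianRing Cᵐᵒᵖ] [∀ i, IsArtinianRing (A i)ᵐᵒᵖ]
    (O : AddSubgroup (K0 C)) (hDO : h.radicalSpan ≤ O) (hOB : O ≤ h.inflSpan)
    (hTO : ∀ x ∈ O, omegaBar C x ∈ O) (hO : IsSyzygyFinite O) (hφ : ∀ i, phiDim (A i) < ⊤) :
    phiDim C < ⊤ := by
  let S : AddMonoid.End (∀ i, K0 (A i)) := AddMonoidHom.pi fun i =>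
    (omegaBar (A i) : K0 (A i) →+ K0 (A i)).comp (Pi.evalAddMonoidHom (fun i => K0 (A i)) i)
  have hSpow : ∀ (l : ℕ) (y : ∀ i, K0 (A i)) (i : Fin n), (S ^ l) y i = (omegaBar (A i) ^ l) (y i) := by
    intro l
    induction l with
    | zero => intro y i; rfl
    | succ l ih => intro y i; rw [pow_succ, pow_succ]; exact ih (S y) i
  -- There are finitely many parts, so the largest of their stabilization indices serves for the
  -- product.
  have hS : ∃ N : ℕ, ∀ y, (S ^ (N + 1)) y = 0 → (S ^ N) y = 0 := by
    choose N hN using fun i => exists_ker_of_phiDim_lt_top (hφ i)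
    refine ⟨Finset.univ.sup N, fun y hy => funext fun i => ?_⟩
    have h1 := congrFun hy i
    rw [hSpow] at h1 ⊢
    obtain ⟨d, hd⟩ := Nat.exists_eq_add_of_le (Finset.le_sup (f := N) (Finset.mem_univ i))
    rw [hd] at h1 ⊢
    have h2 : (omegaBar (A i) ^ N i) (y i) = 0 := by
      rw [← toIntLinearMap_pow]
      refine pow_apply_eq_zero_of_le (AddMonoidHom.toIntLinearMap (omegaBar (A i))) ?_ (d + 1) (y i) ?_
      · intro x; rw [toIntLinearMap_pow, toIntLinearMap_pow]; exact hN i x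
      · rw [toIntLinearMap_pow, show d + 1 + N i = N i + d + 1 by ring]; exact h1
    rw [add_comm, pow_add]
    exact (congrArg (omegaBar (A i) ^ d) h2).trans (map_zero (omegaBar (A i) ^ d))
  obtain ⟨m, hm⟩ := exists_ker_pow_stable_addSubgroup (omegaBar C) S h.coinvPi h.inflSpan
    h.inflProjSpan h.radicalSpan O h.omegaBar_mem_inflSpan
    (fun b hb h0 => h.mem_inflProjSpan_of_coinvPi_eq_zero hb h0) h.inflProjSpan_fg
    h.radicalSpan_fg hDO hOB hTO hO (fun b hb => h.coinvPi_omegaBar_sub_mem hb) hS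
  exact phiDim_lt_top_of_ker hm

end IsGluing

end Gluing


/-! ### Universal property of the path algebra -/

section PathAlgebraLift

variable {k : Type u} [Field k] {V : Type u} [Quiver.{u} V] {B : Type*} [Ring B] [Algebra k B]

/-- The value of a path under an assignment of values to vertices and arrows. -/
def pathVal (b : V → B) (arr : ∀ {a c : V}, (a ⟶ c) → B) {a : V} : ∀ {c : V}, Quiver.Path a c → B
  | _, .nil => b a
  | _, .cons p α => pathVal b arr p * arr α

/-- The linear map on the path algebra with given values on vertices and arrows. -/
noncomputable def liftLinear (b : V → B) (arr : ∀ {a c : V}, (a ⟶ c) → B) :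
    PathAlgebra k V →ₗ[k] B :=
  Finsupp.linearCombination k (fun p : AllPaths V => pathVal b arr p.2.2)

theorem liftLinear_ofPath (b : V → B) (arr : ∀ {a c : V}, (a ⟶ c) → B) {a c : V}
    (p : Quiver.Path a c) : liftLinear (k := k) b arr (ofPath k p) = pathVal b arr p :=
  (Finsupp.linearCombination_single k _ _).trans (one_smul k _)

variable {b : V → B} {arr : ∀ {a c : V}, (a ⟶ c) → B}

theorem mul_pathVal (hb : ∀ a, b a * b a = b a) {a c : V} (p : Quiver.Path a c) :
    b a * pathVal b arr p = pathVal b arr p := by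
  induction p with
  | nil => exact hb a
  | cons p α ih => rw [pathVal, ← mul_assoc, ih]

theorem pathVal_mul (hb : ∀ a, b a * b a = b a)
    (harr : ∀ {a c : V} (α : a ⟶ c), arr α * b c = arr α) {a c : V} (p : Quiver.Path a c) :
    pathVal b arr p * b c = pathVal b arr p := by
  cases p with
  | nil => exact hb a
  | cons p α => rw [pathVal, mul_assoc, harr]

theorem pathVal_comp (hb : ∀ a, b a * b a = b a)
    (harr : ∀ {a c : V} (α : a ⟶ c), arr α * b c = arr α) {a c d : V} (p : Quiver.Path a c)
    (p' : Quiver.Path c d) :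
    pathVal b arr (p.comp p') = pathVal b arr p * pathVal b arr p' := by
  induction p' with
  | nil => exact (pathVal_mul hb harr p).symm
  | cons p' α ih => rw [Quiver.Path.comp_cons, pathVal, pathVal, ih, mul_assoc]

theorem pathVal_eq_zero (harr : ∀ {a c : V} (α : a ⟶ c), arr α = 0) {a c : V}
    (p : Quiver.Path a c) (hp : 1 ≤ p.length) : pathVal b arr p = 0 := by
  cases p with
  | nil => simp at hp
  | cons p α => rw [pathVal, harr, mul_zero]

variable [Fintype V]

/-- The universal property of the path algebra. -/
noncomputable def liftHom (b : V → B) (arr : ∀ {a c : V}, (a ⟶ c) → B)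
    (hb : ∀ a, b a * b a = b a) (hort : ∀ a c, a ≠ c → b a * b c = 0) (hsum : ∑ a, b a = 1)
    (harr : ∀ {a c : V} (α : a ⟶ c), arr α * b c = arr α) : PathAlgebra k V →ₐ[k] B :=
  AlgHom.ofLinearMap (liftLinear b arr)
    (by
      rw [one_eq, map_sum, ← hsum]
      exact Finset.sum_congr rfl fun v _ => liftLinear_ofPath b arr _)
    (by
      intro x y
      induction x using induction_ofPath with
      | h0 => simp
      | hadd x x' hx hx' => rw [add_mul, map_add, hx, hx', map_add, add_mul]
      | hp r a c p =>
      induction y using induction_ofPath with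
      | h0 => simp
      | hadd x x' hx hx' => rw [mul_add, map_add, hx, hx', map_add, mul_add]
      | hp r a' c' p' =>
      rw [smul_mul_assoc, mul_smul_comm, map_smul, map_smul, map_smul, map_smul, smul_mul_assoc,
        mul_smul_comm]
      congr 2
      by_cases hca : c = a'
      · subst hca
        rw [ofPath_mul_ofPath, liftLinear_ofPath, liftLinear_ofPath, liftLinear_ofPath,
          pathVal_comp hb harr]
      · rw [ofPath_mul_ofPath_of_ne _ _ hca, map_zero, liftLinear_ofPath, liftLinear_ofPath,
          ← pathVal_mul hb harr p, ← mul_pathVal hb p', mul_assoc, ← mul_assoc (b c), hort _ _ hca,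
          zero_mul, mul_zero])

end PathAlgebraLift

/-! ### Length filtration and vertex characters -/

section VertexCharacters

variable {k : Type u} [Field k] {V : Type u} [Quiver.{u} V]

variable (k V) in
/-- The span of the paths of length at least `m`. -/
noncomputable def lengthSpan (m : ℕ) : Submodule k (PathAlgebra k V) :=
  Submodule.span k {x | ∃ (a c : V) (p : Quiver.Path a c), m ≤ p.length ∧ x = ofPath k p}

theorem ofPath_mem_lengthSpan {m : ℕ} {a c : V} (p : Quiver.Path a c) (hp : m ≤ p.length) :
    ofPath k p ∈ lengthSpan k V m := Submodule.subset_span ⟨a, c, p, hp, rfl⟩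

variable [Fintype V]

theorem mul_mem_lengthSpan {m m' : ℕ} {x y : PathAlgebra k V} (hx : x ∈ lengthSpan k V m)
    (hy : y ∈ lengthSpan k V m') : x * y ∈ lengthSpan k V (m + m') := by
  induction hx using Submodule.span_induction with
  | zero => rw [zero_mul]; exact zero_mem _
  | add a b _ _ ha hb => rw [add_mul]; exact add_mem ha hb
  | smul c a _ ha => rw [smul_mul_assoc]; exact Submodule.smul_mem _ _ ha
  | mem x hx =>
  obtain ⟨a, c, p, hp, rfl⟩ := hx
  induction hy using Submodule.span_induction with
  | zero => rw [mul_zero]; exact zero_mem _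
  | add a b _ _ ha hb => rw [mul_add]; exact add_mem ha hb
  | smul c a _ ha => rw [mul_smul_comm]; exact Submodule.smul_mem _ _ ha
  | mem y hy =>
  obtain ⟨a', c', p', hp', rfl⟩ := hy
  by_cases hca : c = a'
  · subst hca
    rw [ofPath_mul_ofPath]
    exact ofPath_mem_lengthSpan _ (by rw [Quiver.Path.length_comp]; omega)
  · rw [ofPath_mul_ofPath_of_ne _ _ hca]
    exact zero_mem _

theorem pow_mem_lengthSpan {x : PathAlgebra k V} (hx : x ∈ lengthSpan k V 1) (m : ℕ) :
    x ^ (m + 1) ∈ lengthSpan k V (m + 1) := by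
  induction m with
  | zero => simpa using hx
  | succ m ih => rw [pow_succ]; exact mul_mem_lengthSpan ih hx

open Classical in
variable (k) in
/-- The character of the path algebra that is given by the coefficient of a vertex. -/
noncomputable def vertexChar (v : V) : PathAlgebra k V →ₐ[k] k :=
  liftHom (fun w => if w = v then 1 else 0) (fun _ => 0) (fun a => by split_ifs <;> simp)
    (fun a c hac => by
      by_cases h : a = v
      · have : c ≠ v := fun h' => hac (h.trans h'.symm)
        simp [this]
      · simp [h])
    (by simp) (fun _ => zero_mul _)

open Classical in
theorem vertexChar_ofPath (v : V) {a c : V} (p : Quiver.Path a c) :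
    vertexChar k v (ofPath k p) = pathVal (fun w => if w = v then 1 else 0) (fun _ => 0) p :=
  liftLinear_ofPath _ _ p

theorem vertexChar_nil_self (v : V) :
    vertexChar k v (ofPath k (Quiver.Path.nil : Quiver.Path v v)) = 1 :=
  (vertexChar_ofPath v _).trans (if_pos rfl)

theorem vertexChar_nil_ne {v w : V} (h : w ≠ v) :
    vertexChar k v (ofPath k (Quiver.Path.nil : Quiver.Path w w)) = 0 :=
  (vertexChar_ofPath v _).trans (if_neg h)

theorem vertexChar_of_one_le (v : V) {a c : V} (p : Quiver.Path a c) (hp : 1 ≤ p.length) :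
    vertexChar k v (ofPath k p) = 0 :=
  (vertexChar_ofPath v p).trans (pathVal_eq_zero (fun _ => rfl) p hp)

/-- The vertex characters read off the coefficients of the trivial paths, so their common kernel
consists of combinations of paths of positive length. -/
theorem sub_sum_vertexChar_mem (x : PathAlgebra k V) :
    x - ∑ v, vertexChar k v x • ofPath k (Quiver.Path.nil : Quiver.Path v v) ∈
      lengthSpan k V 1 := by
  classical
  induction x using induction_ofPath with
  | h0 => simp
  | hadd x y hx hy =>
    convert add_mem hx hy using 1
    simp only [map_add, add_smul, Finset.sum_add_distrib]
    abel
  | hp r a c p =>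
    have key : ofPath k p - ∑ v, vertexChar k v (ofPath k p) •
        ofPath k (Quiver.Path.nil : Quiver.Path v v) ∈ lengthSpan k V 1 := by
      cases p with
      | nil =>
        rw [Finset.sum_eq_single a, vertexChar_nil_self, one_smul, sub_self]
        · exact zero_mem _
        · intro v _ hv
          rw [vertexChar_nil_ne hv.symm, zero_smul]
        · simp
      | cons p α =>
        rw [Finset.sum_eq_zero, sub_zero]
        · exact ofPath_mem_lengthSpan _ (by simp)
        · intro v _
          rw [vertexChar_of_one_le v _ (by simp), zero_smul]
    convert Submodule.smul_mem _ r key using 1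
    simp only [map_smul, smul_sub, Finset.smul_sum, smul_smul, smul_eq_mul]

theorem mem_lengthSpan_one {x : PathAlgebra k V} (hx : ∀ v, vertexChar k v x = 0) :
    x ∈ lengthSpan k V 1 := by
  have := sub_sum_vertexChar_mem x
  rwa [Finset.sum_eq_zero (fun v _ => by rw [hx v, zero_smul]), sub_zero] at this

omit [Fintype V] in
theorem mem_lengthSpan_of_support {m : ℕ} {x : PathAlgebra k V}
    (hx : ∀ p ∈ Finsupp.support (α := AllPaths V) (M := k) x, m ≤ p.2.2.length) :
    x ∈ lengthSpan k V m := by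
  let y : AllPaths V →₀ k := x
  have h1 : y = Finsupp.sum y (fun p c => Finsupp.single p c) := (Finsupp.sum_single y).symm
  have h2 : ∀ p ∈ y.support, (Finsupp.single p (y p) : AllPaths V →₀ k) ∈ lengthSpan k V m := by
    intro p hp
    have h3 : (Finsupp.single p (y p) : AllPaths V →₀ k) = y p • Finsupp.single p 1 := by
      rw [Finsupp.smul_single, smul_eq_mul, mul_one]
    rw [h3]
    exact (lengthSpan k V m).smul_mem (y p) (ofPath_mem_lengthSpan p.2.2 (hx p hp))
  have h4 : y ∈ lengthSpan k V m := by
    rw [h1]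
    exact Submodule.sum_mem (lengthSpan k V m) h2
  exact h4

theorem vertexChar_eq_zero_of_mem {m : ℕ} (hm : 1 ≤ m) {x : PathAlgebra k V}
    (hx : x ∈ lengthSpan k V m) (v : V) : vertexChar k v x = 0 := by
  induction hx using Submodule.span_induction with
  | zero => exact map_zero _
  | add a b _ _ ha hb => rw [map_add, ha, hb, add_zero]
  | smul c a _ ha => rw [map_smul, ha, smul_zero]
  | mem x hx =>
    obtain ⟨a, c, p, hp, rfl⟩ := hx
    exact vertexChar_of_one_le v p (hm.trans hp)

end VertexCharacters

/-! ### Bound quiver algebras are split basic -/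

section BoundAlgebra

variable {k : Type u} [Field k] {V : Type u} [Quiver.{u} V] [Fintype V]
  {I : Ideal (PathAlgebra k V)} [I.IsTwoSided]

/-- The idempotent of a vertex in (the opposite of) a bound quiver algebra. -/
noncomputable def vertexIdem (I : Ideal (PathAlgebra k V)) [I.IsTwoSided] (v : V) :
    (BoundAlgebra I)ᵐᵒᵖ :=
  MulOpposite.op (Ideal.Quotient.mk I (ofPath k (Quiver.Path.nil : Quiver.Path v v)))

omit [I.IsTwoSided] in
theorem IsAdmissible.vertexChar_eq_zero (hI : IsAdmissible I) (v : V) (x : PathAlgebra k V)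
    (hx : x ∈ I) : vertexChar k v x = 0 :=
  vertexChar_eq_zero_of_mem one_le_two (mem_lengthSpan_of_support (hI.1 x hx)) v

/-- The character of a vertex of a bound quiver algebra. -/
noncomputable def boundChar (hI : IsAdmissible I) (v : V) : (BoundAlgebra I)ᵐᵒᵖ →ₐ[k] k :=
  AlgHom.fromOpposite (Ideal.Quotient.liftₐ I (vertexChar k v) (hI.vertexChar_eq_zero v))
    fun _ _ => mul_comm _ _

theorem boundChar_mk (hI : IsAdmissible I) (v : V) (x : PathAlgebra k V) :
    boundChar hI v (MulOpposite.op (Ideal.Quotient.mk I x)) = vertexChar k v x := rfl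

theorem exists_op_mk (x : (BoundAlgebra I)ᵐᵒᵖ) :
    ∃ z, MulOpposite.op (Ideal.Quotient.mk I z) = x := by
  obtain ⟨z, hz⟩ := Ideal.Quotient.mk_surjective x.unop
  exact ⟨z, by rw [hz, MulOpposite.op_unop]⟩

omit [I.IsTwoSided] in
theorem IsAdmissible.mem_of_mem_lengthSpan {m : ℕ}
    (hm : ∀ (a b : V) (p : Quiver.Path a b), m ≤ p.length → ofPath k p ∈ I) {x : PathAlgebra k V}
    (hx : x ∈ lengthSpan k V m) : x ∈ I := by
  induction hx using Submodule.span_induction with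
  | zero => exact zero_mem _
  | add a b _ _ ha hb => exact add_mem ha hb
  | smul c a _ ha => rw [Algebra.smul_def]; exact I.mul_mem_left _ ha
  | mem x hx =>
    obtain ⟨a, c, p, hp, rfl⟩ := hx
    exact hm a c p hp

theorem IsAdmissible.isSplitBasic (hI : IsAdmissible I) :
    IsSplitBasic (vertexIdem I) (boundChar hI) where
  idem v := by
    rw [vertexIdem, ← MulOpposite.op_mul, ← map_mul, ofPath_mul_ofPath]
    rfl
  ortho v w hvw := by
    rw [vertexIdem, vertexIdem, ← MulOpposite.op_mul, ← map_mul,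
      ofPath_mul_ofPath_of_ne _ _ hvw.symm, map_zero, MulOpposite.op_zero]
  sum_eq_one := by
    have h1 : (1 : (BoundAlgebra I)ᵐᵒᵖ) = MulOpposite.op (Ideal.Quotient.mk I 1) := rfl
    rw [h1, one_eq, map_sum, Finset.op_sum]
    rfl
  chi_self v := (boundChar_mk hI v _).trans (vertexChar_nil_self v)
  chi_ne v w hvw := (boundChar_mk hI v _).trans (vertexChar_nil_ne hvw.symm)
  nil x hx := by
    obtain ⟨z, rfl⟩ := exists_op_mk x
    obtain ⟨m, hm, hp⟩ := hI.2
    -- An element killed by all characters is represented by paths of positive length, and its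
    -- `m`-th power by paths of length at least `m`, which lie in `I`.
    have hz : z ∈ lengthSpan k V 1 := mem_lengthSpan_one hx
    refine ⟨m, ?_⟩
    rw [← MulOpposite.op_pow, ← map_pow, Ideal.Quotient.eq_zero_iff_mem.2, MulOpposite.op_zero]
    have h1 := pow_mem_lengthSpan hz (m - 1)
    rw [Nat.sub_add_cancel (by omega)] at h1
    exact IsAdmissible.mem_of_mem_lengthSpan hp h1

theorem isArtinianRing_mop (k A : Type u) [Field k] [Ring A] [Algebra k A] [Module.Finite k A] :
    IsArtinianRing Aᵐᵒᵖ :=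
  have : Module.Finite k Aᵐᵒᵖ := Module.Finite.equiv (MulOpposite.opLinearEquiv k (M := A))
  isArtinian_of_tower k (inferInstance : IsArtinian k Aᵐᵒᵖ)

end BoundAlgebra


/-! ### Paths of the glued quiver modulo the relations -/

section GluedPaths

variable {m : ℕ} {Q : Fin m → Type u} {D : ∀ i j : Fin m, Q i → Q j → Type u}
  [∀ i, Quiver.{u} (Q i)] {k : Type u} [Field k]

/-- The paths of the glued quiver that are not forced to be zero: the paths of the parts, and the
paths that start with a connecting arrow and go on in its target part. -/
inductive IsGluedPath : ∀ {a b : Glued Q D}, Quiver.Path a b → Prop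
  | inner {i : Fin m} {v w : Q i} (p : Quiver.Path v w) :
      IsGluedPath ((inclQ Q D i).mapPath p)
  | conn {i j : Fin m} (hij : i ≠ j) {v : Q i} {w w' : Q j} (δ : D i j v w)
      (p : Quiver.Path w w') :
      IsGluedPath ((connArrow Q D hij δ).toPath.comp ((inclQ Q D j).mapPath p))

theorem incl_ofPath (i : Fin m) {v w : Q i} (p : Quiver.Path v w) :
    incl Q D k i (ofPath k p) = ofPath k ((inclQ Q D i).mapPath p) :=
  (Finsupp.linearCombination_single k _ _).trans (one_smul k _)

variable [∀ i, Fintype (Q i)]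

theorem ofPath_cons {V : Type u} [Quiver.{u} V] [Fintype V] {a b c : V} (p : Quiver.Path a b)
    (α : b ⟶ c) : ofPath k (p.cons α) = ofPath k p * ofArrow k α :=
  (ofPath_mul_ofPath p α.toPath).symm

theorem incl_mul (i : Fin m) (x y : PathAlgebra k (Q i)) :
    incl Q D k i (x * y) = incl Q D k i x * incl Q D k i y := by
  induction x using induction_ofPath with
  | h0 => simp
  | hadd x x' hx hx' => rw [add_mul, map_add, hx, hx', map_add, add_mul]
  | hp r a c p =>
  induction y using induction_ofPath with
  | h0 => simp
  | hadd x x' hx hx' => rw [mul_add, map_add, hx, hx', map_add, mul_add]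
  | hp r a' c' p' =>
  rw [smul_mul_assoc, mul_smul_comm, map_smul, map_smul, map_smul, map_smul, smul_mul_assoc,
    mul_smul_comm]
  congr 2
  rw [incl_ofPath, incl_ofPath]
  by_cases hca : c = a'
  · subst hca
    rw [ofPath_mul_ofPath, ofPath_mul_ofPath, incl_ofPath, Prefunctor.mapPath_comp]
  · rw [ofPath_mul_ofPath_of_ne _ _ hca, ofPath_mul_ofPath_of_ne, map_zero]
    intro heq
    exact hca (eq_of_heq (Sigma.mk.inj heq).2)

section Restriction

/-- Transport of an element of a path algebra along an equality of indices. -/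
noncomputable def castPart {i j : Fin m} (h : j = i) (x : PathAlgebra k (Q j)) :
    PathAlgebra k (Q i) := h ▸ x

variable (D k) in
/-- The value of a vertex under the restriction to the `i`-th part. -/
noncomputable def restrVertex (i : Fin m) (a : Glued Q D) : PathAlgebra k (Q i) :=
  if h : a.1 = i then castPart h (ofPath k (Quiver.Path.nil : Quiver.Path a.2 a.2)) else 0

variable (D k) in
/-- The value of an arrow under the restriction to the `i`-th part. -/
noncomputable def restrArrow (i : Fin m) {a b : Glued Q D} : (a ⟶ b) → PathAlgebra k (Q i)
  | GluedHom.inner (i := j) α => if h : j = i then castPart h (ofArrow k α) else 0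
  | GluedHom.conn _ _ => 0

theorem restrVertex_self (i : Fin m) (v : Q i) : restrVertex D k i ⟨i, v⟩ =
    ofPath k (Quiver.Path.nil : Quiver.Path v v) := dif_pos rfl

theorem restrVertex_ne {i : Fin m} {a : Glued Q D} (h : a.1 ≠ i) : restrVertex D k i a = 0 :=
  dif_neg h

theorem restrArrow_inner_self (i : Fin m) {v w : Q i} (α : v ⟶ w) :
    restrArrow D k i (innerArrow Q D α) = ofArrow k α := dif_pos rfl

theorem restrArrow_inner_ne {i j : Fin m} (h : j ≠ i) {v w : Q j} (α : v ⟶ w) :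
    restrArrow D k i (innerArrow Q D α) = 0 := dif_neg h

theorem restrVertex_idem (i : Fin m) (a : Glued Q D) :
    restrVertex D k i a * restrVertex D k i a = restrVertex D k i a := by
  obtain ⟨j, v⟩ := a
  by_cases h : j = i
  · subst h
    rw [restrVertex_self, ofPath_mul_ofPath]
    rfl
  · rw [restrVertex_ne (a := ⟨j, v⟩) h, mul_zero]

theorem restrArrow_mul (i : Fin m) {a b : Glued Q D} (α : a ⟶ b) :
    restrArrow D k i α * restrVertex D k i b = restrArrow D k i α := by
  change GluedHom Q D _ _ at α
  cases α with
  | @inner j v w α =>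
    by_cases h : j = i
    · subst h
      change restrArrow D k j (innerArrow Q D α) * _ = restrArrow D k j (innerArrow Q D α)
      rw [restrArrow_inner_self, restrVertex_self]
      exact ofPath_mul_ofPath _ _
    · change restrArrow D k i (innerArrow Q D α) * _ = restrArrow D k i (innerArrow Q D α)
      rw [restrArrow_inner_ne h, zero_mul]
  | conn h δ => exact zero_mul _

variable (D k) in
/-- The restriction `kΓ → kQ i`, which sends the vertices outside `Q i` and the connecting arrows
to zero. -/
noncomputable def restr (i : Fin m) : PathAlgebra k (Glued Q D) →ₐ[k] PathAlgebra k (Q i) :=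
  liftHom (restrVertex D k i) (restrArrow D k i) (restrVertex_idem i)
    (by
      rintro ⟨j, v⟩ ⟨j', v'⟩ hne
      by_cases h : j = i
      · by_cases h' : j' = i
        · subst h
          subst h'
          rw [restrVertex_self, restrVertex_self, ofPath_mul_ofPath_of_ne]
          rintro rfl
          exact hne rfl
        · rw [restrVertex_ne (a := ⟨j', v'⟩) h', mul_zero]
      · rw [restrVertex_ne (a := ⟨j, v⟩) h, zero_mul])
    (by
      refine (Fintype.sum_sigma (fun a : Σ i, Q i => restrVertex D k i a)).trans ?_
      rw [Finset.sum_eq_single i, one_eq]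
      · exact Finset.sum_congr rfl fun v _ => restrVertex_self i v
      · intro j _ hj
        exact Finset.sum_eq_zero fun v _ => restrVertex_ne (a := ⟨j, v⟩) hj
      · simp)
    (restrArrow_mul i)

theorem restr_ofPath (i : Fin m) {a b : Glued Q D} (p : Quiver.Path a b) :
    restr D k i (ofPath k p) = pathVal (restrVertex D k i) (restrArrow D k i) p :=
  liftLinear_ofPath _ _ p

theorem restr_ofPath_of_ne {i : Fin m} {a b : Glued Q D} (p : Quiver.Path a b)
    (h : a.1 ≠ i ∨ b.1 ≠ i) : restr D k i (ofPath k p) = 0 := by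
  rw [restr_ofPath]
  rcases h with h | h
  · rw [← mul_pathVal (restrVertex_idem i), restrVertex_ne h, zero_mul]
  · rw [← pathVal_mul (restrVertex_idem i) (restrArrow_mul i), restrVertex_ne h, mul_zero]

theorem restr_ofPath_mapPath (i : Fin m) {v w : Q i} (p : Quiver.Path v w) :
    restr D k i (ofPath k ((inclQ Q D i).mapPath p)) = ofPath k p := by
  rw [restr_ofPath]
  induction p with
  | nil => exact restrVertex_self i v
  | cons p α ih =>
    rw [Prefunctor.mapPath_cons, pathVal, ih, ofPath_cons]
    exact congrArg _ (restrArrow_inner_self i α)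

theorem restr_incl (i : Fin m) (x : PathAlgebra k (Q i)) : restr D k i (incl Q D k i x) = x := by
  induction x using induction_ofPath with
  | h0 => simp
  | hadd x y hx hy => rw [map_add, map_add, hx, hy]
  | hp r a c p => rw [map_smul, map_smul, incl_ofPath, restr_ofPath_mapPath]

/-- A path either stays in `Q i` or meets a vertex outside it, and then restricts to zero. -/
theorem incl_restr_ofPath (i : Fin m) {a b : Glued Q D} (p : Quiver.Path a b) :
    incl Q D k i (restr D k i (ofPath k p)) = ofPath k p ∨ restr D k i (ofPath k p) = 0 := by
  induction p with
  | nil =>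
    obtain ⟨j, v⟩ := a
    by_cases h : j = i
    · subst h
      left
      have h1 := restr_ofPath_mapPath (D := D) (k := k) j (Quiver.Path.nil : Quiver.Path v v)
      have h2 := incl_ofPath (D := D) (k := k) j (Quiver.Path.nil : Quiver.Path v v)
      exact (congrArg (incl Q D k j) h1).trans h2
    · exact Or.inr (restr_ofPath_of_ne _ (Or.inl h))
  | @cons b c p α ih =>
    rw [ofPath_cons, map_mul]
    rcases ih with ih | ih
    · change GluedHom Q D _ _ at α
      cases α with
      | @inner j v w α =>
        by_cases h : j = i
        · subst h
          left
          rw [incl_mul, ih]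
          congr 1
          have h1 := restr_ofPath_mapPath (D := D) (k := k) j α.toPath
          have h2 := incl_ofPath (D := D) (k := k) j α.toPath
          exact (congrArg (incl Q D k j) h1).trans h2
        · right
          have h1 : restr D k i (ofArrow k (innerArrow Q D α)) = 0 :=
            restr_ofPath_of_ne (innerArrow Q D α).toPath (Or.inl h)
          exact (congrArg _ h1).trans (mul_zero _)
      | @conn j j' hjj v w δ =>
        right
        have h1 : restr D k i (ofArrow k (connArrow Q D hjj δ)) = 0 := by
          refine restr_ofPath_of_ne (connArrow Q D hjj δ).toPath ?_
          by_contra! hcon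
          exact hjj (hcon.1.trans hcon.2.symm)
        exact (congrArg _ h1).trans (mul_zero _)
    · right
      rw [ih, zero_mul]

theorem incl_one_mul_ofPath (i : Fin m) {a b : Glued Q D} (p : Quiver.Path a b) :
    incl Q D k i 1 * ofPath k p = if a.1 = i then ofPath k p else 0 := by
  rw [one_eq, map_sum, Finset.sum_mul]
  obtain ⟨j, v⟩ := a
  split_ifs with h
  · change j = i at h
    subst h
    rw [Finset.sum_eq_single v]
    · rw [incl_ofPath]
      exact (ofPath_mul_ofPath _ p).trans (congrArg _ (Quiver.Path.nil_comp p))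
    · intro w _ hw
      rw [incl_ofPath]
      exact ofPath_mul_ofPath_of_ne _ _ fun heq => hw (eq_of_heq (Sigma.mk.inj heq).2)
    · simp
  · refine Finset.sum_eq_zero fun w _ => ?_
    rw [incl_ofPath]
    exact ofPath_mul_ofPath_of_ne _ _ fun heq => h (congrArg Sigma.fst heq).symm

theorem ofPath_mul_incl_one (i : Fin m) {a b : Glued Q D} (p : Quiver.Path a b) :
    ofPath k p * incl Q D k i 1 = if b.1 = i then ofPath k p else 0 := by
  rw [one_eq, map_sum, Finset.mul_sum]
  obtain ⟨j, v⟩ := b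
  split_ifs with h
  · change j = i at h
    subst h
    rw [Finset.sum_eq_single v]
    · rw [incl_ofPath]
      exact ofPath_mul_ofPath p _
    · intro w _ hw
      rw [incl_ofPath]
      exact ofPath_mul_ofPath_of_ne _ _ fun heq => hw (eq_of_heq (Sigma.mk.inj heq).2).symm
    · simp
  · refine Finset.sum_eq_zero fun w _ => ?_
    rw [incl_ofPath]
    exact ofPath_mul_ofPath_of_ne _ _ fun heq => h (congrArg Sigma.fst heq)

end Restriction

section Relations

variable {IC : Ideal (PathAlgebra k (Glued Q D))} [IC.IsTwoSided]
  (hinner : ∀ (i j : Fin m) (hij : i ≠ j) (u v : Q i) (w : Q j) (α : u ⟶ v) (δ : D i j v w),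
    ofArrow k (innerArrow Q D α) * ofArrow k (connArrow Q D hij δ) ∈ IC)
  (hconn : ∀ (i j l : Fin m) (hij : i ≠ j) (hjl : j ≠ l) (u : Q i) (v : Q j) (w : Q l)
    (δ : D i j u v) (δ' : D j l v w),
    ofArrow k (connArrow Q D hij δ) * ofArrow k (connArrow Q D hjl δ') ∈ IC)

include hinner hconn

omit [IC.IsTwoSided] in
/-- An arrow followed by a connecting arrow is a relation. -/
theorem ofArrow_mul_conn_mem {i j : Fin m} (hij : i ≠ j) {a : Glued Q D} {v : Q i} {w : Q j}
    (α : a ⟶ (inclQ Q D i).obj v) (δ : D i j v w) :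
    ofArrow k α * ofArrow k (connArrow Q D hij δ) ∈ IC := by
  change GluedHom Q D _ _ at α
  cases α with
  | inner α => exact hinner _ _ hij _ _ _ α δ
  | conn h δ' => exact hconn _ _ _ h hij _ _ _ δ' δ

/-- A connecting arrow survives only as the first arrow: any arrow directly before it, inner or
connecting, yields a relation. Inner arrows may always be appended. -/
theorem isGluedPath_or_mem {a b : Glued Q D} (p : Quiver.Path a b) :
    IsGluedPath p ∨ ofPath k p ∈ IC := by
  induction p with
  | nil =>
    obtain ⟨i, v⟩ := a
    exact Or.inl (IsGluedPath.inner (Quiver.Path.nil : Quiver.Path v v))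
  | @cons b c p α ih =>
    rcases ih with ih | ih
    · change GluedHom Q D _ _ at α
      cases α with
      | @inner i v w α =>
        left
        cases ih with
        | inner p => exact IsGluedPath.inner (p.cons α)
        | conn hij δ p => exact IsGluedPath.conn hij δ (p.cons α)
      | @conn i j hij v w δ =>
        have hmem : ∀ {a' b' : Glued Q D} (p' : Quiver.Path a' b') (β : b' ⟶ (inclQ Q D i).obj v),
            ofPath k ((p'.cons β).cons (connArrow Q D hij δ)) ∈ IC := by
          intro a' b' p' β
          rw [ofPath_cons, ofPath_cons, mul_assoc]
          exact IC.mul_mem_left _ (ofArrow_mul_conn_mem hinner hconn hij β δ)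
        cases ih with
        | inner p =>
          cases p with
          | nil => exact Or.inl (IsGluedPath.conn hij δ Quiver.Path.nil)
          | cons p β => exact Or.inr (hmem ((inclQ Q D i).mapPath p) (innerArrow Q D β))
        | conn hij' δ' p =>
          cases p with
          | nil => exact Or.inr (hmem Quiver.Path.nil (connArrow Q D hij' δ'))
          | cons p β => exact Or.inr (hmem _ (innerArrow Q D β))
    · right
      rw [ofPath_cons]
      exact IC.mul_mem_right _ ih

/-- Modulo the relations, the corner of the `i`-th part consists of the paths of `Q i`. -/
theorem corner_sub_incl_restr_mem (i : Fin m) (z : PathAlgebra k (Glued Q D)) :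
    incl Q D k i 1 * z * incl Q D k i 1 - incl Q D k i (restr D k i z) ∈ IC := by
  induction z using induction_ofPath with
  | h0 => simp
  | hadd x y hx hy =>
    convert add_mem hx hy using 1
    rw [mul_add, add_mul, map_add, map_add]
    abel
  | hp r a b p =>
    have key : incl Q D k i 1 * ofPath k p * incl Q D k i 1 -
        incl Q D k i (restr D k i (ofPath k p)) ∈ IC := by
      rw [incl_one_mul_ofPath]
      by_cases ha : a.1 = i
      · rw [if_pos ha, ofPath_mul_incl_one]
        by_cases hb : b.1 = i
        · rw [if_pos hb]
          rcases isGluedPath_or_mem hinner hconn p with hp | hp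
          · cases hp with
            | @inner j v w p =>
              have hj : j = i := ha
              subst hj
              rw [restr_ofPath_mapPath, incl_ofPath, sub_self]
              exact zero_mem _
            -- Such a path starts and ends in different parts, so it cannot lie in the corner.
            | conn hij δ p => exact absurd (ha.trans hb.symm) hij
          · rcases incl_restr_ofPath (k := k) i p with h | h
            · rw [h, sub_self]; exact zero_mem _
            · rw [h, map_zero, sub_zero]; exact hp
        · rw [if_neg hb, restr_ofPath_of_ne p (Or.inr hb), map_zero, sub_self]
          exact zero_mem _
      · rw [if_neg ha, zero_mul, restr_ofPath_of_ne p (Or.inl ha), map_zero, sub_self]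
        exact zero_mem _
    have h2 := IC.mul_mem_left (algebraMap k (PathAlgebra k (Glued Q D)) r) key
    rw [← Algebra.smul_def] at h2
    convert h2 using 1
    rw [mul_smul_comm, smul_mul_assoc, map_smul, map_smul, smul_sub]

/-- Elements of the radical annihilate what lies outside the parts. -/
theorem mul_sub_sum_incl_restr_mem {w : PathAlgebra k (Glued Q D)}
    (hw : w ∈ lengthSpan k (Glued Q D) 1) (z : PathAlgebra k (Glued Q D)) :
    w * (z - ∑ i, incl Q D k i (restr D k i z)) ∈ IC := by
  classical
  induction z using induction_ofPath with
  | h0 => simp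
  | hadd x y hx hy =>
    convert add_mem hx hy using 1
    rw [← mul_add]
    congr 1
    simp only [map_add, Finset.sum_add_distrib]
    abel
  | hp r a b p =>
    have key : w * (ofPath k p - ∑ i, incl Q D k i (restr D k i (ofPath k p))) ∈ IC := by
      rcases isGluedPath_or_mem hinner hconn p with hp | hp
      · cases hp with
        | @inner j v v' p =>
          rw [Finset.sum_eq_single j, restr_ofPath_mapPath, incl_ofPath, sub_self, mul_zero]
          · exact zero_mem _
          · intro i _ hi
            rw [restr_ofPath_of_ne _ (Or.inl (Ne.symm hi)), map_zero]
          · simp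
        | @conn i j hij v v' v'' δ p =>
          -- The path leaves its part, so all its restrictions vanish. A path of `w` that ends at
          -- its source has a last arrow `β`, and `β δ` is a relation.
          rw [Finset.sum_eq_zero, sub_zero]
          · induction hw using Submodule.span_induction with
            | zero => rw [zero_mul]; exact zero_mem _
            | add a b _ _ ha hb => rw [add_mul]; exact add_mem ha hb
            | smul c a _ ha =>
              rw [smul_mul_assoc, Algebra.smul_def]
              exact IC.mul_mem_left _ ha
            | mem x hx =>
              obtain ⟨a', c', p', hp', rfl⟩ := hx
              cases p' with
              | nil => simp at hp'
              | @cons b' _ p' β =>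
                by_cases hc : c' = (inclQ Q D i).obj v
                · subst hc
                  rw [ofPath_cons, ← ofPath_mul_ofPath (k := k) (connArrow Q D hij δ).toPath,
                    mul_assoc, ← mul_assoc (ofArrow k β)]
                  exact IC.mul_mem_left _ (IC.mul_mem_right _
                    (ofArrow_mul_conn_mem hinner hconn hij β δ))
                · rw [ofPath_mul_ofPath_of_ne _ _ hc]
                  exact zero_mem _
          · intro l _
            rw [restr_ofPath_of_ne, map_zero]
            by_contra! hcon
            exact hij (hcon.1.trans hcon.2.symm)
      · refine IC.mul_mem_left _ (sub_mem hp (sum_mem fun i _ => ?_))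
        rcases incl_restr_ofPath (k := k) i p with h | h
        · rw [h]; exact hp
        · rw [h, map_zero]; exact zero_mem _
    have h2 := IC.mul_mem_left (algebraMap k (PathAlgebra k (Glued Q D)) r) key
    rw [← Algebra.smul_def] at h2
    convert h2 using 1
    simp only [map_smul, ← Finset.smul_sum, ← smul_sub, mul_smul_comm]

/-- The relations of `Γ` restrict to relations of `Q i`. -/
theorem restr_mem {I : ∀ i, Ideal (PathAlgebra k (Q i))}
    (hres : ∀ i (x : PathAlgebra k (Q i)), incl Q D k i x ∈ IC ↔ x ∈ I i) (i : Fin m)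
    {z : PathAlgebra k (Glued Q D)} (hz : z ∈ IC) : restr D k i z ∈ I i := by
  rw [← hres]
  -- Modulo `IC`, including the restriction of `z` amounts to cutting `z` to the corner, which keeps
  -- it in the ideal.
  have h1 := corner_sub_incl_restr_mem hinner hconn i z
  have h2 := sub_mem (IC.mul_mem_right (incl Q D k i 1) (IC.mul_mem_left (incl Q D k i 1) hz)) h1
  rwa [sub_sub_cancel] at h2

end Relations

end GluedPaths


/-! ### The bound quiver algebra of `Γ` is a gluing -/

section GluedAlgebra

variable {k : Type u} [Field k] {m : ℕ} {Q : Fin m → Type u} [∀ i, Fintype (Q i)]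
  [∀ i, Quiver.{u} (Q i)] {I : ∀ i, Ideal (PathAlgebra k (Q i))} [∀ i, (I i).IsTwoSided]
  {D : ∀ i j : Fin m, Q i → Q j → Type u}
  {IC : Ideal (PathAlgebra k (Glued Q D))} [IC.IsTwoSided]

/-- The quotient map from the algebra of the glued quiver to the algebra of a part. -/
noncomputable def partMap (hr : ∀ i, ∀ z ∈ IC, restr D k i z ∈ I i) (i : Fin m) :
    (BoundAlgebra IC)ᵐᵒᵖ →+* (BoundAlgebra (I i))ᵐᵒᵖ :=
  RingHom.op (Ideal.Quotient.lift IC ((Ideal.Quotient.mk (I i)).comp (restr D k i : _ →+* _))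
    fun z hz => Ideal.Quotient.eq_zero_iff_mem.2 (hr i z hz))

theorem partMap_mk (hr : ∀ i, ∀ z ∈ IC, restr D k i z ∈ I i) (i : Fin m)
    (z : PathAlgebra k (Glued Q D)) :
    partMap hr i (MulOpposite.op (Ideal.Quotient.mk IC z)) =
      MulOpposite.op (Ideal.Quotient.mk (I i) (restr D k i z)) := rfl

theorem partMap_surjective (hr : ∀ i, ∀ z ∈ IC, restr D k i z ∈ I i) (i : Fin m) :
    Function.Surjective (partMap hr i) := by
  intro x
  obtain ⟨z, rfl⟩ := exists_op_mk x
  exact ⟨MulOpposite.op (Ideal.Quotient.mk IC (incl Q D k i z)), by rw [partMap_mk, restr_incl]⟩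

theorem partMap_eq_zero {hr : ∀ i, ∀ z ∈ IC, restr D k i z ∈ I i} {i : Fin m}
    {z : PathAlgebra k (Glued Q D)}
    (hz : partMap hr i (MulOpposite.op (Ideal.Quotient.mk IC z)) = 0) : restr D k i z ∈ I i :=
  Ideal.Quotient.eq_zero_iff_mem.1 (MulOpposite.op_injective hz)

theorem vertexChar_restr (i : Fin m) (v : Q i) (z : PathAlgebra k (Glued Q D)) :
    vertexChar k v (restr D k i z) = vertexChar k ((inclQ Q D i).obj v) z := by
  induction z using induction_ofPath with
  | h0 => simp
  | hadd x y hx hy => rw [map_add, map_add, map_add, hx, hy]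
  | hp r a b p =>
    rw [map_smul, map_smul, map_smul]
    congr 1
    cases p with
    | nil =>
      obtain ⟨j, w⟩ := a
      by_cases hj : j = i
      · subst hj
        have h1 := restr_ofPath_mapPath (D := D) (k := k) j (Quiver.Path.nil : Quiver.Path w w)
        refine (congrArg (vertexChar k v) h1).trans ?_
        by_cases hw : w = v
        · subst hw
          exact (vertexChar_nil_self w).trans (vertexChar_nil_self ((inclQ Q D j).obj w)).symm
        · refine (vertexChar_nil_ne hw).trans (vertexChar_nil_ne ?_).symm
          exact fun heq => hw (eq_of_heq (Sigma.mk.inj heq).2)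
      · have h1 := restr_ofPath_of_ne (k := k) (Quiver.Path.nil : Quiver.Path
          ((inclQ Q D j).obj w) ((inclQ Q D j).obj w)) (Or.inl hj)
        refine (congrArg (vertexChar k v) h1).trans ((map_zero _).trans ?_)
        exact (vertexChar_nil_ne (w := (inclQ Q D j).obj w) (v := (inclQ Q D i).obj v)
          fun heq => hj (congrArg Sigma.fst heq)).symm
    | cons p α =>
      rw [vertexChar_of_one_le _ (p.cons α) (by simp), ofPath_cons, map_mul, map_mul]
      have h1 : vertexChar k v (restr D k i (ofArrow k α)) = 0 := by
        obtain ⟨j, w⟩ := b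
        change GluedHom Q D _ _ at α
        cases α with
        | @inner j w' w α =>
          by_cases hj : j = i
          · subst hj
            have h1 := restr_ofPath_mapPath (D := D) (k := k) j α.toPath
            exact (congrArg (vertexChar k v) h1).trans (vertexChar_of_one_le v _ le_rfl)
          · have h1 := restr_ofPath_of_ne (k := k) (innerArrow Q D α).toPath (Or.inl hj)
            exact (congrArg (vertexChar k v) h1).trans (map_zero _)
        | @conn j j' hjj w' w δ =>
          have h1 : restr D k i (ofArrow k (connArrow Q D hjj δ)) = 0 := by
            refine restr_ofPath_of_ne (connArrow Q D hjj δ).toPath ?_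
            by_contra! hcon
            exact hjj (hcon.1.trans hcon.2.symm)
          exact (congrArg (vertexChar k v) h1).trans (map_zero _)
      rw [h1, mul_zero]

/-- The idempotent of the `i`-th part of the glued algebra. -/
theorem partIdem_vertexIdem (i : Fin m) :
    partIdem (V := Q) (vertexIdem IC) i =
      MulOpposite.op (Ideal.Quotient.mk IC (incl Q D k i 1)) := by
  rw [one_eq, map_sum, map_sum, Finset.op_sum]
  refine Finset.sum_congr rfl fun v _ => ?_
  rw [incl_ofPath]
  rfl

section

variable (hres : ∀ i (x : PathAlgebra k (Q i)), incl Q D k i x ∈ IC ↔ x ∈ I i)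
  (hinner : ∀ (i j : Fin m) (hij : i ≠ j) (u v : Q i) (w : Q j) (α : u ⟶ v) (δ : D i j v w),
    ofArrow k (innerArrow Q D α) * ofArrow k (connArrow Q D hij δ) ∈ IC)
  (hconn : ∀ (i j l : Fin m) (hij : i ≠ j) (hjl : j ≠ l) (u : Q i) (v : Q j) (w : Q l)
    (δ : D i j u v) (δ' : D j l v w),
    ofArrow k (connArrow Q D hij δ) * ofArrow k (connArrow Q D hjl δ') ∈ IC)

include hres hinner hconn

-- Modulo `IC`, a radical element only sees the restrictions of `z` to the parts, and these are
-- relations of the parts, hence of `Γ`.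
omit [∀ i, (I i).IsTwoSided] in
theorem mul_mem_of_restr_mem {w z : PathAlgebra k (Glued Q D)}
    (hw : w ∈ lengthSpan k (Glued Q D) 1) (hz : ∀ i, restr D k i z ∈ I i) : w * z ∈ IC := by
  have h1 := mul_sub_sum_incl_restr_mem hinner hconn hw z
  have h2 : w * ∑ i, incl Q D k i (restr D k i z) ∈ IC :=
    IC.mul_mem_left _ (sum_mem fun i _ => (hres i _).2 (hz i))
  have h3 := add_mem h1 h2
  rwa [← mul_add, sub_add_cancel] at h3

omit [∀ i, (I i).IsTwoSided] in
theorem corner_mem_of_restr_mem {i : Fin m} {z : PathAlgebra k (Glued Q D)}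
    (hz : restr D k i z ∈ I i) : incl Q D k i 1 * (z * incl Q D k i 1) ∈ IC := by
  have h1 := add_mem (corner_sub_incl_restr_mem hinner hconn i z) ((hres i _).2 hz)
  rwa [sub_add_cancel, mul_assoc] at h1

/-- Algebras of quivers that are glued along connecting arrows, each of which is killed by
whatever arrow precedes it. -/
theorem isGluing_vertexIdem (hI : ∀ i, IsAdmissible (I i)) (hIC : IsAdmissible IC)
    (hr : ∀ i, ∀ z ∈ IC, restr D k i z ∈ I i) :
    IsGluing (V := Q) (C := BoundAlgebra IC) (vertexIdem (V := Glued Q D) IC) (boundChar (V := Glued Q D) hIC)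
      (fun i => vertexIdem (I i))
      (fun i => boundChar (hI i)) (partMap hr) where
  basic := hIC.isSplitBasic
  basic' i := (hI i).isSplitBasic
  surj := partMap_surjective hr
  q_self i v := congrArg (fun z => MulOpposite.op (Ideal.Quotient.mk (I i) z))
    (restr_ofPath_mapPath (D := D) (k := k) i (Quiver.Path.nil : Quiver.Path v v))
  q_ne i j v hij := by
    refine (congrArg (fun z => MulOpposite.op (Ideal.Quotient.mk (I i) z))
      (restr_ofPath_of_ne (k := k) (Quiver.Path.nil : Quiver.Path ((inclQ Q D j).obj v) ((inclQ Q D j).obj v))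
        (Or.inl (Ne.symm hij)))).trans ?_
    rw [map_zero, MulOpposite.op_zero]
  chi i v x := by
    obtain ⟨z, rfl⟩ := exists_op_mk x
    exact (vertexChar_restr i v z).symm
  mul_eq_zero x y hx hy := by
    obtain ⟨z, rfl⟩ := exists_op_mk x
    obtain ⟨w, rfl⟩ := exists_op_mk y
    have hz : ∀ i, restr D k i z ∈ I i := fun i => partMap_eq_zero (hx i)
    have hw : w ∈ lengthSpan k (Glued Q D) 1 := mem_lengthSpan_one hy
    rw [← MulOpposite.op_mul, ← map_mul]
    exact congrArg MulOpposite.op (Ideal.Quotient.eq_zero_iff_mem.2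
      (mul_mem_of_restr_mem hres hinner hconn hw hz))
  corner i x hx := by
    obtain ⟨z, rfl⟩ := exists_op_mk x
    have h1 := corner_mem_of_restr_mem hres hinner hconn (partMap_eq_zero hx)
    change partIdem (V := Q) (C := BoundAlgebra IC) (vertexIdem (V := Glued Q D) IC) i *
      MulOpposite.op (Ideal.Quotient.mk IC z) *
        partIdem (V := Q) (C := BoundAlgebra IC) (vertexIdem (V := Glued Q D) IC) i = 0
    rw [partIdem_vertexIdem, ← MulOpposite.op_mul, ← MulOpposite.op_mul, ← map_mul, ← map_mul]
    exact congrArg MulOpposite.op (Ideal.Quotient.eq_zero_iff_mem.2 h1)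

end

end GluedAlgebra


/-! ### Superfluous submodules and syzygies of direct sums -/

section Superfluous

variable {R P P' : Type*} [Ring R] [AddCommGroup P] [Module R P] [AddCommGroup P'] [Module R P']

/-- The image of a superfluous submodule is superfluous. -/
theorem eq_top_of_map_sup_eq_top {K : Submodule R P}
    (hK : ∀ N : Submodule R P, K ⊔ N = ⊤ → N = ⊤) (g : P →ₗ[R] P') {N : Submodule R P'}
    (hN : K.map g ⊔ N = ⊤) : N = ⊤ := by
  have h1 : N.comap g = ⊤ := by
    refine hK _ (eq_top_iff.2 fun p _ => ?_)
    obtain ⟨_, ⟨a, ha, rfl⟩, b, hb, hab⟩ := Submodule.mem_sup.1 (hN ▸ trivial : g p ∈ K.map g ⊔ N)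
    refine Submodule.mem_sup.2 ⟨a, ha, p - a, ?_, add_sub_cancel _ _⟩
    rw [Submodule.mem_comap, map_sub, ← hab, add_sub_cancel_left]
    exact hb
  rw [← hN, eq_comm, sup_eq_right, Submodule.map_le_iff_le_comap, h1]
  exact le_top

/-- The product is the sum of the images of the two factors, both superfluous, and these are
absorbed one after the other. -/
theorem eq_top_of_prod_sup_eq_top {K : Submodule R P} {K' : Submodule R P'}
    (hK : ∀ N : Submodule R P, K ⊔ N = ⊤ → N = ⊤) (hK' : ∀ N : Submodule R P', K' ⊔ N = ⊤ → N = ⊤)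
    {N : Submodule R (P × P')} (hN : K.prod K' ⊔ N = ⊤) : N = ⊤ := by
  refine eq_top_of_map_sup_eq_top hK' (LinearMap.inr R P P') ?_
  refine eq_top_of_map_sup_eq_top hK (LinearMap.inl R P P') ?_
  rw [← sup_assoc, eq_top_iff, ← hN]
  refine sup_le_sup_right (fun x hx => ?_) N
  refine Submodule.mem_sup.2 ⟨_, ⟨x.1, hx.1, rfl⟩, _, ⟨x.2, hx.2, rfl⟩, ?_⟩
  simp

/-- The syzygy of a direct sum. -/
theorem IsSyzygy.prod {A : Type u} [Ring A] {M X Y K K' : FGMod A} (E : M ≃ₗ[Aᵐᵒᵖ] (X × Y))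
    (hX : IsSyzygy X K) (hY : IsSyzygy Y K') :
    IsSyzygy M (FGModuleCat.of Aᵐᵒᵖ (K × K')) := by
  obtain ⟨P, f, hP, hf, hs, ⟨E1⟩⟩ := hX
  obtain ⟨P', f', hP', hf', hs', ⟨E2⟩⟩ := hY
  have hk : LinearMap.ker (E.symm.toLinearMap ∘ₗ LinearMap.prodMap f f') =
      (LinearMap.ker f).prod (LinearMap.ker f') := by
    rw [← LinearMap.ker_prodMap]
    exact LinearEquiv.ker_comp E.symm _
  refine ⟨FGModuleCat.of Aᵐᵒᵖ (P × P'), E.symm.toLinearMap ∘ₗ LinearMap.prodMap f f',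
    inferInstanceAs (Module.Projective Aᵐᵒᵖ (P × P')), E.symm.surjective.comp (hf.prodMap hf'),
    fun N hN => ?_, ⟨?_⟩⟩
  · rw [hk] at hN
    exact eq_top_of_prod_sup_eq_top hs hs' hN
  · exact (LinearEquiv.prodCongr E1 E2).trans
      ((LinearEquiv.ofEq _ _ hk).trans
      { toFun := fun x => (⟨x.1.1, x.2.1⟩, ⟨x.1.2, x.2.2⟩)
        invFun := fun y => ⟨(y.1.1, y.2.1), ⟨y.1.2, y.2.2⟩⟩
        map_add' := fun _ _ => rfl
        map_smul' := fun _ _ => rfl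
        left_inv := fun _ => rfl
        right_inv := fun _ => rfl }).symm

end Superfluous

/-- A linear map between modules that are annihilated by the kernel of `q`. -/
def Desc.map {R S : Type*} [Ring R] [Ring S] {q : R →+* S} (hq : Function.Surjective q)
    {M M' : Type*} [AddCommGroup M] [Module R M] [AddCommGroup M'] [Module R M']
    (hM : IsKilled q M) (hM' : IsKilled q M') (f : M →ₗ[R] M') :
    Desc hq hM →ₗ[S] Desc hq hM' where
  toFun x := f x.val
  map_add' x y := f.map_add x.val y.val
  map_smul' c x := by
    obtain ⟨r, rfl⟩ := hq c
    rw [Desc.val_smul, f.map_smul]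
    exact (Desc.smul_eq hq hM' r (f x.val)).symm

/-! ### Radical pieces as summands of syzygies of simple modules -/

section Gluing

variable {k : Type u} [Field k] {n : ℕ} {V : Fin n → Type u} [∀ i, Fintype (V i)]
  {C : Type u} [Ring C] [Algebra k Cᵐᵒᵖ] {A : Fin n → Type u} [∀ i, Ring (A i)]
  [∀ i, Algebra k (A i)ᵐᵒᵖ]

namespace IsGluing

variable {e : (Σ i, V i) → Cᵐᵒᵖ} {χ : (Σ i, V i) → Cᵐᵒᵖ →ₐ[k] k}
  {e' : ∀ i, V i → (A i)ᵐᵒᵖ} {χ' : ∀ i, V i → (A i)ᵐᵒᵖ →ₐ[k] k}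
  {q : ∀ i, Cᵐᵒᵖ →+* (A i)ᵐᵒᵖ} (h : IsGluing e χ e' χ' q)

include h

/-- A linear map respects the decomposition into pieces. -/
def pieceMap {W W' : Type u} [AddCommGroup W] [Module Cᵐᵒᵖ W] [AddCommGroup W'] [Module Cᵐᵒᵖ W']
    (hW : IsKilledByAll q W) (hW' : IsKilledByAll q W') (i : Fin n) (f : W →ₗ[Cᵐᵒᵖ] W') :
    h.piece hW i →ₗ[Cᵐᵒᵖ] h.piece hW' i :=
  f.restrict fun w hw => by rw [mem_piece, ← f.map_smul, (h.mem_piece hW).1 hw]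

/-- The projective cover of the direct sum of the simple modules outside the `j`-th part. -/
def simplesCover (j : Fin n) : (∀ s : {w : Σ i, V i // w.1 ≠ j}, rightFixed (e s.1)) →ₗ[Cᵐᵒᵖ]
    (∀ l : {l : Fin n // l ≠ j}, inflMod (h.surj l) (charSum (χ' l))) where
  toFun x l := (fun v => χ ⟨l, v⟩ (x ⟨⟨l, v⟩, l.2⟩) : ∀ v, CharModule (χ' l v))
  map_add' x y := funext fun l => funext fun v => map_add (χ ⟨l, v⟩) _ _
  map_smul' c x := funext fun l => funext fun v => by
    refine (map_mul (χ ⟨l, v⟩) c (x ⟨⟨l, v⟩, l.2⟩)).trans ?_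
    rw [h.chi l v c]
    rfl

theorem simplesCover_surjective (j : Fin n) : Function.Surjective (h.simplesCover j) := by
  intro y
  let y' : ∀ (l : {l : Fin n // l ≠ j}) (v : V l), k := y
  refine ⟨fun s => ⟨algebraMap k Cᵐᵒᵖ (y' ⟨s.1.1, s.2⟩ s.1.2) * e s.1, ?_⟩, ?_⟩
  · rw [mem_rightFixed, mul_assoc, h.basic.idem]
  · refine funext fun l => funext fun v => ?_
    change χ ⟨l, v⟩ (algebraMap k Cᵐᵒᵖ (y' l v) * e ⟨l, v⟩) = y' l v
    rw [map_mul, AlgHom.commutes, h.basic.chi_self]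
    exact mul_one _

/-- On `C e` with `e` a vertex idempotent, all characters but that of the vertex vanish. So the
kernel is the full radical, and the cover is a projective cover. -/
theorem mem_ker_simplesCover {j : Fin n}
    {x : ∀ s : {w : Σ i, V i // w.1 ≠ j}, rightFixed (e s.1)} :
    x ∈ LinearMap.ker (h.simplesCover j) ↔ ∀ s, (x s : Cᵐᵒᵖ) ∈ charKer χ := by
  constructor
  · rintro hx ⟨⟨l, v⟩, hl⟩ w
    by_cases hw : w = ⟨l, v⟩
    · subst hw
      exact congrFun (congrFun hx ⟨l, hl⟩) v
    · exact h.basic.chi_eq_zero_of_mul_eq hw (x ⟨⟨l, v⟩, hl⟩).2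
  · intro hx
    exact funext fun l => funext fun v => hx ⟨⟨l, v⟩, l.2⟩ ⟨l, v⟩

variable [IsNoetherianRing Cᵐᵒᵖ]

theorem isKilled_radicalPiece (j : Fin n) (w : Σ i, V i) : IsKilled (q j) (h.radicalPiece j w) :=
  h.isKilled_piece (h.isKilledByAll_radical w) j

variable [∀ i, IsNoetherianRing (A i)ᵐᵒᵖ]

/-- The radical pieces are summands of the part in `A j` of the syzygy of the direct sum of the
simple modules outside the `j`-th part. -/
theorem exists_isSyzygy_simples (j : Fin n) : ∃ K : FGMod C,
    IsSyzygy (FGModuleCat.of Cᵐᵒᵖ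
      (∀ l : {l : Fin n // l ≠ j}, inflMod (h.surj l) (charSum (χ' l)))) K ∧
    ∃ hK : IsKilledByAll q K, ∀ w : Σ i, V i, w.1 ≠ j →
      IsSummand (descMod (h.surj j) (h.radicalPiece j w) (h.isKilled_radicalPiece j w))
        (descMod (h.surj j) (FGModuleCat.of Cᵐᵒᵖ (h.piece hK j)) (h.isKilled_piece hK j)) := by
  classical
  have hfin := fun s : {w : Σ i, V i // w.1 ≠ j} => finite_rightFixed (h.basic.idem s.1)
  have hproj := fun s : {w : Σ i, V i // w.1 ≠ j} => projective_rightFixed (h.basic.idem s.1)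
  let P : FGMod C := FGModuleCat.of Cᵐᵒᵖ (∀ s : {w : Σ i, V i // w.1 ≠ j}, rightFixed (e s.1))
  have hP : Module.Projective Cᵐᵒᵖ P :=
    projective_pi (M := fun s : {w : Σ i, V i // w.1 ≠ j} => rightFixed (e s.1))
  have hK : IsKilledByAll q (LinearMap.ker (h.simplesCover j)) :=
    h.isKilledByAll_of_components fun x hx => h.mem_ker_simplesCover.1 hx
  refine ⟨FGModuleCat.of Cᵐᵒᵖ (LinearMap.ker (h.simplesCover j)),
    ⟨P, h.simplesCover j, hP, h.simplesCover_surjective j, fun N hN =>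
      h.basic.eq_top_of_sup_eq_top (fun x hx => h.mem_ker_simplesCover.1 hx) hN,
      ⟨LinearEquiv.refl _ _⟩⟩, hK, fun w hw => ?_⟩
  -- The kernel is the direct sum of the radicals of the `C e`. The inclusion and projection of the
  -- summand at `w` respect parts and give the retraction.
  let f : (charKer χ ⊓ rightFixed (e w) : Submodule Cᵐᵒᵖ Cᵐᵒᵖ) →ₗ[Cᵐᵒᵖ]
      LinearMap.ker (h.simplesCover j) :=
    LinearMap.codRestrict _ (LinearMap.single Cᵐᵒᵖ
        (fun s : {w : Σ i, V i // w.1 ≠ j} => rightFixed (e s.1)) ⟨w, hw⟩ ∘ₗ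
        Submodule.inclusion inf_le_right) fun x => by
      rw [mem_ker_simplesCover]
      intro s
      by_cases hs : s = ⟨w, hw⟩
      · subst hs
        rw [LinearMap.comp_apply, LinearMap.single_apply, Pi.single_eq_same]
        exact x.2.1
      · rw [LinearMap.comp_apply, LinearMap.single_apply, Pi.single_eq_of_ne hs]
        exact zero_mem _
  let g : LinearMap.ker (h.simplesCover j) →ₗ[Cᵐᵒᵖ]
      (charKer χ ⊓ rightFixed (e w) : Submodule Cᵐᵒᵖ Cᵐᵒᵖ) :=
    { toFun := fun x => ⟨(x.1 ⟨w, hw⟩ : rightFixed (e w)),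
        h.mem_ker_simplesCover.1 x.2 _, (x.1 ⟨w, hw⟩).2⟩
      map_add' := fun x y => rfl
      map_smul' := fun c x => rfl }
  have hgf : ∀ x, g (f x) = x := fun x => by
    have h1 := congrArg (fun y : rightFixed (e w) => (y : Cᵐᵒᵖ))
      (Pi.single_eq_same (M := fun s : {w : Σ i, V i // w.1 ≠ j} => rightFixed (e s.1))
        ⟨w, hw⟩ (Submodule.inclusion inf_le_right x))
    exact Subtype.ext h1
  refine isSummand_of_retract
    (Desc.map (h.surj j) (h.isKilled_radicalPiece j w) (h.isKilled_piece hK j)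
      (h.pieceMap (h.isKilledByAll_radical w) hK j f))
    (Desc.map (h.surj j) (h.isKilled_piece hK j) (h.isKilled_radicalPiece j w)
      (h.pieceMap hK (h.isKilledByAll_radical w) j g)) fun x => ?_
  exact Subtype.ext (hgf _)

end IsGluing

end Gluing


/-! ### The orbit subgroup contains the radical pieces and is stable under `Ω̄` -/

section OrbitSubgroup

variable {k : Type u} [Field k] {m : ℕ} {Q : Fin m → Type u} [∀ i, Fintype (Q i)]
  [∀ i, Quiver.{u} (Q i)] {I : ∀ i, Ideal (PathAlgebra k (Q i))} [∀ i, (I i).IsTwoSided]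
  {D : ∀ i j : Fin m, Q i → Q j → Type u}
  {IC : Ideal (PathAlgebra k (Glued Q D))} [IC.IsTwoSided]
  {hI : ∀ i, IsAdmissible (I i)} {hIC : IsAdmissible IC}
  {hr : ∀ i, ∀ z ∈ IC, restr D k i z ∈ I i}
  (h : IsGluing (V := Q) (C := BoundAlgebra IC) (vertexIdem (V := Glued Q D) IC)
    (boundChar (V := Glued Q D) hIC) (fun i => vertexIdem (I i)) (fun i => boundChar (hI i))
    (partMap hr))

include h

/-- The module `N`, regarded as a module over the glued algebra, is unique. -/
theorem IsGluing.nonempty_equiv_of_isInflation {i : Fin m} {N : FGMod (BoundAlgebra (I i))}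
    {W : FGMod (BoundAlgebra IC)} (hW : IsInflation I IC i N W) :
    Nonempty (Infl (partMap hr i) N ≃ₗ[(BoundAlgebra IC)ᵐᵒᵖ] W) := by
  obtain ⟨φ, ⟨hinj, hrange, hmul⟩, hsurj⟩ := hW
  suffices hsmul : ∀ (c : (BoundAlgebra IC)ᵐᵒᵖ) (x : Infl (partMap hr i) N),
      φ (c • x).val = c • φ x.val by
    let f : Infl (partMap hr i) N →ₗ[(BoundAlgebra IC)ᵐᵒᵖ] W :=
      { toFun := fun x => φ x.val
        map_add' := fun x y => φ.map_add x.val y.val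
        map_smul' := hsmul }
    exact ⟨LinearEquiv.ofBijective f ⟨hinj, hsurj⟩⟩
  intro c x
  obtain ⟨z, rfl⟩ := exists_op_mk c
  have hfix : ∀ w : W, partIdem (V := Q) (C := BoundAlgebra IC)
      (vertexIdem (V := Glued Q D) IC) i • w = w := fun w => by
    rw [partIdem_vertexIdem]
    exact (hrange w).1 (hsurj w)
  -- The data of an inflation only prescribe the action of `kQ i`. An arbitrary `z` acts as the
  -- inclusion of its restriction, because their difference is killed by `q i` and therefore
  -- vanishes in the corner.
  have h1 : partMap hr i (MulOpposite.op (Ideal.Quotient.mk IC z) -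
      MulOpposite.op (Ideal.Quotient.mk IC (incl Q D k i (restr D k i z)))) = 0 := by
    rw [map_sub, partMap_mk, partMap_mk, restr_incl, sub_self]
  have h2 := congrArg (· • φ x.val) (h.corner i _ h1)
  simp only [zero_smul] at h2
  change (partIdem (V := Q) (C := BoundAlgebra IC) (vertexIdem (V := Glued Q D) IC) i * _ *
    partIdem (V := Q) (C := BoundAlgebra IC) (vertexIdem (V := Glued Q D) IC) i) • φ x.val = 0 at h2
  rw [mul_smul, hfix, mul_smul, hfix, sub_smul, sub_eq_zero] at h2
  exact (hmul _ x.val).trans h2.symm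

theorem IsGluing.mk_eq_of_isInflation {i : Fin m} {N : FGMod (BoundAlgebra (I i))}
    {W : FGMod (BoundAlgebra IC)} (hW : IsInflation I IC i N W) :
    K0.mk W = K0.mk (inflMod (h.surj i) N) := by
  obtain ⟨E⟩ := h.nonempty_equiv_of_isInflation hW
  exact (K0.mk_eq_of_equiv (M := inflMod (h.surj i) N) (M' := W) E).symm

theorem IsGluing.isRestriction_piece {K : FGMod (BoundAlgebra IC)}
    (hK : IsKilledByAll (partMap hr) K) (j : Fin m) [IsNoetherianRing (BoundAlgebra IC)ᵐᵒᵖ] :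
    IsRestriction I IC j K (descMod (h.surj j)
      (FGModuleCat.of (BoundAlgebra IC)ᵐᵒᵖ (h.piece hK j)) (h.isKilled_piece hK j)) := by
  refine ⟨(h.piece hK j).subtype.toAddMonoidHom, Subtype.val_injective, fun y => ?_, fun x n => ?_⟩
  · rw [← partIdem_vertexIdem]
    exact ⟨fun ⟨a, ha⟩ => ha ▸ a.2, fun hy => ⟨⟨y, hy⟩, rfl⟩⟩
  · have h1 : partMap hr j (MulOpposite.op (Ideal.Quotient.mk IC (incl Q D k j x))) =
        MulOpposite.op (Ideal.Quotient.mk (I j) x) := by rw [partMap_mk, restr_incl]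
    rw [← h1]
    exact congrArg Subtype.val (Desc.val_smul (hq := h.surj j) (hM := h.isKilled_piece hK j) _ n)

theorem IsGluing.isInflation_of_equiv {i : Fin m} {W : FGMod (BoundAlgebra IC)}
    {N : FGMod (BoundAlgebra (I i))} (E : W ≃ₗ[(BoundAlgebra IC)ᵐᵒᵖ] Infl (partMap hr i) N) :
    IsInflation I IC i N W := by
  refine ⟨E.symm.toLinearMap.toAddMonoidHom, ⟨E.symm.injective, fun y => ?_, fun x n => ?_⟩,
    E.symm.surjective⟩
  · refine ⟨fun _ => ?_, fun _ => E.symm.surjective y⟩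
    rw [← partIdem_vertexIdem]
    refine E.injective ((E.map_smul _ y).trans ?_)
    change partMap hr i (partIdem (V := Q) (C := BoundAlgebra IC)
      (vertexIdem (V := Glued Q D) IC) i) • (E y).val = (E y).val
    rw [h.q_partIdem_self, one_smul]
  · have h1 : partMap hr i (MulOpposite.op (Ideal.Quotient.mk IC (incl Q D k i x))) =
        MulOpposite.op (Ideal.Quotient.mk (I i) x) := by rw [partMap_mk, restr_incl]
    rw [← h1]
    exact E.symm.map_smul (MulOpposite.op (Ideal.Quotient.mk IC (incl Q D k i x))) n

theorem IsGluing.isInflation_inflMod (i : Fin m) (N : FGMod (BoundAlgebra (I i))) :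
    IsInflation I IC i N (inflMod (h.surj i) N) :=
  h.isInflation_of_equiv (W := inflMod (h.surj i) N) (LinearEquiv.refl _ (Infl (partMap hr i) N))

theorem IsGluing.orbitSubgroup_le_inflSpan : orbitSubgroup I IC ≤ h.inflSpan := by
  refine (AddSubgroup.closure_le _).2 ?_
  rintro _ ⟨i, n, N, L, X, W, -, -, -, hW, rfl⟩
  exact AddSubgroup.subset_closure ⟨i, X, h.mk_eq_of_isInflation hW⟩

variable [Module.Finite k (BoundAlgebra IC)] [∀ i, Module.Finite k (BoundAlgebra (I i))]

/-- The radical pieces already occur at `n = 0`, as summands of the restricted syzygy of the simple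
modules outside the part. -/
theorem IsGluing.radicalSpan_le_orbitSubgroup : h.radicalSpan ≤ orbitSubgroup I IC := by
  refine (AddSubgroup.closure_le _).2 ?_
  rintro _ ⟨j, w, hw, rfl⟩
  obtain ⟨K, hs, hK, hsum⟩ := h.exists_isSyzygy_simples j
  refine AddSubgroup.subset_closure ⟨j, 0, _, _, _, _,
    ⟨fun l => charSum (boundChar (hI l)), fun l => inflMod (h.surj l) (charSum (boundChar (hI l))),
      K, fun l => (hI l).isSplitBasic.isSumOfSimples, fun l => h.isInflation_inflMod l _, hs,
      h.isRestriction_piece hK j⟩, IsIterSyzygy.zero (LinearEquiv.refl _ _), hsum w hw, ?_, rfl⟩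
  exact h.isInflation_of_equiv (inflDescEquiv (h.surj j) (h.isKilled_radicalPiece j w))

/-- Up to radical pieces, the syzygy over `C` of a summand `X` of `Ωⁿ(N)` is its syzygy over `A i`.
The latter is a summand of `Ωⁿ⁺¹(N)`, as syzygies of direct sums split. -/
theorem IsGluing.omegaBar_mem_orbitSubgroup {x : K0 (BoundAlgebra IC)}
    (hx : x ∈ orbitSubgroup I IC) : omegaBar (BoundAlgebra IC) x ∈ orbitSubgroup I IC := by
  refine (AddSubgroup.closure_le (K := (orbitSubgroup I IC).comap
    (omegaBar (BoundAlgebra IC)))).2 ?_ hx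
  rintro _ ⟨i, n, N, L, X, W, hN, hL, ⟨Y, ⟨E⟩⟩, hW, rfl⟩
  change omegaBar (BoundAlgebra IC) (K0.mk W) ∈ orbitSubgroup I IC
  obtain ⟨ΩX, hX, hd⟩ := h.exists_isSyzygy i X
  obtain ⟨ΩY, hY, -⟩ := h.exists_isSyzygy i Y
  rw [h.mk_eq_of_isInflation hW, ← sub_add_cancel (omegaBar (BoundAlgebra IC) _)
    (K0.mk (inflMod (h.surj i) ΩX))]
  refine add_mem (h.radicalSpan_le_orbitSubgroup hd) (AddSubgroup.subset_closure
    ⟨i, n + 1, N, _, ΩX, _, hN, hL.succ (IsSyzygy.prod E hX hY),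
      ⟨ΩY, ⟨LinearEquiv.refl _ _⟩⟩, h.isInflation_inflMod i ΩX, rfl⟩)

end OrbitSubgroup

end BoundQuiver



theorem theorem3p2 {k : Type u} [Field k] {m : ℕ}
    -- the bound quivers `(Q i, I i)` and the finite dimensional algebras `A i = k(Q i) / I i`
    (Q : Fin m → Type u) [∀ i, Fintype (Q i)] [∀ i, Quiver.{u} (Q i)]
    (I : ∀ i, Ideal (PathAlgebra k (Q i))) [∀ i, (I i).IsTwoSided]
    [∀ i, Module.Finite k (BoundAlgebra (I i))]
    (hI : ∀ i, IsAdmissible (I i))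
    -- the connecting arrows, the glued quiver `Γ` and the algebra `C = kΓ / IC`
    (D : ∀ i j : Fin m, Q i → Q j → Type u)
    (IC : Ideal (PathAlgebra k (Glued Q D))) [IC.IsTwoSided]
    [Module.Finite k (BoundAlgebra IC)]
    (hIC : IsAdmissible IC)
    -- `IC ∩ k(Q i) = I i`
    (hres : ∀ i (x : PathAlgebra k (Q i)), incl Q D k i x ∈ IC ↔ x ∈ I i)
    -- an arrow of some `Q i` followed by a connecting arrow is zero in `C`
    (hinner : ∀ (i j : Fin m) (hij : i ≠ j) (u v : Q i) (w : Q j) (α : u ⟶ v) (δ : D i j v w),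
      ofArrow k (innerArrow Q D α) * ofArrow k (connArrow Q D hij δ) ∈ IC)
    -- a connecting arrow followed by a connecting arrow is zero in `C`
    (hconn : ∀ (i j l : Fin m) (hij : i ≠ j) (hjl : j ≠ l) (u : Q i) (v : Q j) (w : Q l)
      (δ : D i j u v) (δ' : D j l v w),
      ofArrow k (connArrow Q D hij δ) * ofArrow k (connArrow Q D hjl δ') ∈ IC)
    (hO : IsSyzygyFinite (orbitSubgroup I IC))
    (hφ : ∀ i, phiDim (BoundAlgebra (I i)) < ⊤) :
    phiDim (BoundAlgebra IC) < ⊤ := by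
  have h := isGluing_vertexIdem hres hinner hconn hI hIC
    fun i _ hz => restr_mem hinner hconn hres i hz
  have := isArtinianRing_mop k (BoundAlgebra IC)
  have := fun i => isArtinianRing_mop k (BoundAlgebra (I i))
  exact h.phiDim_lt_top (orbitSubgroup I IC) h.radicalSpan_le_orbitSubgroup
    h.orbitSubgroup_le_inflSpan (fun _ hx => h.omegaBar_mem_orbitSubgroup hx) hO hφ
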